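/- **Setting.** For every $n$ let $N=N_n$, $T=T_n$ be positive integers with $T\to\infty$, $N\to\infty$, $T/N\to 0$ as $n\to\infty$; $p,r\ge 0$ are fixed. All objects below may depend on $n$. Let $$Y_{it}=\mu_i+\beta_i^\top X_t+\varepsilon_{it},\qquad \varepsilon_{it}=\gamma_i^\top Z_t+\eta_{it}\qquad(1\le i\le N,\ 1\le t\le T),$$ with non-random $\mu_i\in\mathbb R$, $\beta_i\in\mathbb R^p$, $\gamma_i\in\mathbb R^r$, where the latent factors $Z_t$ are i.i.d. $\mathbb N(0,I_r)$, the idiosyncratic errors $\eta_{\cdot t}=(\eta_{1t},\dots,\eta_{Nt})^\top$ are i.i.d. $\mathbb N(0,\Sigma_\eta)$ with $\Sigma_\eta=(\sigma_{ij})$, the processes $(X_t)$, $(Z_t)$, $(\eta_{\cdot t})$ are mutually independent, $E(X_{jt})=0$ and $\mathrm{var}(Y_{it})=1$. Write $\boldsymbol\mu=(\mu_1,\dots,\mu_N)^\top$, $\gamma=(\gamma_1,\dots,\gamma_N)^\top$, $\mathbb X=(X_1,\dots,X_T)^\top$, $\mathbb Y=(Y_{it})\in\mathbb R^{N\times T}$,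 $\mathcal E=(\varepsilon_{it})\in\mathbb R^{N\times T}$, $\Sigma_{\mathcal E}=\gamma\gamma^\top+\Sigma_\eta$, $\rho_{ij}=\sigma_{ij}/(\sigma_{ii}\sigma_{jj})^{1/2}$, $N_0=\#\{i:\mu_i=0\}$, $N_1=N-N_0$, and let $\mathbf 1\in\mathbb R^T$ be the vector of ones. For a matrix $A$ with $T$ rows let $\mathcal Q(A)=I_T-A(A^\top A)^{-1}A^\top$, and put $\mathcal Q=\mathcal Q(\mathbb X)$; with probability tending to one $\mathbb X^\top\mathbb X$ is invertible and $\mathbf 1^\top\mathcal Q\mathbf 1\neq0$. **Procedure.** Let $\widehat\mu_i=(\mathbf 1^\top\mathcal Q\mathbf 1)^{-1}\mathbf 1^\top\mathcal Q(Y_{i1},\dots,Y_{iT})^\top$ and $\widehat{\mathcal E}^\top=\mathcal Q\mathbb Y^\top$. Let $\widehat{\mathbf Z}=T^{1/2}(\widehat\varrho_1,\dots,\widehat\varrho_r)$, where $\widehat\varrho_1,\dots,\widehat\varrho_r$ are orthonormal eigenvectors of $(TN)^{-1}\widehat{\mathcal E}^\top\widehat{\mathcal E}$ for its $r$ largest eigenvalues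 (the number $r$ of factors is known; any choice of eigenvectors is allowed), $\widehat\gamma^\top=(\widehat{\mathbf Z}^\top\widehat{\mathbf Z})^{-1}\widehat{\mathbf Z}^\top\widehat{\mathcal E}^\top$ with rows $\widehat\gamma_i^\top$ of $\widehat\gamma$, $\widehat\eta^\top=\mathcal Q(\widehat{\mathbf Z})\widehat{\mathcal E}^\top$ with rows $\widehat\eta_{i\cdot}$ of $\widehat\eta$, and $\widehat\sigma_{ii}=T^{-1}\|\widehat\eta_{i\cdot}\|^2$. The factor-adjusted statistics and p-values are $$\widehat T_i=\frac{(\mathbf 1^\top\mathcal Q\mathbf 1)^{1/2}\widehat\mu_i-(\mathbf 1^\top\mathcal Q\mathbf 1)^{-1/2}\mathbf 1^\top\mathcal Q\widehat{\mathbf Z}\widehat\gamma_i}{\widehat\sigma_{ii}^{1/2}},\qquad P_i=2\Phi(-|\widehat T_i|),$$ where $\Phi$ is the standard normal distribution function. Let $R(t)=\#\{i:P_i\le t\}$, $V(t)=\#\{i:\mu_i=0,\ P_i\le t\}$, $\mathrm{FDP}(t)=V(t)/\max\{R(t),1\}$ and, for $\lambda\in[0,1)$, $$\widehat{\mathrm{FDR}}_\lambda(t)=\frac{N\,\widehat\pi_0(\lambda)\,t}{\max\{R(t),1\}},\qquad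 \widehat\pi_0(\lambda)=\frac{N-R(\lambda)}{(1-\lambda)N}.$$ **Conditions.** Sparsity: $\pi_0=\lim N_0/N=1$. Weak dependence: $N^{-2+\delta}\sum_{i\ne j}|\rho_{ij}|=O(1)$ for some $\delta>0$. - (C1) $\log N\le C_\hbar T^{\hbar}$ for some constants $0<\hbar<1/2$ and $C_\hbar>0$. - (C2) $\|\boldsymbol\mu\|\le C_\mu\min\{N^{1/2}/T^{1/2},\,N/(TN_1^{1/2})\}$ for some constant $C_\mu>0$ (if $N_1=0$, then $\boldsymbol\mu=0$ and the condition is void). - (C3) $\min_i\sigma_{ii}\ge\sigma_0^2$ for some constant $\sigma_0^2>0$. - (C4) $N^{-1}\gamma^\top\gamma\to\Sigma_\gamma$ for some positive definite $r\times r$ matrix $\Sigma_\gamma$, and $\max_i\|\gamma_i\|^2\le\gamma_{\max}$ for some constant $\gamma_{\max}$. - (C5) $\max_{i\le r}\|\overline\psi_i-\psi_i\|=O_p(N^{-\nu})$ for some constant $\nu>0$, where $\overline\psi_i$ and $\psi_i$ are suitably chosen orthonormal eigenvectors for the $i$-th largest eigenvalues of $T^{-1}\mathcal E\mathcal E^\top$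 and $\Sigma_{\mathcal E}$. - (C6) There is $H>0$ such that $R(t)/N\ge H$ with probability tending to one. Conditions (C1)–(C4) and the existence of the eigenvectors in (C5) and of $\widehat\varrho_1,\dots,\widehat\varrho_r$ are required for all sufficiently large $n$. **Theorem 1.** Under these conditions, for every fixed $\lambda\in[0,1)$ and every fixed threshold $t\in(0,1]$ (with (C6) holding at $t$), $$\big|\widehat{\mathrm{FDR}}_\lambda(t)-\mathrm{FDP}(t)\big|=O_p(N^{-\delta/2})+O_p\big(\sqrt{\log N}/\sqrt T\big)+O_p(N^{-\nu})+O_p(N_1/N)+O_p\big(N^{-1}T\|\boldsymbol\mu\|^2\big)+O_p\big(N_1^{1/2}N^{-1}T\|\boldsymbol\mu\|\big),$$ and $\widehat{\mathrm{FDR}}_\lambda(t)$ is consistent for $\mathrm{FDP}(t)$, i.e. $\widehat{\mathrm{FDR}}_\lambda(t)-\mathrm{FDP}(t)\to0$ in probability. -/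

import Mathlib

open MeasureTheory ProbabilityTheory Filter Topology Matrix

noncomputable section

namespace FAT

/-! Stochastic order symbols for triangular arrays. The `n`-th variable lives on its own
probability space `Ω n`. -/

/-- The event `A n` has probability tending to one. -/
def WithHighProb {Ω : ℕ → Type*} [∀ n, MeasurableSpace (Ω n)] (P : ∀ n, Measure (Ω n))
    (A : ∀ n, Set (Ω n)) : Prop :=
  Tendsto (fun n => P n (A n)ᶜ) atTop (𝓝 0)

/-- `X n = O_p(a n)`. -/
def IsBigOInProb {Ω : ℕ → Type*} [∀ n, MeasurableSpace (Ω n)] (P : ∀ n, Measure (Ω n))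
    (X : ∀ n, Ω n → ℝ) (a : ℕ → ℝ) : Prop :=
  ∀ ε : ℝ, 0 < ε → ∃ C : ℝ, 0 < C ∧
    ∀ᶠ n in atTop, P n {ω | C * a n < |X n ω|} ≤ ENNReal.ofReal ε

/-- `X n` converges to zero in probability. -/
def TendstoZeroInProb {Ω : ℕ → Type*} [∀ n, MeasurableSpace (Ω n)] (P : ∀ n, Measure (Ω n))
    (X : ∀ n, Ω n → ℝ) : Prop :=
  ∀ ε : ℝ, 0 < ε → Tendsto (fun n => P n {ω | ε ≤ |X n ω|}) atTop (𝓝 0)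

/-- `v` lists orthonormal eigenvectors of the symmetric matrix `A` belonging to its `k` largest
eigenvalues (counted with multiplicity), in decreasing order of the eigenvalues: `v` is the
initial part of an orthonormal eigenbasis whose eigenvalues `d` are in decreasing order. -/
def IsLeadingEigenvectors {m k : ℕ} (A : Matrix (Fin m) (Fin m) ℝ)
    (v : Fin k → EuclideanSpace ℝ (Fin m)) : Prop :=
  ∃ (b : OrthonormalBasis (Fin m) ℝ (EuclideanSpace ℝ (Fin m))) (d : Fin m → ℝ) (h : k ≤ m),
    Antitone d ∧ (∀ j, A *ᵥ (b j).ofLp = d j • (b j).ofLp) ∧ ∀ j, v j = b (Fin.castLE h j)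

/-- The standard normal distribution function `Φ`. -/
def stdNormalCDF (x : ℝ) : ℝ := cdf (gaussianReal 0 1) x

/-! The factor-adjusted procedure, computed from a design matrix `X` (`T × p`), a response matrix
`Y` (`N × T`) and `r` leading eigenvectors `v`. -/

section Procedure

variable {N T p r : ℕ}

/-- `I - X (Xᵀ X)⁻¹ Xᵀ`. -/
def residualMaker {k : ℕ} (X : Matrix (Fin T) (Fin k) ℝ) : Matrix (Fin T) (Fin T) ℝ :=
  1 - X * (Xᵀ * X)⁻¹ * Xᵀ

/-- The number `1ᵀ Q 1`, where `Q` is the residual maker of the design. -/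
def oneQOne (X : Matrix (Fin T) (Fin p) ℝ) : ℝ :=
  (1 : Fin T → ℝ) ⬝ᵥ (residualMaker X *ᵥ 1)

/-- The least squares intercept `(1ᵀ Q 1)⁻¹ 1ᵀ Q Y_i` of unit `i`. -/
def muHat (X : Matrix (Fin T) (Fin p) ℝ) (Y : Matrix (Fin N) (Fin T) ℝ) (i : Fin N) : ℝ :=
  (oneQOne X)⁻¹ * ((1 : Fin T → ℝ) ⬝ᵥ (residualMaker X *ᵥ Y i))

/-- The residual matrix `Ê` (`N × T`), `Êᵀ = Q Yᵀ`. -/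
def residual (X : Matrix (Fin T) (Fin p) ℝ) (Y : Matrix (Fin N) (Fin T) ℝ) :
    Matrix (Fin N) (Fin T) ℝ :=
  (residualMaker X * Yᵀ)ᵀ

/-- The matrix `(T N)⁻¹ Êᵀ Ê` (`T × T`) whose leading eigenvectors are extracted. -/
def pcaMatrix (X : Matrix (Fin T) (Fin p) ℝ) (Y : Matrix (Fin N) (Fin T) ℝ) :
    Matrix (Fin T) (Fin T) ℝ :=
  ((T : ℝ) * N)⁻¹ • ((residual X Y)ᵀ * residual X Y)

/-- The estimated factors `Ẑ = T^{1/2} (v_1, …, v_r)` (`T × r`). -/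
def factorHat (v : Fin r → EuclideanSpace ℝ (Fin T)) : Matrix (Fin T) (Fin r) ℝ :=
  Matrix.of fun t k => √(T : ℝ) * v k t

/-- The estimated loadings `γ̂` (`N × r`), `γ̂ᵀ = (Ẑᵀ Ẑ)⁻¹ Ẑᵀ Êᵀ`. -/
def loadingHat (X : Matrix (Fin T) (Fin p) ℝ) (Y : Matrix (Fin N) (Fin T) ℝ)
    (v : Fin r → EuclideanSpace ℝ (Fin T)) : Matrix (Fin N) (Fin r) ℝ :=
  (((factorHat v)ᵀ * factorHat v)⁻¹ * (factorHat v)ᵀ * (residual X Y)ᵀ)ᵀ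

/-- The estimated idiosyncratic errors `η̂` (`N × T`), `η̂ᵀ = (I - Ẑ (Ẑᵀ Ẑ)⁻¹ Ẑᵀ) Êᵀ`. -/
def noiseHat (X : Matrix (Fin T) (Fin p) ℝ) (Y : Matrix (Fin N) (Fin T) ℝ)
    (v : Fin r → EuclideanSpace ℝ (Fin T)) : Matrix (Fin N) (Fin T) ℝ :=
  (residualMaker (factorHat v) * (residual X Y)ᵀ)ᵀ

/-- The estimated idiosyncratic variance `T⁻¹ η̂_iᵀ η̂_i` of unit `i`. -/
def varHat (X : Matrix (Fin T) (Fin p) ℝ) (Y : Matrix (Fin N) (Fin T) ℝ)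
    (v : Fin r → EuclideanSpace ℝ (Fin T)) (i : Fin N) : ℝ :=
  (T : ℝ)⁻¹ * (noiseHat X Y v i ⬝ᵥ noiseHat X Y v i)

/-- The factor-adjusted test statistic of unit `i`. -/
def testStat (X : Matrix (Fin T) (Fin p) ℝ) (Y : Matrix (Fin N) (Fin T) ℝ)
    (v : Fin r → EuclideanSpace ℝ (Fin T)) (i : Fin N) : ℝ :=
  (√(oneQOne X) * muHat X Y i -
      (√(oneQOne X))⁻¹ *
        ((1 : Fin T → ℝ) ⬝ᵥ (residualMaker X *ᵥ (factorHat v *ᵥ loadingHat X Y v i)))) /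
    √(varHat X Y v i)

/-- The factor-adjusted p-value of unit `i`. -/
def pValue (X : Matrix (Fin T) (Fin p) ℝ) (Y : Matrix (Fin N) (Fin T) ℝ)
    (v : Fin r → EuclideanSpace ℝ (Fin T)) (i : Fin N) : ℝ :=
  2 * stdNormalCDF (-|testStat X Y v i|)

/-- `R(t)`: the number of p-values that are at most `t`. -/
def rejections (q : Fin N → ℝ) (t : ℝ) : ℕ :=
  (Finset.univ.filter fun i => q i ≤ t).card

/-- `V(t)`: the number of true nulls (`μ_i = 0`) whose p-value is at most `t`. -/
def falseRejections (μ q : Fin N → ℝ) (t : ℝ) : ℕ :=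
  (Finset.univ.filter fun i => μ i = 0 ∧ q i ≤ t).card

/-- The false discovery proportion `V(t) / (R(t) ∨ 1)`. -/
def FDP (μ q : Fin N → ℝ) (t : ℝ) : ℝ :=
  (falseRejections μ q t : ℝ) / max (rejections q t : ℝ) 1

/-- Storey's estimate `{(1 - lam) N}⁻¹ {N - R(lam)}` of the proportion of true nulls. -/
def nullProportionHat (q : Fin N → ℝ) (lam : ℝ) : ℝ :=
  ((1 - lam) * N)⁻¹ * ((N : ℝ) - rejections q lam)

/-- The Storey-type estimate of the false discovery rate at threshold `t`. -/
def FDRHat (q : Fin N → ℝ) (lam t : ℝ) : ℝ :=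
  N * nullProportionHat q lam * t / max (rejections q t : ℝ) 1

end Procedure

/-- The panel model with `N` units, `T` observations, `p` observed and `r` latent factors:
`Y_it = μ_i + β_iᵀ X_t + γ_iᵀ Z_t + η_it`, where the `Z_t` are i.i.d. `N(0, I_r)`, the `η_t` are
i.i.d. `N(0, Σ_η)`, the processes `X`, `Z` and `η` are mutually independent, `E X_t = 0` and
`var Y_it = 1`. -/
structure Panel (N T p r : ℕ) (Ω : Type*) [MeasurableSpace Ω] (P : Measure Ω) where
  /-- The intercepts. -/
  mu : EuclideanSpace ℝ (Fin N)
  /-- The regression coefficients. -/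
  beta : Matrix (Fin N) (Fin p) ℝ
  /-- The factor loadings. -/
  gamma : Matrix (Fin N) (Fin r) ℝ
  /-- The covariance matrix of the idiosyncratic errors. -/
  SigmaEta : Matrix (Fin N) (Fin N) ℝ
  /-- The observed explanatory variables. -/
  X : Fin T → Ω → EuclideanSpace ℝ (Fin p)
  /-- The latent factors. -/
  Z : Fin T → Ω → EuclideanSpace ℝ (Fin r)
  /-- The idiosyncratic errors. -/
  eta : Fin T → Ω → EuclideanSpace ℝ (Fin N)
  posSemidef_SigmaEta : SigmaEta.PosSemidef
  measurable_X : ∀ t, Measurable (X t)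
  measurable_Z : ∀ t, Measurable (Z t)
  measurable_eta : ∀ t, Measurable (eta t)
  integrable_X : ∀ t j, Integrable (fun ω => X t ω j) P
  mean_X : ∀ t j, ∫ ω, X t ω j ∂P = 0
  law_Z : ∀ t, HasLaw (Z t) (stdGaussian (EuclideanSpace ℝ (Fin r))) P
  law_eta : ∀ t, HasLaw (eta t) (multivariateGaussian 0 SigmaEta) P
  indep_Z : iIndepFun Z P
  indep_eta : iIndepFun eta P
  indep_Z_eta : IndepFun (fun ω t => Z t ω) (fun ω t => eta t ω) P
  indep_X : IndepFun (fun ω t => X t ω) (fun ω => (fun t => Z t ω, fun t => eta t ω)) P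
  var_Y : ∀ i t, variance (fun ω =>
    mu i + beta i ⬝ᵥ (X t ω).ofLp + gamma i ⬝ᵥ (Z t ω).ofLp + eta t ω i) P = 1

namespace Panel

variable {N T p r : ℕ} {Ω : Type*} [MeasurableSpace Ω] {P : Measure Ω} (M : Panel N T p r Ω P)

/-- The composite error `ε_it = γ_iᵀ Z_t + η_it`, as an `N × T` matrix. -/
def error (ω : Ω) : Matrix (Fin N) (Fin T) ℝ :=
  Matrix.of fun i t => M.gamma i ⬝ᵥ (M.Z t ω).ofLp + M.eta t ω i

/-- The response matrix (`N × T`). -/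
def Y (ω : Ω) : Matrix (Fin N) (Fin T) ℝ :=
  Matrix.of fun i t => M.mu i + M.beta i ⬝ᵥ (M.X t ω).ofLp + M.error ω i t

/-- The design matrix (`T × p`). -/
def design (ω : Ω) : Matrix (Fin T) (Fin p) ℝ :=
  Matrix.of fun t j => M.X t ω j

/-- The covariance matrix `γ γᵀ + Σ_η` of the composite error of one time point. -/
def SigmaE : Matrix (Fin N) (Fin N) ℝ := M.gamma * M.gammaᵀ + M.SigmaEta

/-- The correlation of `η_it` and `η_jt`. -/
def corr (i j : Fin N) : ℝ :=
  M.SigmaEta i j / √(M.SigmaEta i i * M.SigmaEta j j)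

/-- The number `N₁` of false nulls. -/
def N1 : ℕ := (Finset.univ.filter fun i => M.mu i ≠ 0).card

/-- The number `N₀` of true nulls. -/
def N0 : ℕ := (Finset.univ.filter fun i => M.mu i = 0).card

/-- The factor-adjusted p-values, with eigenvectors `v` of the matrix `(T N)⁻¹ Êᵀ Ê`. -/
def pVal (v : Ω → Fin r → EuclideanSpace ℝ (Fin T)) (ω : Ω) : Fin N → ℝ :=
  pValue (M.design ω) (M.Y ω) (v ω)

end Panel

end FAT

end

open MeasureTheory ProbabilityTheory Filter Topology Matrix
noncomputable section
namespace FAT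
set_option linter.unusedSectionVars false

/-! ### Operator norms of real matrices. -/

section MatrixNorms

open scoped Matrix.Norms.L2Operator

variable {n t k l : Type*} [Fintype n] [Fintype t] [Fintype k] [Fintype l]
  [DecidableEq n] [DecidableEq t] [DecidableEq k] [DecidableEq l]

/-! Since R(t) ≥ HN with high probability, the difference of the estimate and the false discovery
proportion is a bounded factor times t(1 − R(λ)/N)/(1 − λ) − V(t)/N. As R(λ) exceeds V(λ) by at most
N₁, everything reduces to showing that V(s)/N − s is small at s = λ and s = t
(`abs_FDRHat_sub_FDP_le`, `isBigOInProb_falseRejections`).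

Let Q be the residual maker of the design and w the unit vector along Q1. The ideal statistic of
unit i is ξᵢ = wᵀηᵢ/√σᵢᵢ. Given the design it is standard normal, and ξᵢ, ξⱼ have correlation ρᵢⱼ.
Two exceedance indicators have covariance O(|ρᵢⱼ|) (`abs_prob_inter_sub_le`), so the number of
exceedances of the critical value deviates from Ns by O(Nκ), where (Nκ)² = ∑|ρᵢⱼ| (`corrRoot`). An
error of size b in the statistics affects only units with |ξᵢ| within b of the critical value. Their
expected number is at most 4Nb.

It remains to compare the statistics of the true nulls with the ξᵢ. Rescaled by (NT)^(-1/2), the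
residual matrix is F = m wᵀ + (G Zᵀ + E)Q, and the estimated factors span the leading right singular
vectors V of F. The small quantities are θ = T^(-1/2), κ, h = √(θ² + κ) and the bounded q =
√T‖μ‖/√N. With u = w − VVᵀw, the numerator of the statistic is √T uᵀQ(Z gᵢ + yᵢ). It misses wᵀηᵢ by
√T times (Zᵀu)ᵀgᵢ − (wᵀV)(Vᵀyᵢ). The vector u is orthogonal to V, so (FV)ᵀFu = 0. Since FV is G(ZᵀV)
up to noise, this equation can be solved for Zᵀu and shows that it is of second order, θ(θ + κ + qh)
(`exists_right_inverse`, `norm_Z_residualDir`). The eigenvalues enter only through a lower bound,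
which follows from the min-max principle on the span of QZ (`exists_leading_eigenvalues`,
`norm_residualForm_mul_ge`).

This analysis is deterministic (`PCASystem`). The bounds it needs are collected in `GoodDraw`.
Conditionally on the independent design, most follow from Markov's inequality and second or fourth
Gaussian moments (Isserlis' formula). The two that hold uniformly over the units follow from
exponential tails, which is where √(log N/T) comes from (`prob_not_goodDraw`). The resulting rate
√(log N/T) + κ + qh is finally expressed through N, T and ‖μ‖ in `eventually_adjustmentRate_le`. -/

lemma norm_transpose_eq (A : Matrix n t ℝ) : ‖Aᵀ‖ = ‖A‖ := by
  rw [← Matrix.conjTranspose_eq_transpose_of_trivial, Matrix.l2_opNorm_conjTranspose]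

lemma norm_transpose_mul_self_eq (A : Matrix n t ℝ) : ‖Aᵀ * A‖ = ‖A‖ ^ 2 := by
  rw [← Matrix.conjTranspose_eq_transpose_of_trivial, Matrix.l2_opNorm_conjTranspose_mul_self, sq]

lemma norm_matrix_mul_le_of_le {A : Matrix n t ℝ} {B : Matrix t k ℝ} {a b : ℝ} (hA : ‖A‖ ≤ a)
    (hB : ‖B‖ ≤ b) : ‖A * B‖ ≤ a * b :=
  (Matrix.l2_opNorm_mul A B).trans
    (mul_le_mul hA hB (norm_nonneg _) ((norm_nonneg _).trans hA))

lemma norm_one_matrix_le : ‖(1 : Matrix k k ℝ)‖ ≤ 1 := by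
  rw [← Matrix.diagonal_one, Matrix.l2_opNorm_diagonal]
  exact (pi_norm_le_iff_of_nonneg zero_le_one).2 fun i => by simp

lemma norm_le_one_of_transpose_mul_self_eq_one {V : Matrix t k ℝ} (hV : Vᵀ * V = 1) :
    ‖V‖ ≤ 1 := by
  have h := norm_transpose_mul_self_eq V
  rw [hV] at h
  nlinarith [norm_one_matrix_le (k := k), norm_nonneg V]

/-- Symmetry and idempotence turn the C*-identity into ‖Q‖ = ‖Q‖². -/
lemma norm_le_one_of_idem {Q : Matrix t t ℝ} (hQ : Qᵀ = Q) (hQ2 : Q * Q = Q) : ‖Q‖ ≤ 1 := by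
  have h := norm_transpose_mul_self_eq Q
  rw [hQ, hQ2] at h
  nlinarith [norm_nonneg Q]

lemma norm_unit_matrix (A : Matrix Unit Unit ℝ) : ‖A‖ = |A () ()| := by
  have h : A = Matrix.diagonal fun _ => A () () := by ext i j; simp
  rw [h, Matrix.l2_opNorm_diagonal]
  simp

/-- Cauchy–Schwarz in each row. Sums of squared entries are what moment computations control, so
this is the bridge from probability to operator norms. -/
lemma norm_sq_le_sum_sq (A : Matrix n t ℝ) : ‖A‖ ^ 2 ≤ ∑ i, ∑ j, A i j ^ 2 := by
  have h0 : 0 ≤ ∑ i, ∑ j, A i j ^ 2 := by positivity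
  have h : ‖A‖ ≤ √(∑ i, ∑ j, A i j ^ 2) := by
    rw [Matrix.l2_opNorm_def]
    refine ContinuousLinearMap.opNorm_le_bound _ (Real.sqrt_nonneg _) fun x => ?_
    rw [EuclideanSpace.norm_eq, EuclideanSpace.norm_eq, ← Real.sqrt_mul h0]
    refine Real.sqrt_le_sqrt ?_
    rw [Finset.sum_mul]
    refine Finset.sum_le_sum fun i _ => ?_
    simp only [Real.norm_eq_abs, sq_abs]
    exact Finset.sum_mul_sq_le_sq_mul_sq Finset.univ (fun j => A i j) (fun j => x j)
  calc ‖A‖ ^ 2 ≤ (√(∑ i, ∑ j, A i j ^ 2)) ^ 2 := by gcongr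
    _ = _ := Real.sq_sqrt h0

lemma norm_col_sq (x : Matrix t Unit ℝ) : ‖x‖ ^ 2 = ∑ i, x i () ^ 2 := by
  rw [← norm_transpose_mul_self_eq, norm_unit_matrix, abs_of_nonneg]
  · simp [Matrix.mul_apply, sq]
  · simp only [Matrix.mul_apply, Matrix.transpose_apply]
    exact Finset.sum_nonneg fun i _ => mul_self_nonneg _

lemma norm_le_of_sum_sq_le {A : Matrix n t ℝ} {c : ℝ} (hc : 0 ≤ c)
    (h : ∑ i, ∑ j, A i j ^ 2 ≤ c ^ 2) : ‖A‖ ≤ c :=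
  (sq_le_sq₀ (norm_nonneg _) hc).1 ((norm_sq_le_sum_sq A).trans h)

end MatrixNorms

/-! ### Leading eigenvectors and the min-max principle. -/

section Eigen

variable {T r : ℕ}

lemma quadratic_form_eq_sum {A : Matrix (Fin T) (Fin T) ℝ}
    (b : OrthonormalBasis (Fin T) ℝ (EuclideanSpace ℝ (Fin T))) {d : Fin T → ℝ}
    (h : ∀ j, A *ᵥ (b j).ofLp = d j • (b j).ofLp) (x : EuclideanSpace ℝ (Fin T)) :
    x.ofLp ⬝ᵥ (A *ᵥ x.ofLp) = ∑ j, d j * (inner ℝ (b j) x) ^ 2 := by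
  have hx : x.ofLp = ∑ j, (inner ℝ (b j) x) • (b j).ofLp := by
    conv_lhs => rw [← b.sum_repr' x]
    simp
  have hi : ∀ j, x.ofLp ⬝ᵥ (b j).ofLp = inner ℝ (b j) x := fun j => by
    simp [PiLp.inner_apply, dotProduct]
  conv_lhs => rw [show A *ᵥ x.ofLp = ∑ j, (inner ℝ (b j) x) • (d j • (b j).ofLp) by
    conv_lhs => rw [hx]
    rw [Matrix.mulVec_sum]
    simp_rw [Matrix.mulVec_smul, h]]
  rw [dotProduct_sum]
  refine Finset.sum_congr rfl fun j _ => ?_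
  rw [dotProduct_smul, dotProduct_smul, hi]
  simp only [smul_eq_mul]; ring

/-- The leading eigenvalues are bounded below by the quadratic form on any `r`-dimensional
subspace. -/
lemma exists_leading_eigenvalues {A : Matrix (Fin T) (Fin T) ℝ}
    {v : Fin r → EuclideanSpace ℝ (Fin T)} (hv : IsLeadingEigenvectors A v)
    {U : Matrix (Fin T) (Fin r) ℝ} {c : ℝ}
    (hU : ∀ y : Fin r → ℝ, U *ᵥ y = 0 → y = 0)
    (hA : ∀ y : Fin r → ℝ,
      c * ((U *ᵥ y) ⬝ᵥ (U *ᵥ y)) ≤ (U *ᵥ y) ⬝ᵥ (A *ᵥ (U *ᵥ y))) :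
    ∃ d : Fin r → ℝ, (∀ j, c ≤ d j) ∧
      (Matrix.of fun t j => v j t)ᵀ * (Matrix.of fun t j => v j t) = 1 ∧
      A * (Matrix.of fun t j => v j t) = (Matrix.of fun t j => v j t) * Matrix.diagonal d := by
  obtain ⟨b, d, hr, hd, hb, hvb⟩ := hv
  refine ⟨fun j => d (Fin.castLE hr j), fun i => ?_, ?_, ?_⟩
  -- The eigenvalue with index `i` is tested on a vector in the range of `U` orthogonal to the `i`
  -- eigenvectors before it: `i` linear conditions on `r > i` unknowns leave a nonzero solution.
  · let L : (Fin r → ℝ) →ₗ[ℝ] (Fin i.1 → ℝ) :=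
      { toFun := fun y j => (b ⟨j.1, by omega⟩).ofLp ⬝ᵥ (U *ᵥ y)
        map_add' := fun x y => by ext j; simp [Matrix.mulVec_add, dotProduct_add]
        map_smul' := fun a y => by ext j; simp [Matrix.mulVec_smul, dotProduct_smul] }
    have hker : LinearMap.ker L ≠ ⊥ := LinearMap.ker_ne_bot_of_finrank_lt (by simp)
    obtain ⟨y, hy, hy0⟩ := (Submodule.ne_bot_iff _).1 hker
    set x : EuclideanSpace ℝ (Fin T) := WithLp.toLp 2 (U *ᵥ y) with hx
    have hxy : U *ᵥ y = x.ofLp := rfl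
    have hperp : ∀ j : Fin T, j.1 < i.1 → inner ℝ (b j) x = 0 := fun j hj => by
      have h1 := congrFun (LinearMap.mem_ker.1 hy) ⟨j.1, hj⟩
      have h2 : inner ℝ (b j) x = (b j).ofLp ⬝ᵥ (U *ᵥ y) := by
        simp [PiLp.inner_apply, dotProduct, hx, mul_comm]
      rw [h2]; exact h1
    have hxx : x.ofLp ⬝ᵥ x.ofLp = ∑ j, (inner ℝ (b j) x) ^ 2 := by
      have h1 := b.sum_sq_norm_inner_right x
      simp only [Real.norm_eq_abs, sq_abs] at h1
      rw [h1, EuclideanSpace.real_norm_sq_eq, dotProduct]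
      simp [sq]
    have hpos : 0 < x.ofLp ⬝ᵥ x.ofLp := by
      have h1 : 0 ≤ x.ofLp ⬝ᵥ x.ofLp := by rw [hxx]; positivity
      refine lt_of_le_of_ne h1 fun h2 => hy0 (hU y ?_)
      rw [hxy]; exact dotProduct_self_eq_zero.1 h2.symm
    have h1 := hA y
    rw [hxy, quadratic_form_eq_sum b hb] at h1
    -- Components before `i` vanish, and from `i` on no eigenvalue exceeds the one at `i`.
    have h2 : ∑ j, d j * (inner ℝ (b j) x) ^ 2 ≤
        ∑ j, d (Fin.castLE hr i) * (inner ℝ (b j) x) ^ 2 := by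
      refine Finset.sum_le_sum fun j _ => ?_
      rcases lt_or_ge j.1 i.1 with hj | hj
      · simp [hperp j hj]
      · exact mul_le_mul_of_nonneg_right (hd (by simpa [Fin.le_def] using hj)) (sq_nonneg _)
    rw [← Finset.mul_sum, ← hxx] at h2
    exact le_of_mul_le_mul_right (h1.trans h2) hpos
  · ext i j
    have h1 : ((Matrix.of fun t j => v j t)ᵀ * (Matrix.of fun t j => v j t)) i j
        = inner ℝ (v j) (v i) := by
      simp [Matrix.mul_apply, PiLp.inner_apply]
    rw [h1, hvb, hvb, orthonormal_iff_ite.1 b.orthonormal]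
    simp [Matrix.one_apply, eq_comm]
  · ext i j
    have h1 := congrFun (hb (Fin.castLE hr j)) i
    rw [← hvb] at h1
    simp only [Matrix.mul_diagonal, Matrix.of_apply]
    rw [Matrix.mul_apply]
    simpa [Matrix.mulVec, dotProduct, mul_comm] using h1

end Eigen

/-! ### Deterministic perturbation analysis of the principal components. -/

section PCA

open scoped Matrix.Norms.L2Operator

variable {n t k : Type*} [Fintype n] [Fintype t] [Fintype k]
  [DecidableEq n] [DecidableEq t] [DecidableEq k]

/-- The rescaled residual matrix of a factor model with intercepts `m`, loadings `G`, factors `Z`,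
noise `E`, where `Q` projects the design out and `w` is the normalised projection of `1`. -/
def residualForm (m : Matrix n Unit ℝ) (G : Matrix n k ℝ) (Z : Matrix t k ℝ) (E : Matrix n t ℝ)
    (Q : Matrix t t ℝ) (w : Matrix t Unit ℝ) : Matrix n t ℝ :=
  m * wᵀ + (G * Zᵀ + E) * Q

/-- Leading right singular vectors `V` of a rescaled residual matrix, with the bounds on the
ingredients that control them. -/
structure PCASystem (C θ κ h q τ : ℝ) (m : Matrix n Unit ℝ) (G : Matrix n k ℝ)
    (Z : Matrix t k ℝ) (E : Matrix n t ℝ) (Q : Matrix t t ℝ) (w : Matrix t Unit ℝ)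
    (V : Matrix t k ℝ) (d : k → ℝ) : Prop where
  one_le : 1 ≤ C
  theta_nonneg : 0 ≤ θ
  kappa_nonneg : 0 ≤ κ
  h_nonneg : 0 ≤ h
  h_sq : h ^ 2 = θ ^ 2 + κ
  h_small : 60 * C ^ 9 * h ≤ 1
  q_nonneg : 0 ≤ q
  q_le : q ≤ C
  Q_symm : Qᵀ = Q
  Q_idem : Q * Q = Q
  Q_w : Q * w = w
  w_unit : wᵀ * w = 1
  V_orth : Vᵀ * V = 1
  eigen : (residualForm m G Z E Q w)ᵀ * residualForm m G Z E Q w * V = V * diagonal d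
  d_lower : ∀ j, C⁻¹ ≤ d j
  norm_G : ‖G‖ ≤ C
  norm_Z : ‖Z‖ ≤ C
  norm_Zw : ‖Zᵀ * w‖ ≤ C * θ
  norm_Ew : ‖E * w‖ ≤ C * θ
  norm_GE : ‖Gᵀ * E‖ ≤ C * κ
  norm_GEw : ‖Gᵀ * E * w‖ ≤ C * κ * θ
  norm_m : ‖m‖ ≤ q * θ
  norm_Gm : ‖Gᵀ * m‖ ≤ C * θ ^ 2
  norm_EEw : ‖Eᵀ * E * w - τ • w‖ ≤ C * κ * θ
  tau_nonneg : 0 ≤ τ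
  tau_le : τ ≤ θ ^ 2
  norm_E : ‖E‖ ≤ C * h

namespace PCASystem

variable {C θ κ h q τ : ℝ} {m : Matrix n Unit ℝ} {G : Matrix n k ℝ}
    {Z : Matrix t k ℝ} {E : Matrix n t ℝ} {Q : Matrix t t ℝ} {w : Matrix t Unit ℝ}
    {V : Matrix t k ℝ} {d : k → ℝ}

lemma h_le_one (H : PCASystem C θ κ h q τ m G Z E Q w V d) : h ≤ 1 := by
  have h1 : 1 ≤ C ^ 9 := one_le_pow₀ H.one_le
  nlinarith [H.h_small, H.h_nonneg]

lemma theta_le_h (H : PCASystem C θ κ h q τ m G Z E Q w V d) : θ ≤ h := by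
  refine (sq_le_sq₀ H.theta_nonneg H.h_nonneg).1 ?_
  linarith [H.h_sq, H.kappa_nonneg]

lemma norm_m_le (H : PCASystem C θ κ h q τ m G Z E Q w V d) : ‖m‖ ≤ C * θ :=
  H.norm_m.trans (mul_le_mul_of_nonneg_right H.q_le H.theta_nonneg)

lemma d_pos (H : PCASystem C θ κ h q τ m G Z E Q w V d) (j : k) : 0 < d j :=
  (inv_pos.2 (by linarith [H.one_le])).trans_le (H.d_lower j)

lemma diag_inv_mul (H : PCASystem C θ κ h q τ m G Z E Q w V d) :
    diagonal (fun j => (d j)⁻¹) * diagonal d = 1 := by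
  rw [diagonal_mul_diagonal, ← diagonal_one]
  congr 1; ext j; exact inv_mul_cancel₀ (H.d_pos j).ne'

lemma diag_mul_inv (H : PCASystem C θ κ h q τ m G Z E Q w V d) :
    diagonal d * diagonal (fun j => (d j)⁻¹) = 1 :=
  _root_.mul_eq_one_comm.1 H.diag_inv_mul

lemma norm_diag_inv (H : PCASystem C θ κ h q τ m G Z E Q w V d) :
    ‖diagonal (fun j => (d j)⁻¹)‖ ≤ C := by
  rw [Matrix.l2_opNorm_diagonal]
  refine (pi_norm_le_iff_of_nonneg (by linarith [H.one_le])).2 fun j => ?_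
  rw [Real.norm_eq_abs, abs_of_pos (inv_pos.2 (H.d_pos j))]
  exact inv_le_of_inv_le₀ (by linarith [H.one_le]) (H.d_lower j)

lemma norm_V (H : PCASystem C θ κ h q τ m G Z E Q w V d) : ‖V‖ ≤ 1 :=
  norm_le_one_of_transpose_mul_self_eq_one H.V_orth

lemma norm_w (H : PCASystem C θ κ h q τ m G Z E Q w V d) : ‖w‖ ≤ 1 :=
  norm_le_one_of_transpose_mul_self_eq_one (by rw [H.w_unit])

lemma residualForm_mul_Q (H : PCASystem C θ κ h q τ m G Z E Q w V d) :
    residualForm m G Z E Q w * Q = residualForm m G Z E Q w := by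
  have h1 : wᵀ * Q = wᵀ := by
    rw [← H.Q_symm, ← Matrix.transpose_mul, H.Q_w]
  simp only [residualForm, Matrix.add_mul, Matrix.mul_assoc, h1, H.Q_idem]

/-- The eigenvalues are nonzero, so V = FᵀFVD⁻¹ lies in the range of Fᵀ, on which Q acts as the
identity. -/
lemma Q_V (H : PCASystem C θ κ h q τ m G Z E Q w V d) : Q * V = V := by
  have h1 : V = (residualForm m G Z E Q w)ᵀ * residualForm m G Z E Q w * V *
      diagonal (fun j => (d j)⁻¹) := by
    rw [H.eigen, Matrix.mul_assoc, H.diag_mul_inv, Matrix.mul_one]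
  have h2 : Q * (residualForm m G Z E Q w)ᵀ = (residualForm m G Z E Q w)ᵀ := by
    have h3 := congrArg Matrix.transpose H.residualForm_mul_Q
    rwa [Matrix.transpose_mul, H.Q_symm] at h3
  conv_lhs => rw [h1]
  rw [← Matrix.mul_assoc, ← Matrix.mul_assoc, ← Matrix.mul_assoc, h2]
  exact h1.symm

/-- The noise part of `residualForm * V`. -/
def noiseScore (m : Matrix n Unit ℝ) (E : Matrix n t ℝ) (w : Matrix t Unit ℝ)
    (V : Matrix t k ℝ) : Matrix n k ℝ := E * V + m * (wᵀ * V)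

lemma residualForm_mul_of_Q {l : Type*} [Fintype l] {x : Matrix t l ℝ} (hx : Q * x = x) :
    residualForm m G Z E Q w * x = m * (wᵀ * x) + G * (Zᵀ * x) + E * x := by
  simp only [residualForm, Matrix.add_mul, Matrix.mul_assoc, hx, add_assoc]

lemma score_eq (H : PCASystem C θ κ h q τ m G Z E Q w V d) :
    residualForm m G Z E Q w * V = G * (Zᵀ * V) + noiseScore m E w V := by
  rw [residualForm_mul_of_Q H.Q_V, noiseScore]; abel

lemma norm_ZV (H : PCASystem C θ κ h q τ m G Z E Q w V d) : ‖Zᵀ * V‖ ≤ C := by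
  simpa using norm_matrix_mul_le_of_le ((norm_transpose_eq Z).trans_le H.norm_Z) H.norm_V

lemma norm_wV_le_one (H : PCASystem C θ κ h q τ m G Z E Q w V d) : ‖wᵀ * V‖ ≤ 1 := by
  simpa using norm_matrix_mul_le_of_le ((norm_transpose_eq w).trans_le H.norm_w) H.norm_V

lemma norm_score (H : PCASystem C θ κ h q τ m G Z E Q w V d) :
    ‖residualForm m G Z E Q w * V‖ ≤ 3 * C ^ 2 := by
  have hC := H.one_le
  rw [residualForm_mul_of_Q H.Q_V]
  have h1 : ‖m * (wᵀ * V)‖ ≤ C * θ * 1 := norm_matrix_mul_le_of_le H.norm_m_le H.norm_wV_le_one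
  have h2 : ‖G * (Zᵀ * V)‖ ≤ C * C := norm_matrix_mul_le_of_le H.norm_G H.norm_ZV
  have h3 : ‖E * V‖ ≤ C * h * 1 := norm_matrix_mul_le_of_le H.norm_E H.norm_V
  have h4 := H.h_le_one
  have h5 := H.theta_le_h
  refine (norm_add₃_le).trans ?_
  nlinarith

/-- The eigenvalue equation gives wᵀV = (Fw)ᵀ(FV)D⁻¹, and all three terms of Fw = m + G(Zᵀw) + Ew
are of order θ. The estimated factors are thus almost orthogonal to the intercept direction. -/
lemma norm_wV (H : PCASystem C θ κ h q τ m G Z E Q w V d) : ‖wᵀ * V‖ ≤ 9 * C ^ 5 * θ := by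
  have hC := H.one_le
  have h0 : wᵀ * V = (residualForm m G Z E Q w * w)ᵀ * (residualForm m G Z E Q w * V) *
      diagonal (fun j => (d j)⁻¹) := by
    have h1 : (residualForm m G Z E Q w * w)ᵀ * (residualForm m G Z E Q w * V)
        = wᵀ * ((residualForm m G Z E Q w)ᵀ * residualForm m G Z E Q w * V) := by
      simp only [Matrix.transpose_mul, Matrix.mul_assoc]
    rw [h1, H.eigen, ← Matrix.mul_assoc, Matrix.mul_assoc, H.diag_mul_inv, Matrix.mul_one]
  have h2 : ‖residualForm m G Z E Q w * w‖ ≤ 3 * C ^ 2 * θ := by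
    rw [residualForm_mul_of_Q H.Q_w, H.w_unit, Matrix.mul_one]
    have h3 : ‖G * (Zᵀ * w)‖ ≤ C * (C * θ) := norm_matrix_mul_le_of_le H.norm_G H.norm_Zw
    have h4 := H.norm_m_le
    have h5 := H.norm_Ew
    have h6 := H.theta_nonneg
    refine (norm_add₃_le).trans ?_
    nlinarith [mul_nonneg (sub_nonneg.2 hC) h6, mul_nonneg (mul_nonneg (sub_nonneg.2 hC) h6) (sub_nonneg.2 hC)]
  rw [h0]
  refine (norm_matrix_mul_le_of_le (norm_matrix_mul_le_of_le
    ((norm_transpose_eq _).trans_le h2) H.norm_score) H.norm_diag_inv).trans (le_of_eq ?_)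
  ring

/-- The noise contributes its full norm, of order h. The intercepts contribute only θ², because
`norm_wV` supplies a second factor θ. -/
lemma norm_noiseScore (H : PCASystem C θ κ h q τ m G Z E Q w V d) :
    ‖noiseScore m E w V‖ ≤ 10 * C ^ 6 * h := by
  have hC := H.one_le
  have h1 : ‖m * (wᵀ * V)‖ ≤ C * θ * (9 * C ^ 5 * θ) :=
    norm_matrix_mul_le_of_le H.norm_m_le H.norm_wV
  have h3 : ‖E * V‖ ≤ C * h * 1 := norm_matrix_mul_le_of_le H.norm_E H.norm_V
  have h4 : θ * θ ≤ h := by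
    nlinarith [H.h_le_one, H.theta_le_h, H.theta_nonneg, H.h_nonneg]
  have h5 : C ≤ C ^ 6 := le_self_pow₀ hC (by norm_num)
  have h6 : C * h ≤ C ^ 6 * h := mul_le_mul_of_nonneg_right h5 H.h_nonneg
  have h7 : C ^ 6 * (θ * θ) ≤ C ^ 6 * h := by gcongr
  refine (norm_add_le _ _).trans ?_
  nlinarith

/-- With A = FV one has AᵀA = diag(d). Replacing the first A by G(ZᵀV) plus noise shows that
D⁻¹(VᵀZ)(GᵀA) is a small perturbation of the identity, hence invertible. No true factor is missed by
the estimated scores. -/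
lemma exists_right_inverse (H : PCASystem C θ κ h q τ m G Z E Q w V d) :
    ∃ J : Matrix k k ℝ, Gᵀ * (residualForm m G Z E Q w * V) * J = 1 ∧ ‖J‖ ≤ 2 * C ^ 2 := by
  have hC := H.one_le
  set A := residualForm m G Z E Q w * V with hA
  set B := noiseScore m E w V with hB
  set D' : Matrix k k ℝ := diagonal (fun j => (d j)⁻¹) with hD'
  have h1 : Aᵀ * A = diagonal d := by
    rw [hA, Matrix.transpose_mul, Matrix.mul_assoc, ← Matrix.mul_assoc _ _ V, H.eigen,
      ← Matrix.mul_assoc, H.V_orth, Matrix.one_mul]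
  have h2 : Aᵀ = Vᵀ * Z * Gᵀ + Bᵀ := by
    rw [hA, H.score_eq, hB]
    simp only [Matrix.transpose_add, Matrix.transpose_mul, Matrix.transpose_transpose]
  have hK : D' * (Vᵀ * Z) * (Gᵀ * A) = 1 - D' * (Bᵀ * A) := by
    rw [← H.diag_inv_mul, ← h1, eq_sub_iff_add_eq]
    conv_rhs => rw [h2]
    simp only [Matrix.mul_add, Matrix.add_mul, Matrix.mul_assoc]
    rfl
  set R := D' * (Bᵀ * A) with hR
  -- The factor bounds multiply to 30C⁹h, and `h_small` makes this at most 1/2.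
  have hRn : ‖R‖ ≤ 1 / 2 := by
    refine (norm_matrix_mul_le_of_le H.norm_diag_inv (norm_matrix_mul_le_of_le
      ((norm_transpose_eq _).trans_le H.norm_noiseScore) H.norm_score)).trans ?_
    have := H.h_small
    nlinarith
  have hu : IsUnit (1 - R) := isUnit_one_sub_of_norm_lt_one (by linarith)
  obtain ⟨S, hS⟩ := hu.exists_left_inv
  have hinv : (S * (D' * (Vᵀ * Z))) * (Gᵀ * A) = 1 := by
    rw [Matrix.mul_assoc, hK, hS]
  have hinv' := _root_.mul_eq_one_comm.1 hinv
  refine ⟨_, hinv', ?_⟩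
  set J := S * (D' * (Vᵀ * Z))
  -- The fixed-point form allows absorption: ‖J‖ ≤ C² + ‖J‖/2.
  have h3 : J = D' * (Vᵀ * Z) + R * J := by
    have h4 : D' * (Vᵀ * Z) = (1 - R) * J := by
      rw [← hK, Matrix.mul_assoc _ _ J, hinv', Matrix.mul_one]
    rw [h4, Matrix.sub_mul, Matrix.one_mul]; abel
  have h5 : ‖D' * (Vᵀ * Z)‖ ≤ C * C := by
    refine norm_matrix_mul_le_of_le H.norm_diag_inv ?_
    have := norm_transpose_eq (Zᵀ * V)
    rw [Matrix.transpose_mul, Matrix.transpose_transpose] at this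
    rw [this]; exact H.norm_ZV
  have h6 : ‖R * J‖ ≤ 1 / 2 * ‖J‖ := norm_matrix_mul_le_of_le hRn le_rfl
  have h7 : ‖J‖ ≤ ‖D' * (Vᵀ * Z)‖ + ‖R * J‖ := by
    conv_lhs => rw [h3]
    exact norm_add_le _ _
  nlinarith

/-- On the orthogonal complement of the estimated factors, the true factors are controlled by
the noise. -/
lemma norm_Zx_le_of_orth (H : PCASystem C θ κ h q τ m G Z E Q w V d) {x : Matrix t Unit ℝ}
    (hQ : Q * x = x) (hV : Vᵀ * x = 0) :
    ‖Zᵀ * x‖ ≤ 2 * C ^ 2 * ‖(residualForm m G Z E Q w * V)ᵀ * (m * (wᵀ * x) + E * x)‖ := by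
  obtain ⟨J, hJ, hJn⟩ := H.exists_right_inverse
  set A := residualForm m G Z E Q w * V with hA
  -- The transposed eigenvalue equation AᵀF = diag(d)Vᵀ annihilates `x`.
  have h1 : Aᵀ * (residualForm m G Z E Q w * x) = 0 := by
    have h2 := congrArg Matrix.transpose H.eigen
    simp only [Matrix.transpose_mul, Matrix.transpose_transpose, diagonal_transpose] at h2
    rw [hA, Matrix.transpose_mul, Matrix.mul_assoc, ← Matrix.mul_assoc _ _ x, ← Matrix.mul_assoc,
      h2, Matrix.mul_assoc, hV, Matrix.mul_zero]
  rw [residualForm_mul_of_Q hQ] at h1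
  have h3 : Aᵀ * G * (Zᵀ * x) = -(Aᵀ * (m * (wᵀ * x) + E * x)) := by
    rw [eq_neg_iff_add_eq_zero, ← h1]
    simp only [Matrix.mul_add, Matrix.mul_assoc]; abel
  have h4 : Jᵀ * (Aᵀ * G) = 1 := by
    have h5 := congrArg Matrix.transpose hJ
    simpa only [Matrix.transpose_mul, Matrix.transpose_transpose, Matrix.transpose_one] using h5
  have h6 : Zᵀ * x = -(Jᵀ * (Aᵀ * (m * (wᵀ * x) + E * x))) := by
    rw [← Matrix.mul_neg, ← h3, ← Matrix.mul_assoc, h4, Matrix.one_mul]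
  rw [h6, norm_neg]
  exact norm_matrix_mul_le_of_le ((norm_transpose_eq _).trans_le hJn) le_rfl

/-- The leading part G(ZᵀV) of the scores meets intercepts and noise only through Gᵀm and GᵀE, of
orders θ² and κ. The noise part of the scores, of order h, multiplies another term of order h. -/
lemma norm_Zx (H : PCASystem C θ κ h q τ m G Z E Q w V d) {x : Matrix t Unit ℝ}
    (hQ : Q * x = x) (hV : Vᵀ * x = 0) : ‖Zᵀ * x‖ ≤ 42 * C ^ 9 * h ^ 2 * ‖x‖ := by
  have hC := H.one_le
  have hx := norm_nonneg x
  have hθ := H.theta_nonneg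
  have hκ := H.kappa_nonneg
  refine (H.norm_Zx_le_of_orth hQ hV).trans ?_
  have hwx : ‖wᵀ * x‖ ≤ 1 * ‖x‖ :=
    norm_matrix_mul_le_of_le ((norm_transpose_eq w).trans_le H.norm_w) le_rfl
  have h1 : (residualForm m G Z E Q w * V)ᵀ * (m * (wᵀ * x) + E * x) =
      (Zᵀ * V)ᵀ * (Gᵀ * m * (wᵀ * x) + Gᵀ * E * x) +
        (noiseScore m E w V)ᵀ * (m * (wᵀ * x) + E * x) := by
    rw [H.score_eq]
    simp only [Matrix.transpose_add, Matrix.transpose_mul, Matrix.mul_add, Matrix.add_mul,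
      Matrix.mul_assoc, Matrix.transpose_transpose]
    abel
  have h2 : ‖Gᵀ * m * (wᵀ * x) + Gᵀ * E * x‖ ≤ C * h ^ 2 * ‖x‖ := by
    refine (norm_add_le_of_le (norm_matrix_mul_le_of_le H.norm_Gm hwx)
      (norm_matrix_mul_le_of_le H.norm_GE le_rfl)).trans (le_of_eq ?_)
    rw [H.h_sq]; ring
  have h3 : ‖m * (wᵀ * x) + E * x‖ ≤ 2 * C * h * ‖x‖ := by
    refine (norm_add_le_of_le (norm_matrix_mul_le_of_le H.norm_m_le hwx)
      (norm_matrix_mul_le_of_le H.norm_E le_rfl)).trans ?_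
    have : C * θ * ‖x‖ ≤ C * h * ‖x‖ := by
      have := H.theta_le_h
      gcongr
    linarith
  have h4 : ‖(residualForm m G Z E Q w * V)ᵀ * (m * (wᵀ * x) + E * x)‖ ≤
      21 * C ^ 7 * h ^ 2 * ‖x‖ := by
    rw [h1]
    refine (norm_add_le_of_le (norm_matrix_mul_le_of_le
      ((norm_transpose_eq _).trans_le H.norm_ZV) h2) (norm_matrix_mul_le_of_le
      ((norm_transpose_eq _).trans_le H.norm_noiseScore) h3)).trans ?_
    have h5 : C ^ 2 ≤ C ^ 7 := pow_le_pow_right₀ hC (by norm_num)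
    have h6 : C ^ 2 * (h ^ 2 * ‖x‖) ≤ C ^ 7 * (h ^ 2 * ‖x‖) := by gcongr
    linarith
  calc _ ≤ 2 * C ^ 2 * (21 * C ^ 7 * h ^ 2 * ‖x‖) := by gcongr
    _ = _ := by ring

/-- The residual of `w` after projecting the estimated factors out. -/
def residualDir (w : Matrix t Unit ℝ) (V : Matrix t k ℝ) : Matrix t Unit ℝ :=
  w - V * (Vᵀ * w)

lemma V_residualDir (H : PCASystem C θ κ h q τ m G Z E Q w V d) :
    Vᵀ * residualDir w V = 0 := by
  rw [residualDir, Matrix.mul_sub, ← Matrix.mul_assoc, H.V_orth, Matrix.one_mul, sub_self]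

lemma Q_residualDir (H : PCASystem C θ κ h q τ m G Z E Q w V d) :
    Q * residualDir w V = residualDir w V := by
  rw [residualDir, Matrix.mul_sub, ← Matrix.mul_assoc, H.Q_V, H.Q_w]

lemma norm_residualDir (H : PCASystem C θ κ h q τ m G Z E Q w V d) :
    ‖residualDir w V‖ ≤ 1 := by
  have h1 : residualDir w V = (1 - V * Vᵀ) * w := by
    rw [residualDir, Matrix.sub_mul, Matrix.one_mul, Matrix.mul_assoc]
  have h2 : ‖(1 - V * Vᵀ : Matrix t t ℝ)‖ ≤ 1 := by
    refine norm_le_one_of_idem ?_ ?_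
    · simp
    · rw [Matrix.mul_sub, Matrix.sub_mul, Matrix.sub_mul, Matrix.one_mul, Matrix.mul_one,
        Matrix.one_mul, Matrix.mul_assoc V, ← Matrix.mul_assoc Vᵀ, H.V_orth, Matrix.one_mul]
      abel
  rw [h1]
  simpa using norm_matrix_mul_le_of_le h2 H.norm_w

lemma norm_Vw (H : PCASystem C θ κ h q τ m G Z E Q w V d) : ‖Vᵀ * w‖ ≤ 9 * C ^ 5 * θ := by
  have := norm_transpose_eq (wᵀ * V)
  rw [Matrix.transpose_mul, Matrix.transpose_transpose] at this
  rw [this]; exact H.norm_wV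

/-- The order h² of `norm_Zx` is too weak here, since the numerator carries a factor √T = θ⁻¹. The
extra θ is gained because the vector is w up to a correction of order θ, so that Ew, GᵀEw and EᵀEw
enter instead of E, GᵀE and EᵀE. -/
lemma norm_Z_residualDir (H : PCASystem C θ κ h q τ m G Z E Q w V d) :
    ‖Zᵀ * residualDir w V‖ ≤ 278 * C ^ 14 * (θ * (θ + κ + q * h)) := by
  have hC := H.one_le
  have hθ := H.theta_nonneg
  have hκ := H.kappa_nonneg
  have hh := H.h_nonneg
  have hq := H.q_nonneg
  have hθ1 : θ ≤ 1 := H.theta_le_h.trans H.h_le_one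
  have hp : ∀ i, 1 ≤ i → i ≤ 12 → C ^ i ≤ C ^ 12 := fun i _ hi => pow_le_pow_right₀ hC hi
  refine (H.norm_Zx_le_of_orth H.Q_residualDir H.V_residualDir).trans ?_
  set u := residualDir w V with hu
  have hwu : ‖wᵀ * u‖ ≤ 1 := by
    simpa using norm_matrix_mul_le_of_le ((norm_transpose_eq w).trans_le H.norm_w)
      H.norm_residualDir
  -- The isotropic part τw of EᵀEw is split off: it meets V only through Vᵀw and so contributes θ³,
  -- while the remainder is of order κθ.
  have h1 : (residualForm m G Z E Q w * V)ᵀ * (m * (wᵀ * u) + E * u) =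
      (Zᵀ * V)ᵀ * (Gᵀ * m * (wᵀ * u) + (Gᵀ * E * w - Gᵀ * E * V * (Vᵀ * w))) +
        ((noiseScore m E w V)ᵀ * (m * (wᵀ * u)) +
        ((Vᵀ * (Eᵀ * E * w - τ • w) + τ • (Vᵀ * w) - (E * V)ᵀ * (E * V) * (Vᵀ * w)) +
          (m * (wᵀ * V))ᵀ * (E * u))) := by
    have e1 : Gᵀ * E * w - Gᵀ * E * V * (Vᵀ * w) = Gᵀ * (E * u) := by
      rw [hu, residualDir]; simp only [Matrix.mul_sub, Matrix.mul_assoc]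
    have e2 : Vᵀ * (Eᵀ * E * w - τ • w) + τ • (Vᵀ * w) - (E * V)ᵀ * (E * V) * (Vᵀ * w)
        = (E * V)ᵀ * (E * u) := by
      rw [hu, residualDir]
      simp only [Matrix.mul_sub, Matrix.transpose_mul, Matrix.mul_assoc, Matrix.mul_smul]
      abel
    rw [e1, e2, H.score_eq]
    simp only [noiseScore, Matrix.transpose_add, Matrix.transpose_mul, Matrix.mul_add,
      Matrix.add_mul, Matrix.mul_assoc, Matrix.transpose_transpose]
    abel
  have b1 : ‖Gᵀ * m * (wᵀ * u) + (Gᵀ * E * w - Gᵀ * E * V * (Vᵀ * w))‖ ≤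
      C * θ ^ 2 * 1 + (C * κ * θ + C * κ * 1 * (9 * C ^ 5 * θ)) :=
    norm_add_le_of_le (norm_matrix_mul_le_of_le H.norm_Gm hwu) (norm_sub_le_of_le H.norm_GEw
      (norm_matrix_mul_le_of_le (norm_matrix_mul_le_of_le H.norm_GE H.norm_V) H.norm_Vw))
  have b2 : ‖(noiseScore m E w V)ᵀ * (m * (wᵀ * u))‖ ≤ 10 * C ^ 6 * h * (q * θ * 1) :=
    norm_matrix_mul_le_of_le ((norm_transpose_eq _).trans_le H.norm_noiseScore)
      (norm_matrix_mul_le_of_le H.norm_m hwu)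
  have b3 : ‖E * u‖ ≤ C * θ + C * h * 1 * (9 * C ^ 5 * θ) := by
    have : E * u = E * w - E * V * (Vᵀ * w) := by
      rw [hu, residualDir]; simp only [Matrix.mul_sub, Matrix.mul_assoc]
    rw [this]
    exact norm_sub_le_of_le H.norm_Ew (norm_matrix_mul_le_of_le
      (norm_matrix_mul_le_of_le H.norm_E H.norm_V) H.norm_Vw)
  have b4 : ‖(m * (wᵀ * V))ᵀ * (E * u)‖ ≤
      C * θ * (9 * C ^ 5 * θ) * (C * θ + C * h * 1 * (9 * C ^ 5 * θ)) :=
    norm_matrix_mul_le_of_le ((norm_transpose_eq _).trans_le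
      (norm_matrix_mul_le_of_le H.norm_m_le H.norm_wV)) b3
  have b5 : ‖Vᵀ * (Eᵀ * E * w - τ • w)‖ ≤ 1 * (C * κ * θ) :=
    norm_matrix_mul_le_of_le ((norm_transpose_eq _).trans_le H.norm_V) H.norm_EEw
  have b6 : ‖τ • (Vᵀ * w)‖ ≤ θ ^ 2 * (9 * C ^ 5 * θ) := by
    rw [norm_smul, Real.norm_eq_abs, abs_of_nonneg H.tau_nonneg]
    exact mul_le_mul H.tau_le H.norm_Vw (norm_nonneg _) (by positivity)
  have hEV : ‖E * V‖ ≤ C * h * 1 := norm_matrix_mul_le_of_le H.norm_E H.norm_V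
  have b7 : ‖(E * V)ᵀ * (E * V) * (Vᵀ * w)‖ ≤ C * h * 1 * (C * h * 1) * (9 * C ^ 5 * θ) :=
    norm_matrix_mul_le_of_le (norm_matrix_mul_le_of_le ((norm_transpose_eq _).trans_le hEV) hEV)
      H.norm_Vw
  have b8 : ‖(Zᵀ * V)ᵀ * (Gᵀ * m * (wᵀ * u) + (Gᵀ * E * w - Gᵀ * E * V * (Vᵀ * w)))‖ ≤
      C * (C * θ ^ 2 * 1 + (C * κ * θ + C * κ * 1 * (9 * C ^ 5 * θ))) :=
    norm_matrix_mul_le_of_le ((norm_transpose_eq _).trans_le H.norm_ZV) b1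
  have key : ‖(residualForm m G Z E Q w * V)ᵀ * (m * (wᵀ * u) + E * u)‖ ≤
      139 * C ^ 12 * (θ * (θ + κ + q * h)) := by
    rw [h1]
    refine (norm_add_le_of_le b8 (norm_add_le_of_le b2 (norm_add_le_of_le
      (norm_sub_le_of_le (norm_add_le_of_le b5 b6) b7) b4))).trans ?_
    have hh1 : h ≤ 1 := H.h_le_one
    set ρ := θ * (θ + κ + q * h) with hρ
    have hqh : 0 ≤ q * h := mul_nonneg hq hh
    have r1 : θ ^ 2 ≤ ρ := by rw [hρ]; nlinarith [mul_nonneg hθ hκ, mul_nonneg hθ hqh]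
    have r2 : κ * θ ≤ ρ := by rw [hρ]; nlinarith [mul_nonneg hθ hθ, mul_nonneg hθ hqh]
    have r3 : h * (q * θ) ≤ ρ := by rw [hρ]; nlinarith [mul_nonneg hθ hκ, mul_nonneg hθ hθ]
    have r4 : θ ^ 3 ≤ ρ := le_trans (by nlinarith [sq_nonneg θ]) r1
    have r5 : h ^ 2 * θ ≤ 2 * ρ := by rw [H.h_sq]; nlinarith
    have r6 : h * θ ^ 3 ≤ ρ := le_trans (by nlinarith [pow_nonneg hθ 3]) r4
    have hρ0 : 0 ≤ ρ := le_trans (sq_nonneg θ) r1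
    have p : ∀ (i : ℕ) (x : ℝ), 1 ≤ i → i ≤ 12 → 0 ≤ x → ∀ a, x ≤ a → C ^ i * x ≤ C ^ 12 * a :=
      fun i x hi hi' hx a hxa => mul_le_mul (hp i hi hi') hxa hx (by positivity)
    have c1 := p 2 _ (by norm_num) (by norm_num) (by positivity) _ r1
    have c2 := p 2 _ (by norm_num) (by norm_num) (by positivity) _ r2
    have c3 := p 7 _ (by norm_num) (by norm_num) (by positivity) _ r2
    have c4 := p 6 _ (by norm_num) (by norm_num) (by positivity) _ r3
    have c5 := p 1 _ (by norm_num) (by norm_num) (by positivity) _ r2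
    have c6 := p 5 _ (by norm_num) (by norm_num) (by positivity) _ r4
    have c7 := p 7 _ (by norm_num) (by norm_num) (by positivity) _ r5
    have c8 := p 7 _ (by norm_num) (by norm_num) (by positivity) _ r4
    have c9 := p 12 _ (by norm_num) (by norm_num) (by positivity) _ r6
    have e : C * (C * θ ^ 2 * 1 + (C * κ * θ + C * κ * 1 * (9 * C ^ 5 * θ))) +
        (10 * C ^ 6 * h * (q * θ * 1) +
        (1 * (C * κ * θ) + θ ^ 2 * (9 * C ^ 5 * θ) + C * h * 1 * (C * h * 1) * (9 * C ^ 5 * θ) +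
        C * θ * (9 * C ^ 5 * θ) * (C * θ + C * h * 1 * (9 * C ^ 5 * θ)))) =
        C ^ 2 * θ ^ 2 + C ^ 2 * (κ * θ) + 9 * (C ^ 7 * (κ * θ)) + 10 * (C ^ 6 * (h * (q * θ))) +
        C ^ 1 * (κ * θ) + 9 * (C ^ 5 * θ ^ 3) + 9 * (C ^ 7 * (h ^ 2 * θ)) +
        9 * (C ^ 7 * θ ^ 3) + 81 * (C ^ 12 * (h * θ ^ 3)) := by ring
    rw [e]
    have hCρ : 0 ≤ C ^ 12 * ρ := by positivity
    linarith
  calc _ ≤ 2 * C ^ 2 * (139 * C ^ 12 * (θ * (θ + κ + q * h))) := by gcongr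
    _ = _ := by ring

/-- The identity Vᵀ = D⁻¹(FV)ᵀF expresses Vᵀy through Fy. Its factor part is governed by `l`, its
intercept part by θ ≤ l, and its noise part, once multiplied by the scores, by κ + h². In the
application `y` is the rescaled noise of one unit. -/
lemma norm_Vy (H : PCASystem C θ κ h q τ m G Z E Q w V d) {y : Matrix t Unit ℝ} {l : ℝ}
    (hy : ‖y‖ ≤ C) (hl : θ ≤ l) (hZy : ‖Zᵀ * (Q * y)‖ ≤ C * l) :
    ‖Vᵀ * y‖ ≤ 17 * C ^ 9 * (l + κ) := by
  have hC := H.one_le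
  have hθ := H.theta_nonneg
  have hκ := H.kappa_nonneg
  have hh := H.h_nonneg
  have hθ1 : θ ≤ 1 := H.theta_le_h.trans H.h_le_one
  have hl0 : 0 ≤ l := hθ.trans hl
  set A := residualForm m G Z E Q w * V with hA
  have hV : Vᵀ = diagonal (fun j => (d j)⁻¹) * (Aᵀ * residualForm m G Z E Q w) := by
    have h2 := congrArg Matrix.transpose H.eigen
    simp only [Matrix.transpose_mul, Matrix.transpose_transpose, diagonal_transpose] at h2
    rw [hA, Matrix.transpose_mul, Matrix.mul_assoc, h2, ← Matrix.mul_assoc, H.diag_inv_mul,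
      Matrix.one_mul]
  have h1 : Vᵀ * y = diagonal (fun j => (d j)⁻¹) * (Aᵀ * (m * (wᵀ * y)) +
      Aᵀ * (G * (Zᵀ * (Q * y))) + ((Zᵀ * V)ᵀ * (Gᵀ * E * (Q * y)) +
        (noiseScore m E w V)ᵀ * (E * (Q * y)))) := by
    conv_lhs => rw [hV]
    have e : (Zᵀ * V)ᵀ * (Gᵀ * E * (Q * y)) + (noiseScore m E w V)ᵀ * (E * (Q * y))
        = Aᵀ * (E * (Q * y)) := by
      rw [hA, H.score_eq]
      simp only [Matrix.transpose_add, Matrix.transpose_mul, Matrix.add_mul, Matrix.mul_assoc]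
    rw [e]
    simp only [residualForm, Matrix.mul_add, Matrix.add_mul, Matrix.mul_assoc, add_assoc]
  have hQ : ‖Q‖ ≤ 1 := norm_le_one_of_idem H.Q_symm H.Q_idem
  have hQy : ‖Q * y‖ ≤ 1 * C := norm_matrix_mul_le_of_le hQ hy
  have hwy : ‖wᵀ * y‖ ≤ 1 * C :=
    norm_matrix_mul_le_of_le ((norm_transpose_eq w).trans_le H.norm_w) hy
  have hAn : ‖Aᵀ‖ ≤ 3 * C ^ 2 := (norm_transpose_eq _).trans_le H.norm_score
  have hlk : 0 ≤ l + κ := by positivity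
  rw [h1]
  refine (norm_matrix_mul_le_of_le H.norm_diag_inv (norm_add_le_of_le (norm_add_le_of_le
    (norm_matrix_mul_le_of_le hAn (norm_matrix_mul_le_of_le H.norm_m_le hwy))
    (norm_matrix_mul_le_of_le hAn (norm_matrix_mul_le_of_le H.norm_G hZy)))
    (norm_add_le_of_le (norm_matrix_mul_le_of_le ((norm_transpose_eq _).trans_le H.norm_ZV)
      (norm_matrix_mul_le_of_le H.norm_GE hQy))
    (norm_matrix_mul_le_of_le ((norm_transpose_eq _).trans_le H.norm_noiseScore)
      (norm_matrix_mul_le_of_le H.norm_E hQy))))).trans ?_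
  have e : C * (3 * C ^ 2 * (C * θ * (1 * C)) + 3 * C ^ 2 * (C * (C * l)) +
      (C * (C * κ * (1 * C)) + 10 * C ^ 6 * h * (C * h * (1 * C)))) =
      3 * (C ^ 5 * θ) + 3 * (C ^ 5 * l) + C ^ 4 * κ + 10 * (C ^ 9 * h ^ 2) := by ring
  rw [e]
  have p : ∀ (i : ℕ) (x : ℝ), 1 ≤ i → i ≤ 9 → 0 ≤ x → ∀ a, x ≤ a → C ^ i * x ≤ C ^ 9 * a :=
    fun i x hi hi' hx a hxa => mul_le_mul (pow_le_pow_right₀ hC hi') hxa hx (by positivity)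
  have c1 := p 5 θ (by norm_num) (by norm_num) hθ (l + κ) (by linarith)
  have c2 := p 5 l (by norm_num) (by norm_num) hl0 (l + κ) (by linarith)
  have c3 := p 4 κ (by norm_num) (by norm_num) hκ (l + κ) (by linarith)
  have c4 := p 9 (h ^ 2) (by norm_num) (by norm_num) (by positivity) (l + κ)
    (by rw [H.h_sq]; nlinarith)
  linarith

/-- The numerator of the statistic of a true null is that of the oracle, up to a small error. -/
lemma numerator_bound (H : PCASystem C θ κ h q τ m G Z E Q w V d) {y : Matrix t Unit ℝ} {l : ℝ}
    {g : Matrix k Unit ℝ} (hg : ‖g‖ ≤ C)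
    (hy : ‖y‖ ≤ C) (hl : θ ≤ l) (hZy : ‖Zᵀ * (Q * y)‖ ≤ C * l) :
    ‖(residualDir w V)ᵀ * (Q * (Z * g + y)) - wᵀ * y‖ ≤
      431 * C ^ 15 * (θ * (l + κ + q * h)) := by
  have hC := H.one_le
  have hθ := H.theta_nonneg
  have hκ := H.kappa_nonneg
  have hqh : 0 ≤ q * h := mul_nonneg H.q_nonneg H.h_nonneg
  have huQ : (residualDir w V)ᵀ * Q = (residualDir w V)ᵀ := by
    rw [← H.Q_symm, ← Matrix.transpose_mul, H.Q_residualDir]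
  -- Two errors remain: factors imperfectly removed, and noise of the unit absorbed by the estimated
  -- factors.
  have h1 : (residualDir w V)ᵀ * (Q * (Z * g + y)) - wᵀ * y =
      (Zᵀ * residualDir w V)ᵀ * g - wᵀ * V * (Vᵀ * y) := by
    rw [← Matrix.mul_assoc, huQ, Matrix.mul_add]
    conv_lhs => rw [residualDir]
    conv_rhs => rw [residualDir]
    simp only [Matrix.transpose_mul, Matrix.transpose_sub, Matrix.sub_mul, Matrix.mul_sub,
      Matrix.mul_assoc, Matrix.transpose_transpose]
    abel
  rw [h1]
  refine (norm_sub_le_of_le (norm_matrix_mul_le_of_le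
    ((norm_transpose_eq _).trans_le H.norm_Z_residualDir) hg)
    (norm_matrix_mul_le_of_le H.norm_wV (H.norm_Vy hy hl hZy))).trans ?_
  have c1 : θ * (θ + κ + q * h) ≤ θ * (l + κ + q * h) := by gcongr
  have c2 : θ * (l + κ) ≤ θ * (l + κ + q * h) := mul_le_mul_of_nonneg_left (by linarith) hθ
  have c3 : C ^ 14 ≤ C ^ 15 := pow_le_pow_right₀ hC (by norm_num)
  have hl0 : 0 ≤ l := hθ.trans hl
  have c4 : C ^ 15 * (θ * (θ + κ + q * h)) ≤ C ^ 15 * (θ * (l + κ + q * h)) := by gcongr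
  have c5 : C ^ 14 * (θ * (l + κ)) ≤ C ^ 15 * (θ * (l + κ + q * h)) := by gcongr
  linarith

/-- The variance estimate of a true null is that of the oracle, up to a small error. -/
lemma variance_bound (H : PCASystem C θ κ h q τ m G Z E Q w V d) {y : Matrix t Unit ℝ} {l : ℝ}
    {g : Matrix k Unit ℝ} (hg : ‖g‖ ≤ C) (hl1 : l ≤ 1)
    (hy : ‖y‖ ≤ C) (hl : θ ≤ l) (hZy : ‖Zᵀ * (Q * y)‖ ≤ C * l) :
    |‖(1 - V * Vᵀ) * (Q * (Z * g + y))‖ ^ 2 - ‖y‖ ^ 2| ≤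
      ‖(1 - Q) * y‖ ^ 2 + 4190 * C ^ 20 * (l + κ) := by
  have hC := H.one_le
  have hθ := H.theta_nonneg
  have hκ := H.kappa_nonneg
  have hθ1 : θ ≤ 1 := H.theta_le_h.trans H.h_le_one
  have hκ1 : κ ≤ 1 := by nlinarith [H.h_sq, H.h_le_one, H.h_nonneg]
  set R : Matrix t t ℝ := Q - V * Vᵀ with hR
  have hVQ : Vᵀ * Q = Vᵀ := by rw [← H.Q_symm, ← Matrix.transpose_mul, H.Q_V]
  have hVV : V * Vᵀ * (V * Vᵀ) = V * Vᵀ := by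
    rw [Matrix.mul_assoc V, ← Matrix.mul_assoc Vᵀ, H.V_orth, Matrix.one_mul]
  have hQVV : Q * (V * Vᵀ) = V * Vᵀ := by rw [← Matrix.mul_assoc, H.Q_V]
  have hVVQ : V * Vᵀ * Q = V * Vᵀ := by rw [Matrix.mul_assoc, hVQ]
  have hRs : Rᵀ = R := by
    rw [hR, Matrix.transpose_sub, H.Q_symm, Matrix.transpose_mul, Matrix.transpose_transpose]
  have hRi : R * R = R := by
    rw [hR, Matrix.mul_sub, Matrix.sub_mul, Matrix.sub_mul, H.Q_idem, hVVQ, hQVV, hVV]; abel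
  have hR1 : (1 - V * Vᵀ) * (Q * (Z * g + y)) = R * (Z * g) + R * y := by
    rw [← Matrix.mul_assoc, Matrix.sub_mul, Matrix.one_mul, hVVQ, ← hR, Matrix.mul_add]
  have hRn : ‖R‖ ≤ 1 := norm_le_one_of_idem hRs hRi
  set x₁ := R * (Z * g) with hx₁
  set x₂ := R * y with hx₂
  have hVR : Vᵀ * R = 0 := by
    rw [hR, Matrix.mul_sub, hVQ, ← Matrix.mul_assoc, H.V_orth, Matrix.one_mul, sub_self]
  have hQR : Q * R = R := by rw [hR, Matrix.mul_sub, H.Q_idem, hQVV]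
  -- The vector x₁ = RZg lies in the range of Q and is orthogonal to V, so `norm_Zx` applies. Since
  -- R is a projection, ‖x₁‖² = (Zᵀx₁)ᵀg, and one factor ‖x₁‖ cancels.
  have b1 : ‖x₁‖ ≤ 42 * C ^ 10 * h ^ 2 := by
    have h1 := H.norm_Zx (x := x₁) (by rw [hx₁, ← Matrix.mul_assoc, hQR])
      (by rw [hx₁, ← Matrix.mul_assoc, hVR, Matrix.zero_mul])
    have h2 : x₁ᵀ * x₁ = (Zᵀ * x₁)ᵀ * g := by
      have : x₁ᵀ * R = x₁ᵀ := by
        rw [hx₁, Matrix.transpose_mul, hRs, Matrix.mul_assoc, hRi]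
      conv_lhs => rw [hx₁, ← hx₁, ← Matrix.mul_assoc, this]
      simp only [Matrix.transpose_mul, Matrix.transpose_transpose, Matrix.mul_assoc]
    have h3 : ‖x₁‖ ^ 2 ≤ 42 * C ^ 9 * h ^ 2 * ‖x₁‖ * C := by
      rw [← norm_transpose_mul_self_eq, h2]
      exact norm_matrix_mul_le_of_le ((norm_transpose_eq _).trans_le h1) hg
    rcases (norm_nonneg x₁).eq_or_lt with h4 | h4
    · rw [← h4]; positivity
    · refine le_of_mul_le_mul_right ?_ h4
      calc ‖x₁‖ * ‖x₁‖ = ‖x₁‖ ^ 2 := (sq _).symm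
        _ ≤ _ := h3
        _ = _ := by ring
  have b2 : ‖x₂‖ ≤ C := by simpa using norm_matrix_mul_le_of_le hRn hy
  -- Pythagoras for the nested orthogonal projections VVᵀ and Q.
  have b3 : ‖x₂‖ ^ 2 = ‖y‖ ^ 2 - ‖(1 - Q) * y‖ ^ 2 - ‖Vᵀ * y‖ ^ 2 := by
    have h1 : ∀ x : Matrix t Unit ℝ, ‖x‖ ^ 2 = (xᵀ * x) () () := fun x => by
      rw [norm_col_sq]; simp [Matrix.mul_apply, sq]
    have h1' : ∀ x : Matrix k Unit ℝ, ‖x‖ ^ 2 = (xᵀ * x) () () := fun x => by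
      rw [norm_col_sq]; simp [Matrix.mul_apply, sq]
    rw [h1, h1, h1, h1', ← Matrix.sub_apply, ← Matrix.sub_apply]
    rw [hx₂]
    simp only [Matrix.transpose_mul, hRs, Matrix.transpose_sub, Matrix.transpose_one, H.Q_symm,
      Matrix.transpose_transpose]
    have e1 : yᵀ * R * (R * y) = yᵀ * (R * y) := by
      rw [Matrix.mul_assoc, ← Matrix.mul_assoc R, hRi]
    have e2 : yᵀ * (1 - Q) * ((1 - Q) * y) = yᵀ * ((1 - Q) * y) := by
      rw [Matrix.mul_assoc, ← Matrix.mul_assoc (1 - Q)]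
      congr 2
      rw [Matrix.mul_sub, Matrix.sub_mul, Matrix.sub_mul, H.Q_idem]; simp
    rw [e1, e2, hR]
    simp only [Matrix.sub_mul, Matrix.mul_sub, Matrix.one_mul, Matrix.mul_assoc]
    abel_nf
  have b4 := H.norm_Vy hy hl hZy
  rw [hR1]
  have hl0 : 0 ≤ l := hθ.trans hl
  set a := l + κ with ha
  have ha0 : 0 ≤ a := by positivity
  have ha2 : a ≤ 2 := by linarith
  have hha : h ^ 2 ≤ a := by rw [H.h_sq]; nlinarith
  have n1 := norm_add_le x₁ x₂
  have n2 : ‖x₂‖ ≤ ‖x₁ + x₂‖ + ‖x₁‖ := by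
    have := norm_sub_le (x₁ + x₂) x₁
    rwa [add_sub_cancel_left] at this
  have b1' : ‖x₁‖ ≤ 42 * C ^ 10 * a := b1.trans (by gcongr)
  have s1 : ‖x₁‖ ^ 2 ≤ 3528 * C ^ 20 * a := by
    calc ‖x₁‖ ^ 2 ≤ (42 * C ^ 10 * a) ^ 2 := by gcongr
      _ = 1764 * C ^ 20 * a * a := by ring
      _ ≤ 1764 * C ^ 20 * a * 2 := by gcongr
      _ = _ := by ring
  have s2 : ‖x₁‖ * ‖x₂‖ ≤ 42 * C ^ 20 * a := by
    calc ‖x₁‖ * ‖x₂‖ ≤ 42 * C ^ 10 * a * C := by gcongr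
      _ = 42 * C ^ 11 * a := by ring
      _ ≤ 42 * C ^ 20 * a := by gcongr; norm_num
  have s3 : ‖Vᵀ * y‖ ^ 2 ≤ 578 * C ^ 20 * a := by
    calc ‖Vᵀ * y‖ ^ 2 ≤ (17 * C ^ 9 * a) ^ 2 := by gcongr
      _ = 289 * C ^ 18 * a * a := by ring
      _ ≤ 289 * C ^ 20 * a * 2 := by gcongr; norm_num
      _ = _ := by ring
  have nn := norm_nonneg (x₁ + x₂)
  have nn1 := norm_nonneg x₁
  have nn2 := norm_nonneg x₂
  have up : ‖x₁ + x₂‖ ^ 2 ≤ ‖x₂‖ ^ 2 + (‖x₁‖ ^ 2 + 2 * (‖x₁‖ * ‖x₂‖)) :=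
    (pow_le_pow_left₀ nn n1 2).trans (le_of_eq (by ring))
  -- The inverse triangle inequality may be squared only if ‖x₁‖ ≤ ‖x₂‖; otherwise the left side is
  -- nonpositive.
  have lo : ‖x₂‖ ^ 2 - (‖x₁‖ ^ 2 + 2 * (‖x₁‖ * ‖x₂‖)) ≤ ‖x₁ + x₂‖ ^ 2 := by
    have e1 := mul_nonneg nn1 nn2
    have e2 := sq_nonneg ‖x₁‖
    rcases le_total ‖x₁‖ ‖x₂‖ with hc | hc
    · have e3 : (‖x₂‖ - ‖x₁‖) ^ 2 ≤ ‖x₁ + x₂‖ ^ 2 :=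
        pow_le_pow_left₀ (by linarith) (by linarith) 2
      have e4 : (‖x₂‖ - ‖x₁‖) ^ 2 = ‖x₂‖ ^ 2 - 2 * (‖x₁‖ * ‖x₂‖) + ‖x₁‖ ^ 2 := by ring
      linarith
    · have e3 : ‖x₂‖ ^ 2 ≤ ‖x₁‖ ^ 2 := pow_le_pow_left₀ nn2 hc 2
      linarith [sq_nonneg ‖x₁ + x₂‖]
  have p1 := sq_nonneg ‖(1 - Q) * y‖
  have p2 := sq_nonneg ‖Vᵀ * y‖
  rw [abs_le]
  constructor <;> linarith

end PCASystem

end PCA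

/-! ### Linear forms of Gaussian arrays and their moments up to order four. -/

section GaussianMoments

/-- The fourth derivative at zero of the moment generating function exp(vt²/2). -/
lemma integral_pow_four_gaussianReal (v : NNReal) :
    ∫ x, x ^ 4 ∂(gaussianReal 0 v) = 3 * (v : ℝ) ^ 2 := by
  have h := iteratedDeriv_mgf_zero (X := id) (μ := gaussianReal 0 v)
    (by rw [integrableExpSet_id_gaussianReal]; simp) 4
  simp only [Pi.pow_apply, id_eq] at h
  rw [← h, mgf_id_gaussianReal]
  -- Each derivative is again a polynomial times the same exponential; the four rounds only track
  -- the polynomial.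
  have hd : ∀ (p q : ℝ → ℝ), (∀ t, HasDerivAt p (q t) t) →
      deriv (fun t => p t * Real.exp (0 * t + v * t ^ 2 / 2)) =
        fun t => (q t + p t * (v * t)) * Real.exp (0 * t + v * t ^ 2 / 2) := by
    intro p q hp
    ext t
    have h1 : HasDerivAt (fun t : ℝ => 0 * t + v * t ^ 2 / 2) (v * t) t := by
      have := (((hasDerivAt_id t).const_mul (0 : ℝ)).add
        (((hasDerivAt_pow 2 t).const_mul (v : ℝ)).div_const 2))
      exact this.congr_deriv (by norm_num; ring)
    exact ((hp t).mul h1.exp).deriv.trans (by ring)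
  rw [iteratedDeriv_eq_iterate]
  simp only [Function.iterate_succ, Function.iterate_zero, Function.comp_apply, id_eq]
  have e0 : (fun t : ℝ => Real.exp (0 * t + v * t ^ 2 / 2)) =
      fun t => (fun _ => (1 : ℝ)) t * Real.exp (0 * t + v * t ^ 2 / 2) := by simp
  rw [e0, hd _ (fun _ => 0) (fun t => hasDerivAt_const t 1),
    hd (fun t => 0 + 1 * (v * t)) (fun _ => v) (fun t => by
      simpa using (hasDerivAt_id t).const_mul (v : ℝ)),
    hd (fun t => v + (0 + 1 * (v * t)) * (v * t)) (fun t => 2 * v ^ 2 * t) (fun t => by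
      have := ((hasDerivAt_pow 2 t).const_mul ((v : ℝ) ^ 2)).const_add (v : ℝ)
      rw [show (fun t : ℝ => v + (0 + 1 * (v * t)) * (v * t)) = fun t : ℝ => (v : ℝ) + (v : ℝ) ^ 2 * t ^ 2 by
        ext s; ring]
      exact this.congr_deriv (by norm_num; ring)),
    hd (fun t => 2 * v ^ 2 * t + (v + (0 + 1 * (v * t)) * (v * t)) * (v * t))
      (fun t => 3 * v ^ 2 + 3 * v ^ 3 * t ^ 2) (fun t => by
      have := ((hasDerivAt_id t).const_mul (3 * (v : ℝ) ^ 2)).add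
        ((hasDerivAt_pow 3 t).const_mul ((v : ℝ) ^ 3))
      rw [show (fun t : ℝ => 2 * v ^ 2 * t + (v + (0 + 1 * (v * t)) * (v * t)) * (v * t)) =
        fun t : ℝ => 3 * (v : ℝ) ^ 2 * t + (v : ℝ) ^ 3 * t ^ 3 by ext s; ring]
      exact this.congr_deriv (by norm_num; ring))]
  simp

end GaussianMoments

/-- The columns `g t` of the array are independent `N(0, S)` vectors. -/
structure IsGaussianArray {Ω : Type*} [MeasurableSpace Ω] (P : Measure Ω) {T m : ℕ}
    (S : Matrix (Fin m) (Fin m) ℝ) (g : Fin T → Ω → EuclideanSpace ℝ (Fin m)) : Prop where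
  posSemidef : S.PosSemidef
  measurable : ∀ t, Measurable (g t)
  law : ∀ t, HasLaw (g t) (multivariateGaussian 0 S) P
  indep : iIndepFun g P

/-- The linear form with coefficient array `a`. -/
def linForm {Ω : Type*} {T m : ℕ} (g : Fin T → Ω → EuclideanSpace ℝ (Fin m))
    (a : Fin T → Fin m → ℝ) (ω : Ω) : ℝ := ∑ t, ∑ i, a t i * g t ω i

/-- The covariance of two linear forms. -/
def covForm {T m : ℕ} (S : Matrix (Fin m) (Fin m) ℝ) (a b : Fin T → Fin m → ℝ) : ℝ :=
  ∑ t, ∑ i, ∑ j, a t i * b t j * S i j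

lemma covForm_add_left {T m : ℕ} (S : Matrix (Fin m) (Fin m) ℝ) (a b c : Fin T → Fin m → ℝ) :
    covForm S (a + b) c = covForm S a c + covForm S b c := by
  simp only [covForm, ← Finset.sum_add_distrib, Pi.add_apply]
  simp only [add_mul]

lemma covForm_smul_left {T m : ℕ} (S : Matrix (Fin m) (Fin m) ℝ) (x : ℝ)
    (a c : Fin T → Fin m → ℝ) : covForm S (x • a) c = x * covForm S a c := by
  simp only [covForm, Finset.mul_sum, Pi.smul_apply, smul_eq_mul, mul_assoc]

namespace IsGaussianArray

variable {Ω : Type*} [MeasurableSpace Ω] {P : Measure Ω} [IsProbabilityMeasure P] {T m : ℕ}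
    {S : Matrix (Fin m) (Fin m) ℝ} {g : Fin T → Ω → EuclideanSpace ℝ (Fin m)}

lemma covForm_comm (hg : IsGaussianArray P S g) (a b : Fin T → Fin m → ℝ) :
    covForm S a b = covForm S b a := by
  have hs : ∀ i j, S i j = S j i := fun i j => by
    have := congrFun (congrFun hg.posSemidef.isHermitian j) i
    simpa [Matrix.conjTranspose_apply] using this
  unfold covForm
  refine Finset.sum_congr rfl fun t _ => ?_
  rw [Finset.sum_comm]
  refine Finset.sum_congr rfl fun i _ => Finset.sum_congr rfl fun j _ => ?_
  rw [hs j i]; ring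

lemma hasGaussianLaw (hg : IsGaussianArray P S g) :
    HasGaussianLaw (fun ω => (g · ω)) P :=
  hg.indep.hasGaussianLaw fun t => (hg.law t).hasGaussianLaw

lemma measurable_linForm (hg : IsGaussianArray P S g) (a : Fin T → Fin m → ℝ) :
    Measurable (linForm g a) := by
  have := hg.measurable
  unfold linForm
  fun_prop

/-- The linear form as a continuous linear map on arrays. -/
def linFormCLM (a : Fin T → Fin m → ℝ) : (Fin T → EuclideanSpace ℝ (Fin m)) →L[ℝ] ℝ :=
  ∑ t, ∑ i, a t i • ((EuclideanSpace.proj i).comp (ContinuousLinearMap.proj t))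

lemma linFormCLM_apply (a : Fin T → Fin m → ℝ) (ω : Ω) :
    linFormCLM a (fun t => g t ω) = linForm g a ω := by
  simp [linFormCLM, linForm]

lemma hasGaussianLaw_linForm (hg : IsGaussianArray P S g) (a : Fin T → Fin m → ℝ) :
    HasGaussianLaw (linForm g a) P := by
  have h := hg.hasGaussianLaw.map_fun (linFormCLM a)
  simpa only [linFormCLM_apply] using h

lemma hasGaussianLaw_linForm_pair (hg : IsGaussianArray P S g) (a b : Fin T → Fin m → ℝ) :
    HasGaussianLaw (fun ω => (linForm g a ω, linForm g b ω)) P := by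
  have h := hg.hasGaussianLaw.map_fun ((linFormCLM a).prod (linFormCLM b))
  simpa only [ContinuousLinearMap.prod_apply, linFormCLM_apply] using h

lemma hasGaussianLaw_entry (hg : IsGaussianArray P S g) (t : Fin T) (i : Fin m) :
    HasGaussianLaw (fun ω => g t ω i) P :=
  (hg.law t).hasGaussianLaw.map_fun (EuclideanSpace.proj i)

lemma integral_entry (hg : IsGaussianArray P S g) (t : Fin T) (i : Fin m) :
    ∫ ω, g t ω i ∂P = 0 := by
  have h := (hg.law t).integral_comp (f := fun x : EuclideanSpace ℝ (Fin m) => x i)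
    (by fun_prop)
  have h2 : ∫ x, x i ∂(multivariateGaussian 0 S) = 0 := by
    have h3 := (EuclideanSpace.proj i : EuclideanSpace ℝ (Fin m) →L[ℝ] ℝ).integral_comp_comm
      (IsGaussian.integrable_id (μ := multivariateGaussian 0 S))
    simp only [id_eq] at h3
    rw [integral_id_multivariateGaussian] at h3
    simpa using h3
  rw [← h2, ← h]
  rfl

lemma covariance_entry (hg : IsGaussianArray P S g) (t s : Fin T) (i j : Fin m) :
    cov[fun ω => g t ω i, fun ω => g s ω j; P] = if t = s then S i j else 0 := by
  split_ifs with h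
  · subst h
    rw [← covariance_eval_multivariateGaussian (μ := 0) hg.posSemidef i j]
    exact (hg.law t).covariance_fun_comp (f := fun x => x i) (g := fun x => x j) (by fun_prop)
      (by fun_prop)
  · refine IndepFun.covariance_eq_zero ?_ (hg.hasGaussianLaw_entry t i).memLp_two
      (hg.hasGaussianLaw_entry s j).memLp_two
    exact (hg.indep.indepFun h).comp (φ := fun x : EuclideanSpace ℝ (Fin m) => x i)
      (ψ := fun x : EuclideanSpace ℝ (Fin m) => x j) (by fun_prop) (by fun_prop)

lemma integral_linForm (hg : IsGaussianArray P S g) (a : Fin T → Fin m → ℝ) :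
    ∫ ω, linForm g a ω ∂P = 0 := by
  unfold linForm
  have hi : ∀ t i, Integrable (fun ω => a t i * g t ω i) P := fun t i =>
    (hg.hasGaussianLaw_entry t i).integrable.const_mul _
  rw [integral_finsetSum _ fun t _ => integrable_finsetSum _ fun i _ => hi t i]
  refine Finset.sum_eq_zero fun t _ => ?_
  rw [integral_finsetSum _ fun i _ => hi t i]
  refine Finset.sum_eq_zero fun i _ => ?_
  rw [integral_const_mul, hg.integral_entry, mul_zero]

lemma covariance_linForm (hg : IsGaussianArray P S g) (a b : Fin T → Fin m → ℝ) :
    cov[linForm g a, linForm g b; P] = covForm S a b := by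
  have hm : ∀ (a : Fin T → Fin m → ℝ) t i, MemLp (fun ω => a t i * g t ω i) 2 P := fun a t i =>
    (hg.hasGaussianLaw_entry t i).memLp_two.const_mul _
  have e : ∀ a : Fin T → Fin m → ℝ, linForm g a = fun ω => ∑ t, ∑ i, a t i * g t ω i :=
    fun a => rfl
  rw [e, e, covariance_fun_sum_fun_sum (fun t => memLp_finsetSum _ fun i _ => hm a t i)
    (fun t => memLp_finsetSum _ fun i _ => hm b t i)]
  unfold covForm
  refine Finset.sum_congr rfl fun t _ => ?_
  have h1 : ∀ s, cov[fun ω => ∑ i, a t i * g t ω i, fun ω => ∑ j, b s j * g s ω j; P] =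
      if t = s then ∑ i, ∑ j, a t i * b s j * S i j else 0 := fun s => by
    rw [covariance_fun_sum_fun_sum (fun i => hm a t i) (fun i => hm b s i)]
    simp_rw [covariance_const_mul_left, covariance_const_mul_right, hg.covariance_entry]
    split_ifs with h
    · exact Finset.sum_congr rfl fun i _ => Finset.sum_congr rfl fun j _ => by ring
    · simp
  rw [Finset.sum_congr rfl fun s _ => h1 s]
  simp

lemma variance_linForm (hg : IsGaussianArray P S g) (a : Fin T → Fin m → ℝ) :
    Var[linForm g a; P] = covForm S a a := by
  rw [← covariance_self (hg.measurable_linForm a).aemeasurable, hg.covariance_linForm]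

lemma covForm_self_nonneg (hg : IsGaussianArray P S g) (a : Fin T → Fin m → ℝ) :
    0 ≤ covForm S a a := by
  rw [← hg.variance_linForm]; exact variance_nonneg _ _

lemma hasLaw_linForm (hg : IsGaussianArray P S g) (a : Fin T → Fin m → ℝ) :
    HasLaw (linForm g a) (gaussianReal 0 (covForm S a a).toNNReal) P where
  aemeasurable := (hg.measurable_linForm a).aemeasurable
  map_eq := by
    rw [(hg.hasGaussianLaw_linForm a).map_eq_gaussianReal, hg.integral_linForm,
      hg.variance_linForm]

lemma integral_linForm_mul (hg : IsGaussianArray P S g) (a b : Fin T → Fin m → ℝ) :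
    ∫ ω, linForm g a ω * linForm g b ω ∂P = covForm S a b := by
  have h := covariance_eq_sub (hg.hasGaussianLaw_linForm a).memLp_two
    (hg.hasGaussianLaw_linForm b).memLp_two
  rw [hg.covariance_linForm, hg.integral_linForm, zero_mul, sub_zero] at h
  exact h.symm

lemma integrable_linForm_mul (hg : IsGaussianArray P S g) (a b : Fin T → Fin m → ℝ) :
    Integrable (fun ω => linForm g a ω * linForm g b ω) P :=
  (hg.hasGaussianLaw_linForm a).memLp_two.integrable_mul (hg.hasGaussianLaw_linForm b).memLp_two

lemma integrable_linForm_pow (hg : IsGaussianArray P S g) (a : Fin T → Fin m → ℝ) (n : ℕ) :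
    Integrable (fun ω => linForm g a ω ^ n) P := by
  rcases Nat.eq_zero_or_pos n with rfl | hn
  · simp
  have h := ((hg.hasGaussianLaw_linForm a).memLp (p := n) (by simp)).integrable_norm_pow
    (by omega)
  refine h.mono' ((hg.measurable_linForm a).pow_const n).aestronglyMeasurable ?_
  exact Eventually.of_forall fun ω => by simp

lemma integral_linForm_pow_four (hg : IsGaussianArray P S g) (a : Fin T → Fin m → ℝ) :
    ∫ ω, linForm g a ω ^ 4 ∂P = 3 * covForm S a a ^ 2 := by
  have h := (hg.hasLaw_linForm a).integral_comp (f := fun x : ℝ => x ^ 4) (by fun_prop)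
  rw [integral_pow_four_gaussianReal, Real.coe_toNNReal _ (hg.covForm_self_nonneg a)] at h
  exact h

lemma linForm_add (a b : Fin T → Fin m → ℝ) (ω : Ω) :
    linForm g (a + b) ω = linForm g a ω + linForm g b ω := by
  simp only [linForm, ← Finset.sum_add_distrib, Pi.add_apply, add_mul]

lemma linForm_smul (x : ℝ) (a : Fin T → Fin m → ℝ) (ω : Ω) :
    linForm g (x • a) ω = x * linForm g a ω := by
  simp only [linForm, Finset.mul_sum, Pi.smul_apply, smul_eq_mul, mul_assoc]

/-- Isserlis' formula for the fourth mixed moments. -/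
lemma integral_linForm_mul_four (hg : IsGaussianArray P S g) (a b c d : Fin T → Fin m → ℝ) :
    Integrable (fun ω => (linForm g a ω * linForm g b ω) * (linForm g c ω * linForm g d ω)) P ∧
    ∫ ω, (linForm g a ω * linForm g b ω) * (linForm g c ω * linForm g d ω) ∂P =
      covForm S a b * covForm S c d + covForm S a c * covForm S b d +
        covForm S a d * covForm S b c := by
  let s : ℝ → ℝ → ℝ → (Fin T → Fin m → ℝ) := fun x y z => a + x • b + y • c + z • d
  have hs : ∀ x y z ω, linForm g (s x y z) ω =
      linForm g a ω + x * linForm g b ω + y * linForm g c ω + z * linForm g d ω := by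
    intro x y z ω; simp only [s, linForm_add, linForm_smul]
  -- Polarisation: the fourth powers of a ± b ± c ± d, summed over the eight sign patterns with the
  -- product of the signs, give 8 · 24 = 192 times abcd. Only fourth moments of single Gaussian
  -- variables are then needed.
  have e : (fun ω => (linForm g a ω * linForm g b ω) * (linForm g c ω * linForm g d ω)) =
      fun ω => (1 / 192) * ((linForm g (s 1 1 1) ω ^ 4 - linForm g (s (-1) 1 1) ω ^ 4
        - linForm g (s 1 (-1) 1) ω ^ 4 - linForm g (s 1 1 (-1)) ω ^ 4
        + linForm g (s (-1) (-1) 1) ω ^ 4 + linForm g (s (-1) 1 (-1)) ω ^ 4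
        + linForm g (s 1 (-1) (-1)) ω ^ 4 - linForm g (s (-1) (-1) (-1)) ω ^ 4)) := by
    ext ω; simp only [hs]; ring
  have hi := fun x y z => hg.integrable_linForm_pow (s x y z) 4
  have hc : ∀ x y z, covForm S (s x y z) (s x y z) =
      covForm S a a + x ^ 2 * covForm S b b + y ^ 2 * covForm S c c + z ^ 2 * covForm S d d
      + 2 * (x * covForm S a b + y * covForm S a c + z * covForm S a d + x * y * covForm S b c
      + x * z * covForm S b d + y * z * covForm S c d) := by
    intro x y z
    have h1 : ∀ u, covForm S (s x y z) u = covForm S a u + x * covForm S b u +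
        y * covForm S c u + z * covForm S d u := fun u => by
      simp only [s, covForm_add_left, covForm_smul_left]
    rw [h1, hg.covForm_comm a, hg.covForm_comm b, hg.covForm_comm c, hg.covForm_comm d, h1, h1,
      h1, h1, hg.covForm_comm b a, hg.covForm_comm c a, hg.covForm_comm d a, hg.covForm_comm c b,
      hg.covForm_comm d b, hg.covForm_comm d c]
    ring
  have hI := fun x y z => And.intro (hi x y z) (hg.integral_linForm_pow_four (s x y z))
  have hadd : ∀ {f₁ f₂ : Ω → ℝ} {c₁ c₂ : ℝ}, (Integrable f₁ P ∧ ∫ ω, f₁ ω ∂P = c₁) →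
      (Integrable f₂ P ∧ ∫ ω, f₂ ω ∂P = c₂) →
      (Integrable (fun ω => f₁ ω + f₂ ω) P ∧ ∫ ω, (f₁ ω + f₂ ω) ∂P = c₁ + c₂) :=
    fun h₁ h₂ => ⟨h₁.1.add h₂.1, by rw [integral_add h₁.1 h₂.1, h₁.2, h₂.2]⟩
  have hsub : ∀ {f₁ f₂ : Ω → ℝ} {c₁ c₂ : ℝ}, (Integrable f₁ P ∧ ∫ ω, f₁ ω ∂P = c₁) →
      (Integrable f₂ P ∧ ∫ ω, f₂ ω ∂P = c₂) →
      (Integrable (fun ω => f₁ ω - f₂ ω) P ∧ ∫ ω, (f₁ ω - f₂ ω) ∂P = c₁ - c₂) :=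
    fun h₁ h₂ => ⟨h₁.1.sub h₂.1, by rw [integral_sub h₁.1 h₂.1, h₁.2, h₂.2]⟩
  have key := hsub (hadd (hadd (hadd (hsub (hsub (hsub (hI 1 1 1) (hI (-1) 1 1)) (hI 1 (-1) 1))
    (hI 1 1 (-1))) (hI (-1) (-1) 1)) (hI (-1) 1 (-1))) (hI 1 (-1) (-1))) (hI (-1) (-1) (-1))
  rw [e, integral_const_mul, key.2]
  refine ⟨key.1.const_mul _, ?_⟩
  simp only [hc]
  ring

end IsGaussianArray

/-! ### Markov's inequality and conditioning on an independent component. -/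

section Tools

variable {Ω : Type*} [MeasurableSpace Ω] {P : Measure Ω} [IsProbabilityMeasure P]

/-- Markov's inequality in the form used for the moment bounds. -/
lemma prob_gt_le_of_integral_le {f : Ω → ℝ} (hf : ∀ ω, 0 ≤ f ω) (hi : Integrable f P) {B K : ℝ}
    (hB : 0 < B) (hK : 0 < K) (h : ∫ ω, f ω ∂P ≤ B) :
    P {ω | K * B < f ω} ≤ ENNReal.ofReal K⁻¹ := by
  have h1 := mul_meas_ge_le_integral_of_nonneg (μ := P) (Eventually.of_forall hf) hi (K * B)
  have h2 : P.real {ω | K * B < f ω} ≤ P.real {ω | K * B ≤ f ω} :=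
    measureReal_mono fun ω (hω : K * B < f ω) => hω.le
  have h3 : P.real {ω | K * B < f ω} ≤ K⁻¹ := by
    rw [← one_div, le_div_iff₀ hK]
    have h4 : K * B * P.real {ω | K * B < f ω} ≤ B :=
      (mul_le_mul_of_nonneg_left h2 (by positivity)).trans (h1.trans h)
    refine le_of_mul_le_mul_right ?_ hB
    linarith
  rw [← ofReal_measureReal]
  exact ENNReal.ofReal_le_ofReal h3

/-- A bound on the probability given one of two independent components is a bound on the
probability. -/
lemma prob_le_of_indepFun {α β : Type*} [MeasurableSpace α] [MeasurableSpace β] {A : Ω → α}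
    {B : Ω → β} (hA : Measurable A) (hB : Measurable B) (h : IndepFun A B P) {D : Set α}
    (hD : MeasurableSet D) {S : Set (α × β)} (hS : MeasurableSet S) {ε : ENNReal}
    (hε : ∀ a ∈ D, P {ω | (a, B ω) ∈ S} ≤ ε) : P {ω | A ω ∈ D ∧ (A ω, B ω) ∈ S} ≤ ε := by
  have hm := (indepFun_iff_map_prod_eq_prod_map_map hA.aemeasurable hB.aemeasurable).1 h
  have hpA : IsProbabilityMeasure (P.map A) := Measure.isProbabilityMeasure_map hA.aemeasurable
  have hpB : IsProbabilityMeasure (P.map B) := Measure.isProbabilityMeasure_map hB.aemeasurable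
  have hDS : MeasurableSet ((D ×ˢ Set.univ) ∩ S) := (hD.prod MeasurableSet.univ).inter hS
  have h1 : P {ω | A ω ∈ D ∧ (A ω, B ω) ∈ S} =
      (P.map fun ω => (A ω, B ω)) ((D ×ˢ Set.univ) ∩ S) := by
    rw [Measure.map_apply (hA.prodMk hB) hDS]
    congr 1; ext ω; simp
  rw [h1, hm, Measure.prod_apply hDS]
  calc ∫⁻ a, (P.map B) (Prod.mk a ⁻¹' ((D ×ˢ Set.univ) ∩ S)) ∂(P.map A)
      ≤ ∫⁻ _, ε ∂(P.map A) := by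
        refine lintegral_mono fun a => ?_
        rw [Measure.map_apply hB (measurable_prodMk_left hDS)]
        by_cases ha : a ∈ D
        · refine (measure_mono ?_).trans (hε a ha)
          intro ω hω; exact hω.2
        · have : B ⁻¹' (Prod.mk a ⁻¹' ((D ×ˢ Set.univ) ∩ S)) = ∅ := by
            ext ω; simp [ha]
          rw [this]; simp
    _ = ε := by simp

end Tools

/-! ### Second moments of quadratic statistics of a Gaussian array. -/

lemma covForm_outer {T m : ℕ} (S : Matrix (Fin m) (Fin m) ℝ) (x y : Fin T → ℝ)
    (b c : Fin m → ℝ) : covForm S (fun t i => x t * b i) (fun t i => y t * c i) =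
      (∑ t, x t * y t) * ∑ i, ∑ j, b i * c j * S i j := by
  unfold covForm
  rw [Finset.sum_mul]
  refine Finset.sum_congr rfl fun t _ => ?_
  simp only [Finset.mul_sum]
  exact Finset.sum_congr rfl fun i _ => Finset.sum_congr rfl fun j _ => by ring

lemma linForm_outer {Ω : Type*} {T m : ℕ} (g : Fin T → Ω → EuclideanSpace ℝ (Fin m))
    (x : Fin T → ℝ) (b : Fin m → ℝ) (ω : Ω) :
    linForm g (fun t i => x t * b i) ω = ∑ t, ∑ i, x t * b i * g t ω i := rfl

lemma linForm_outer_single {Ω : Type*} {T m : ℕ} (g : Fin T → Ω → EuclideanSpace ℝ (Fin m))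
    (x : Fin T → ℝ) (j : Fin m) (ω : Ω) :
    linForm g (fun t i => x t * (Pi.single j 1 : Fin m → ℝ) i) ω = ∑ t, x t * g t ω j := by
  rw [linForm_outer]
  refine Finset.sum_congr rfl fun t _ => ?_
  rw [Finset.sum_eq_single j]
  · simp
  · intro i _ hij; simp [hij]
  · simp

lemma linForm_single_outer {Ω : Type*} {T m : ℕ} (g : Fin T → Ω → EuclideanSpace ℝ (Fin m))
    (s : Fin T) (b : Fin m → ℝ) (ω : Ω) :
    linForm g (fun t i => (Pi.single s 1 : Fin T → ℝ) t * b i) ω = ∑ i, b i * g s ω i := by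
  rw [linForm_outer, Finset.sum_eq_single s]
  · simp
  · intro i _ hij; simp [hij]
  · simp

lemma sum_single_mul_single {m : ℕ} (S : Matrix (Fin m) (Fin m) ℝ) (i j : Fin m) :
    ∑ a, ∑ b, (Pi.single i 1 : Fin m → ℝ) a * (Pi.single j 1 : Fin m → ℝ) b * S a b = S i j := by
  rw [Finset.sum_eq_single i, Finset.sum_eq_single j]
  · simp
  · intro b _ hb; simp [hb]
  · simp
  · intro b _ hb; simp [hb]
  · simp

namespace IsGaussianArray

variable {Ω : Type*} [MeasurableSpace Ω] {P : Measure Ω} [IsProbabilityMeasure P] {T m : ℕ}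
    {S : Matrix (Fin m) (Fin m) ℝ} {g : Fin T → Ω → EuclideanSpace ℝ (Fin m)}

lemma integral_sum_linForm_sq (hg : IsGaussianArray P S g) {ι : Type*} [Fintype ι]
    (a : ι → Fin T → Fin m → ℝ) :
    Integrable (fun ω => ∑ j, linForm g (a j) ω ^ 2) P ∧
    ∫ ω, ∑ j, linForm g (a j) ω ^ 2 ∂P = ∑ j, covForm S (a j) (a j) := by
  have hi := fun j => hg.integrable_linForm_pow (a j) 2
  refine ⟨integrable_finsetSum _ fun j _ => hi j, ?_⟩
  rw [integral_finsetSum _ fun j _ => hi j]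
  refine Finset.sum_congr rfl fun j _ => ?_
  rw [← hg.integral_linForm_mul]
  simp only [sq]

/-- The variance of a quadratic form. -/
lemma integral_sum_mul_sub_sq (hg : IsGaussianArray P S g) {ι : Type*} [Fintype ι]
    (a b : ι → Fin T → Fin m → ℝ) :
    Integrable (fun ω => (∑ j, linForm g (a j) ω * linForm g (b j) ω -
      ∑ j, covForm S (a j) (b j)) ^ 2) P ∧
    ∫ ω, (∑ j, linForm g (a j) ω * linForm g (b j) ω - ∑ j, covForm S (a j) (b j)) ^ 2 ∂P =
      ∑ i, ∑ j, (covForm S (a i) (a j) * covForm S (b i) (b j) +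
        covForm S (a i) (b j) * covForm S (b i) (a j)) := by
  set c := ∑ j, covForm S (a j) (b j) with hc
  have h4 := fun i j => hg.integral_linForm_mul_four (a i) (b i) (a j) (b j)
  have h2 := fun j => hg.integrable_linForm_mul (a j) (b j)
  have e : (fun ω => (∑ j, linForm g (a j) ω * linForm g (b j) ω - c) ^ 2) = fun ω =>
      (∑ i, ∑ j, (linForm g (a i) ω * linForm g (b i) ω) *
        (linForm g (a j) ω * linForm g (b j) ω)) -
      (2 * c) * (∑ j, linForm g (a j) ω * linForm g (b j) ω) + c ^ 2 := by
    ext ω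
    rw [← Finset.sum_mul_sum]; ring
  have i1 : Integrable (fun ω => ∑ i, ∑ j, (linForm g (a i) ω * linForm g (b i) ω) *
        (linForm g (a j) ω * linForm g (b j) ω)) P :=
    integrable_finsetSum _ fun i _ => integrable_finsetSum _ fun j _ => (h4 i j).1
  have i2 : Integrable (fun ω => ∑ j, linForm g (a j) ω * linForm g (b j) ω) P :=
    integrable_finsetSum _ fun j _ => h2 j
  have i3 : Integrable (fun ω => (2 * c) * ∑ j, linForm g (a j) ω * linForm g (b j) ω) P :=
    i2.const_mul _
  have i4 : Integrable (fun ω => (∑ i, ∑ j, (linForm g (a i) ω * linForm g (b i) ω) *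
        (linForm g (a j) ω * linForm g (b j) ω)) -
      (2 * c) * (∑ j, linForm g (a j) ω * linForm g (b j) ω)) P := i1.sub i3
  rw [e]
  refine ⟨i4.add (integrable_const _), ?_⟩
  rw [integral_add i4 (integrable_const _), integral_sub i1 i3, integral_const_mul,
    integral_finsetSum _ fun i _ => integrable_finsetSum _ fun j _ => (h4 i j).1,
    integral_finsetSum _ fun j _ => h2 j, integral_const]
  simp_rw [integral_finsetSum _ fun j _ => (h4 _ j).1, (h4 _ _).2, hg.integral_linForm_mul]
  rw [← hc]
  -- Among the three pairings in Isserlis' formula, the one inside each product sums to the squared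
  -- mean and cancels after centring; the two cross pairings form the variance.
  have e2 : ∑ i, ∑ j, (covForm S (a i) (b i) * covForm S (a j) (b j) +
      covForm S (a i) (a j) * covForm S (b i) (b j) +
        covForm S (a i) (b j) * covForm S (b i) (a j)) = c ^ 2 +
      ∑ i, ∑ j, (covForm S (a i) (a j) * covForm S (b i) (b j) +
        covForm S (a i) (b j) * covForm S (b i) (a j)) := by
    rw [sq, hc, Finset.sum_mul_sum, ← Finset.sum_add_distrib]
    refine Finset.sum_congr rfl fun i _ => ?_
    rw [← Finset.sum_add_distrib]
    exact Finset.sum_congr rfl fun j _ => by ring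
  rw [e2]
  simp
  ring

/-- Gram matrix across time points, applied to a fixed vector `x`. -/
lemma integral_gram_mulVec (hg : IsGaussianArray P S g) (x : Fin T → ℝ) :
    Integrable (fun ω => ∑ s, (∑ i, g s ω i * (∑ t, x t * g t ω i) - x s * S.trace) ^ 2) P ∧
    ∫ ω, ∑ s, (∑ i, g s ω i * (∑ t, x t * g t ω i) - x s * S.trace) ^ 2 ∂P =
      (T + 1) * (∑ t, x t ^ 2) * ∑ i, ∑ j, S i j ^ 2 := by
  have hs : ∀ i j, S i j = S j i := fun i j => by
    have := congrFun (congrFun hg.posSemidef.isHermitian j) i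
    simpa [Matrix.conjTranspose_apply] using this
  -- Coefficient arrays: `a s j` reads off a single entry, `b j` the combination of the j-th
  -- coordinates with weights `x`.
  let a : Fin T → Fin m → Fin T → Fin m → ℝ := fun s j t i =>
    (Pi.single s 1 : Fin T → ℝ) t * (Pi.single j 1 : Fin m → ℝ) i
  let b : Fin m → Fin T → Fin m → ℝ := fun j t i => x t * (Pi.single j 1 : Fin m → ℝ) i
  have ha : ∀ s j ω, linForm g (a s j) ω = g s ω j := fun s j ω => by
    simp only [a, linForm_outer_single]
    rw [Finset.sum_eq_single s]
    · simp
    · intro t _ ht; simp [ht]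
    · simp
  have hb : ∀ j ω, linForm g (b j) ω = ∑ t, x t * g t ω j := fun j ω => by
    simp only [b, linForm_outer_single]
  have caa : ∀ s i j, covForm S (a s i) (a s j) = S i j := fun s i j => by
    simp only [a, covForm_outer, sum_single_mul_single]
    rw [Finset.sum_eq_single s] <;> simp +contextual
  have cab : ∀ s i j, covForm S (a s i) (b j) = x s * S i j := fun s i j => by
    simp only [a, b, covForm_outer, sum_single_mul_single]
    rw [Finset.sum_eq_single s] <;> simp +contextual
  have cba : ∀ s i j, covForm S (b i) (a s j) = x s * S i j := fun s i j => by
    rw [hg.covForm_comm, cab, hs]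
  have cbb : ∀ i j, covForm S (b i) (b j) = (∑ t, x t ^ 2) * S i j := fun i j => by
    simp only [b, covForm_outer, sum_single_mul_single, sq]
  have key := fun s => hg.integral_sum_mul_sub_sq (a s) b
  have htr : ∀ s, ∑ j, covForm S (a s j) (b j) = x s * S.trace := fun s => by
    simp only [cab, Matrix.trace, Matrix.diag_apply, Finset.mul_sum]
  simp only [ha, hb, htr] at key
  refine ⟨integrable_finsetSum _ fun s _ => (key s).1, ?_⟩
  rw [integral_finsetSum _ fun s _ => (key s).1]
  simp only [(key _).2, caa, cbb, cab, cba]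
  have e : ∀ s, ∑ i, ∑ j, (S i j * ((∑ t, x t ^ 2) * S i j) + x s * S i j * (x s * S i j)) =
      ((∑ t, x t ^ 2) + x s ^ 2) * ∑ i, ∑ j, S i j ^ 2 := fun s => by
    simp only [Finset.mul_sum]
    exact Finset.sum_congr rfl fun i _ => Finset.sum_congr rfl fun j _ => by ring
  simp only [e]
  rw [← Finset.sum_mul, Finset.sum_add_distrib]
  simp only [Finset.sum_const, Finset.card_univ, Fintype.card_fin, nsmul_eq_mul]
  ring

/-- Sample second moments of a standard Gaussian array. -/
lemma integral_sample_moment {g : Fin T → Ω → EuclideanSpace ℝ (Fin m)}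
    (hg : IsGaussianArray P 1 g) (k l : Fin m) :
    Integrable (fun ω => (∑ t, g t ω k * g t ω l - T * (1 : Matrix (Fin m) (Fin m) ℝ) k l) ^ 2) P ∧
    ∫ ω, (∑ t, g t ω k * g t ω l - T * (1 : Matrix (Fin m) (Fin m) ℝ) k l) ^ 2 ∂P ≤ 2 * T := by
  let a : Fin m → Fin T → Fin T → Fin m → ℝ := fun j s t i =>
    (Pi.single s 1 : Fin T → ℝ) t * (Pi.single j 1 : Fin m → ℝ) i
  have ha : ∀ s j ω, linForm g (a j s) ω = g s ω j := fun s j ω => by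
    simp only [a, linForm_outer_single]
    rw [Finset.sum_eq_single s]
    · simp
    · intro t _ ht; simp [ht]
    · simp
  have caa : ∀ s t i j, covForm 1 (a i s) (a j t) =
      if s = t then (1 : Matrix (Fin m) (Fin m) ℝ) i j else 0 := fun s t i j => by
    simp only [a, covForm_outer, sum_single_mul_single]
    rw [Finset.sum_eq_single s]
    · by_cases h : s = t
      · simp [h]
      · simp [h]
    · simp +contextual
    · simp
  have key := hg.integral_sum_mul_sub_sq (a k) (a l)
  simp only [ha, caa, if_true, Finset.sum_const, Finset.card_univ, Fintype.card_fin,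
    nsmul_eq_mul] at key
  refine ⟨key.1, ?_⟩
  rw [key.2]
  have e : ∀ s : Fin T, ∑ t, ((if s = t then (1 : Matrix (Fin m) (Fin m) ℝ) k k else 0) *
      (if s = t then (1 : Matrix (Fin m) (Fin m) ℝ) l l else 0) +
      (if s = t then (1 : Matrix (Fin m) (Fin m) ℝ) k l else 0) *
      (if s = t then (1 : Matrix (Fin m) (Fin m) ℝ) l k else 0)) ≤ 2 := fun s => by
    rw [Finset.sum_eq_single s]
    · simp only [if_true, Matrix.one_apply]
      split_ifs <;> norm_num
    · intro t _ ht; simp [Ne.symm ht]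
    · simp
  calc _ ≤ ∑ s : Fin T, (2 : ℝ) := Finset.sum_le_sum fun s _ => e s
    _ = 2 * T := by simp [mul_comm]

end IsGaussianArray

/-! ### Gaussian anticoncentration, tails, and exceedances of correlated pairs. -/

section GaussianTails

/-- The standard normal density is at most 1/√(2π) ≤ 1. -/
lemma gaussianReal_Icc_le (a b : ℝ) : gaussianReal 0 1 (Set.Icc a b) ≤ ENNReal.ofReal (b - a) := by
  rw [gaussianReal_apply 0 one_ne_zero]
  calc ∫⁻ x in Set.Icc a b, gaussianPDF 0 1 x ≤ ∫⁻ x in Set.Icc a b, 1 := by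
        refine lintegral_mono fun x => ?_
        rw [gaussianPDF, ← ENNReal.ofReal_one]
        refine ENNReal.ofReal_le_ofReal ?_
        rw [gaussianPDFReal]
        have h1 : Real.exp (-(x - 0) ^ 2 / (2 * ((1 : NNReal) : ℝ))) ≤ 1 := by
          rw [Real.exp_le_one_iff]
          have := sq_nonneg (x - 0)
          simp only [NNReal.coe_one]
          linarith
        have h2 : (√(2 * Real.pi * ((1 : NNReal) : ℝ)))⁻¹ ≤ 1 := by
          refine inv_le_one_of_one_le₀ ?_
          rw [Real.one_le_sqrt]
          have := Real.pi_gt_three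
          simp only [NNReal.coe_one]
          linarith
        exact mul_le_one₀ h2 (Real.exp_pos _).le h1
    _ = ENNReal.ofReal (b - a) := by simp

lemma gaussianReal_abs_near_le (z b : ℝ) :
    gaussianReal 0 1 {x | |(|x| - z)| ≤ b} ≤ ENNReal.ofReal (4 * b) := by
  rcases lt_or_ge b 0 with hb | hb
  · have : {x : ℝ | |(|x| - z)| ≤ b} = ∅ := by
      ext x; simp only [Set.mem_ofPred_eq, Set.mem_empty_iff_false, iff_false, not_le]
      exact hb.trans_le (abs_nonneg _)
    rw [this]; simp
  have hs : {x : ℝ | |(|x| - z)| ≤ b} ⊆ Set.Icc (z - b) (z + b) ∪ Set.Icc (-z - b) (-z + b) := by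
    intro x hx
    simp only [Set.mem_ofPred_eq, abs_le] at hx
    rcases abs_cases x with ⟨h1, h2⟩ | ⟨h1, h2⟩
    · left; constructor <;> linarith [hx.1, hx.2]
    · right; constructor <;> linarith [hx.1, hx.2]
  refine (measure_mono hs).trans ((measure_union_le _ _).trans ?_)
  refine (add_le_add (gaussianReal_Icc_le _ _) (gaussianReal_Icc_le _ _)).trans ?_
  rw [← ENNReal.ofReal_add (by linarith) (by linarith)]
  exact ENNReal.ofReal_le_ofReal (by linarith)

lemma integrable_abs_gaussianReal : Integrable (fun x : ℝ => |x|) (gaussianReal 0 1) :=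
  ((memLp_id_gaussianReal 1).integrable (by simp)).abs

lemma integral_abs_gaussianReal_le : ∫ x, |x| ∂(gaussianReal 0 1) ≤ 1 := by
  have h2 : Integrable (fun x : ℝ => x ^ 2) (gaussianReal 0 1) :=
    (memLp_id_gaussianReal 2).integrable_sq
  have h3 : ∫ x, x ^ 2 ∂(gaussianReal 0 1) = 1 := by
    have := variance_eq_sub (memLp_id_gaussianReal (μ := 0) (v := 1) 2)
    rw [variance_id_gaussianReal] at this
    simpa [integral_id_gaussianReal] using this.symm
  calc ∫ x, |x| ∂(gaussianReal 0 1) ≤ ∫ x, (1 / 2 + 1 / 2 * x ^ 2) ∂(gaussianReal 0 1) := by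
        refine integral_mono integrable_abs_gaussianReal
          ((integrable_const _).add (h2.const_mul _)) fun x => ?_
        have := sq_nonneg (|x| - 1)
        have := sq_abs x
        simp only
        nlinarith
    _ = 1 := by
        rw [integral_add (integrable_const _) (h2.const_mul _), integral_const_mul, h3]
        simp; norm_num

variable {Ω : Type*} [MeasurableSpace Ω] {P : Measure Ω} [IsProbabilityMeasure P]

/-- The exceedance indicators of two standard Gaussian variables have covariance at most of the
order of their correlation. -/
lemma abs_prob_inter_sub_le {X Y : Ω → ℝ} (hXY : HasGaussianLaw (fun ω => (X ω, Y ω)) P)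
    (hX : HasLaw X (gaussianReal 0 1) P) (hY : HasLaw Y (gaussianReal 0 1) P) {ρ z : ℝ}
    (hXm : Measurable X) (hYm : Measurable Y)
    (hρ : cov[X, Y; P] = ρ) (hz : 0 ≤ z) :
    |P.real {ω | z ≤ |X ω| ∧ z ≤ |Y ω|} - P.real {ω | z ≤ |X ω|} * P.real {ω | z ≤ |Y ω|}| ≤
      8 * (z + 2) * |ρ| := by
  have hp0 : ∀ s : Set Ω, 0 ≤ P.real s := fun s => measureReal_nonneg
  have hp1 : ∀ s : Set Ω, P.real s ≤ 1 := fun s => measureReal_le_one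
  -- For strong correlation the claim is trivial: the right side is at least 8.
  rcases le_or_gt (1 / 2) |ρ| with h | h
  · have h1 : |P.real {ω | z ≤ |X ω| ∧ z ≤ |Y ω|} -
        P.real {ω | z ≤ |X ω|} * P.real {ω | z ≤ |Y ω|}| ≤ 1 := by
      rw [abs_le]
      constructor
      · nlinarith [hp0 {ω | z ≤ |X ω| ∧ z ≤ |Y ω|}, hp1 {ω | z ≤ |X ω|}, hp1 {ω | z ≤ |Y ω|},
          hp0 {ω | z ≤ |X ω|}, hp0 {ω | z ≤ |Y ω|}]
      · nlinarith [hp1 {ω | z ≤ |X ω| ∧ z ≤ |Y ω|}, hp0 {ω | z ≤ |X ω|}, hp0 {ω | z ≤ |Y ω|}]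
    nlinarith
  have hρ2 : ρ ^ 2 ≤ 1 / 4 := by rw [← sq_abs]; nlinarith [abs_nonneg ρ]
  set s := √(1 - ρ ^ 2) with hs
  have hs2 : s ^ 2 = 1 - ρ ^ 2 := Real.sq_sqrt (by linarith)
  have hs0 : 0 ≤ s := Real.sqrt_nonneg _
  have hs1 : s ≤ 1 := by nlinarith [sq_nonneg ρ]
  have hs3 : 1 / 2 ≤ s := by nlinarith
  have hspos : 0 < s := by linarith
  -- Regression of Y on X: Y = ρX + sζ with ζ standard normal and independent of X. Exceedances of X
  -- and ζ factorise, so only the effect of replacing Y by ζ has to be estimated.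
  set ζ : Ω → ℝ := fun ω => s⁻¹ * (Y ω - ρ * X ω) with hζ
  have hζm : Measurable ζ := by fun_prop
  have hYζ : ∀ ω, Y ω = ρ * X ω + s * ζ ω := fun ω => by
    simp only [hζ]; rw [mul_inv_cancel_left₀ hspos.ne']; ring
  have hXζ : HasGaussianLaw (fun ω => (X ω, ζ ω)) P := by
    have := hXY.map_fun ((ContinuousLinearMap.fst ℝ ℝ ℝ).prod
      (s⁻¹ • (ContinuousLinearMap.snd ℝ ℝ ℝ - ρ • ContinuousLinearMap.fst ℝ ℝ ℝ)))
    simpa [hζ] using this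
  have hXL : MemLp X 2 P := hXY.fst.memLp_two
  have hYL : MemLp Y 2 P := hXY.snd.memLp_two
  have hvX : Var[X; P] = 1 := by rw [hX.variance_eq, variance_id_gaussianReal]; simp
  have hvY : Var[Y; P] = 1 := by rw [hY.variance_eq, variance_id_gaussianReal]; simp
  have hcov : cov[X, ζ; P] = 0 := by
    simp only [hζ]
    rw [covariance_const_mul_right, covariance_fun_sub_right hXL hYL (hXL.const_mul ρ),
      covariance_const_mul_right, hρ, covariance_self hXm.aemeasurable, hvX]
    simp
  have hζv : Var[ζ; P] = 1 := by
    simp only [hζ]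
    rw [variance_const_mul, variance_fun_sub hYL (hXL.const_mul ρ), variance_const_mul, hvX, hvY,
      covariance_const_mul_right, covariance_comm, hρ]
    rw [show 1 - 2 * (ρ * ρ) + ρ ^ 2 * 1 = s ^ 2 by rw [hs2]; ring]
    field_simp
  have hXi : ∫ ω, X ω ∂P = 0 := by rw [hX.integral_eq, integral_id_gaussianReal]
  have hYi : ∫ ω, Y ω ∂P = 0 := by rw [hY.integral_eq, integral_id_gaussianReal]
  have hζi : ∫ ω, ζ ω ∂P = 0 := by
    simp only [hζ]
    rw [integral_const_mul, integral_sub hXY.snd.integrable (hXY.fst.integrable.const_mul ρ),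
      integral_const_mul, hXi, hYi]
    simp
  have hζlaw : P.map ζ = gaussianReal 0 1 := by
    rw [hXζ.snd.map_eq_gaussianReal, hζi, hζv]; simp
  have hind : IndepFun X ζ P := hXζ.indepFun_of_covariance_eq_zero hcov
  have hset : MeasurableSet {x : ℝ | z ≤ |x|} := measurableSet_le measurable_const (by fun_prop)
  have e1 : P.real {ω | z ≤ |X ω|} * P.real {ω | z ≤ |Y ω|} =
      P.real {ω | z ≤ |X ω| ∧ z ≤ |ζ ω|} := by
    have h1 : P.real {ω | z ≤ |Y ω|} = P.real {ω | z ≤ |ζ ω|} := by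
      have h2 := hY.measureReal_eq (p := fun x => z ≤ |x|) hset
      have h3 := (HasLaw.mk hζm.aemeasurable hζlaw).measureReal_eq (p := fun x => z ≤ |x|) hset
      rw [h2, h3]
    rw [h1, measureReal_def, measureReal_def, measureReal_def, ← ENNReal.toReal_mul]
    congr 1
    exact (hind.measure_inter_preimage_eq_mul _ _ hset hset).symm
  rw [e1]
  set B : Set (ℝ × ℝ) := {p | |(|p.2| - z)| ≤ |ρ| * (z + 2 * |p.1|)} with hB
  have hBm : MeasurableSet B := measurableSet_le (by fun_prop) (by fun_prop)
  -- Since 1 − s ≤ ρ² ≤ |ρ|/2 and s ≥ 1/2, the replacement can change the exceedance only if |ζ|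
  -- lies within a distance of order |ρ| from the level.
  have hsub : ∀ ω, ¬ (z ≤ |Y ω| ↔ z ≤ |ζ ω|) → (X ω, ζ ω) ∈ B := by
    intro ω hω
    have t1 : |Y ω| ≤ |ρ| * |X ω| + s * |ζ ω| := by
      rw [hYζ ω]
      refine (abs_add_le _ _).trans ?_
      rw [abs_mul, abs_mul, abs_of_nonneg hs0]
    have t2 : s * |ζ ω| ≤ |Y ω| + |ρ| * |X ω| := by
      have : s * ζ ω = Y ω - ρ * X ω := by rw [hYζ ω]; ring
      rw [← abs_of_nonneg hs0, ← abs_mul, this, ← abs_mul]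
      exact abs_sub _ _
    have n1 := abs_nonneg (X ω)
    have n2 := abs_nonneg (ζ ω)
    have n3 := abs_nonneg ρ
    have n4 : 0 ≤ |ρ| * |X ω| := by positivity
    have n5 : 0 ≤ |ρ| * z := by positivity
    have hsρ : 1 - s ≤ ρ ^ 2 := by nlinarith
    have hρρ : ρ ^ 2 ≤ |ρ| / 2 := by rw [← sq_abs]; nlinarith
    simp only [hB, Set.mem_ofPred_eq, abs_le]
    by_cases hc : z ≤ |ζ ω|
    · have h3 : |Y ω| < z := by
        by_contra h4; exact hω ⟨fun _ => hc, fun _ => not_lt.1 h4⟩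
      constructor
      · linarith
      · have h5 : s * (|ζ ω| - z) ≤ |ρ| / 2 * z + |ρ| * |X ω| := by nlinarith
        nlinarith
    · have h3 : z ≤ |Y ω| := by
        by_contra h4; exact hω ⟨fun h => absurd h h4, fun h => absurd h hc⟩
      push Not at hc
      constructor
      · nlinarith
      · linarith
  have hPB : P.real {ω | (X ω, ζ ω) ∈ B} ≤ 4 * |ρ| * (z + 2) := by
    have hm := (indepFun_iff_map_prod_eq_prod_map_map hXm.aemeasurable hζm.aemeasurable).1 hind
    have h1 : P {ω | (X ω, ζ ω) ∈ B} = (P.map fun ω => (X ω, ζ ω)) B := by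
      rw [Measure.map_apply (hXm.prodMk hζm) hBm]; rfl
    have hi : Integrable (fun x : ℝ => 4 * (|ρ| * (z + 2 * |x|))) (gaussianReal 0 1) :=
      ((((integrable_const z).add (integrable_abs_gaussianReal.const_mul 2))).const_mul _).const_mul _
    have h2 : P {ω | (X ω, ζ ω) ∈ B} ≤
        ENNReal.ofReal (∫ x, 4 * (|ρ| * (z + 2 * |x|)) ∂(gaussianReal 0 1)) := by
      rw [h1, hm, hX.map_eq, hζlaw, Measure.prod_apply hBm,
        ofReal_integral_eq_lintegral_ofReal hi (Eventually.of_forall fun x => by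
          simp only [Pi.zero_apply]; positivity)]
      exact lintegral_mono fun x => gaussianReal_abs_near_le _ _
    rw [measureReal_def]
    refine ENNReal.toReal_le_of_le_ofReal (by positivity) (h2.trans
      (ENNReal.ofReal_le_ofReal ?_))
    rw [integral_const_mul, integral_const_mul,
      integral_add (integrable_const z) (integrable_abs_gaussianReal.const_mul 2),
      integral_const_mul, integral_const]
    have := integral_abs_gaussianReal_le
    have hr := abs_nonneg ρ
    simp only [probReal_univ, smul_eq_mul, one_mul]
    nlinarith
  have hle : ∀ p q : Ω → Prop, (∀ ω, p ω → ¬ q ω → (X ω, ζ ω) ∈ B) →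
      P.real {ω | p ω} ≤ P.real {ω | q ω} + P.real {ω | (X ω, ζ ω) ∈ B} := by
    intro p q hpq
    refine (measureReal_mono (?_ : {ω | p ω} ⊆ {ω | q ω} ∪ {ω | (X ω, ζ ω) ∈ B})).trans
      (measureReal_union_le _ _)
    intro ω hω
    by_cases hq : q ω
    · exact Or.inl hq
    · exact Or.inr (hpq ω hω hq)
  have a1 := hle (fun ω => z ≤ |X ω| ∧ z ≤ |Y ω|) (fun ω => z ≤ |X ω| ∧ z ≤ |ζ ω|)
    (fun ω hp hq => hsub ω fun hi => hq ⟨hp.1, hi.1 hp.2⟩)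
  have a2 := hle (fun ω => z ≤ |X ω| ∧ z ≤ |ζ ω|) (fun ω => z ≤ |X ω| ∧ z ≤ |Y ω|)
    (fun ω hp hq => hsub ω fun hi => hq ⟨hp.1, hi.2 hp.2⟩)
  have hr := abs_nonneg ρ
  rw [abs_le]
  constructor <;> nlinarith

/-- Chernoff's bound with exponent parameter ±ε/V. The scaling is such that L = log N yields 2N⁻²,
so a union over N units still leaves order N⁻¹. -/
lemma prob_abs_gt_le {X : Ω → ℝ} {v : NNReal} (hX : HasLaw X (gaussianReal 0 v) P) {V L : ℝ}
    (hv : (v : ℝ) ≤ V) (hV : 0 < V) (hL : 0 ≤ L) :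
    P {ω | 2 * √L * √V < |X ω|} ≤ ENNReal.ofReal (2 * Real.exp (-2 * L)) := by
  set ε := 2 * √L * √V with hε
  have hε0 : 0 ≤ ε := by positivity
  have hε2 : ε ^ 2 = 4 * L * V := by
    rw [hε, mul_pow, mul_pow, Real.sq_sqrt hL, Real.sq_sqrt hV.le]; ring
  have hint : ∀ t, Integrable (fun ω => Real.exp (t * X ω)) P := fun t => by
    have h := integrable_exp_mul_gaussianReal (μ := 0) (v := v) t
    rw [← hX.map_eq] at h
    exact h.comp_aemeasurable hX.aemeasurable
  have hexp : ∀ t, t = ε / V ∨ t = -(ε / V) → Real.exp (-|t| * ε) * mgf X P t ≤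
      Real.exp (-2 * L) := by
    intro t ht
    have h1 : |t| = ε / V := by
      rcases ht with rfl | rfl
      · exact abs_of_nonneg (by positivity)
      · rw [abs_neg]; exact abs_of_nonneg (by positivity)
    have h2 : t ^ 2 = 4 * L / V := by
      rw [← sq_abs, h1, div_pow, hε2]; field_simp
    rw [mgf_gaussianReal hX.map_eq, ← Real.exp_add, Real.exp_le_exp, h1, h2]
    have h3 : ε / V * ε = 4 * L := by
      rw [div_mul_eq_mul_div, ← sq, hε2]; field_simp
    have h4 : (v : ℝ) * (4 * L / V) / 2 ≤ 2 * L := by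
      have : (v : ℝ) * (4 * L / V) ≤ V * (4 * L / V) :=
        mul_le_mul_of_nonneg_right hv (by positivity)
      rw [mul_div_cancel₀ _ hV.ne'] at this
      linarith
    linarith
  have hεV : 0 ≤ ε / V := by positivity
  have h1 : P.real {ω | ε ≤ X ω} ≤ Real.exp (-2 * L) := by
    refine (measure_ge_le_exp_mul_mgf ε hεV (hint _)).trans ?_
    have := hexp (ε / V) (Or.inl rfl)
    rwa [abs_of_nonneg hεV] at this
  have h2 : P.real {ω | X ω ≤ -ε} ≤ Real.exp (-2 * L) := by
    refine (measure_le_le_exp_mul_mgf (-ε) (neg_nonpos.2 hεV) (hint _)).trans ?_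
    have := hexp (-(ε / V)) (Or.inr rfl)
    rw [abs_neg, abs_of_nonneg hεV] at this
    rwa [show - -(ε / V) * -ε = -(ε / V) * ε by ring]
  have h3 : P.real {ω | ε < |X ω|} ≤ 2 * Real.exp (-2 * L) := by
    refine (measureReal_mono (?_ : _ ⊆ {ω | ε ≤ X ω} ∪ {ω | X ω ≤ -ε})).trans
      ((measureReal_union_le _ _).trans (by linarith))
    intro ω (hω : ε < |X ω|)
    rcases lt_abs.1 hω with h | h
    · exact Or.inl h.le
    · exact Or.inr (by simp only [Set.mem_ofPred_eq]; linarith)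
  rw [← ofReal_measureReal]
  exact ENNReal.ofReal_le_ofReal h3

end GaussianTails

/-! ### Concentration of sums of squared Gaussian variables. -/

section ChiSquare

/-- Quadratic estimates of the exponential on either side of zero. At x = 2s this is the bound (1 −
2s)^(-1/2) ≤ exp(s + 2s²) for the generating function of a squared Gaussian. -/
lemma exp_neg_sub_sq_le {x : ℝ} (hx : |x| ≤ 1 / 2) : Real.exp (-x - x ^ 2) ≤ 1 - x := by
  rw [abs_le] at hx
  rcases le_total x 0 with h | h
  · have h1 : |(-x - x ^ 2)| ≤ 1 := by
      rw [abs_le]; constructor <;> nlinarith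
    have h2 := Real.abs_exp_sub_one_sub_id_le h1
    rw [abs_le] at h2
    nlinarith [h2.2, mul_nonneg (neg_nonneg.2 h) (sq_nonneg x), sq_nonneg x,
      mul_nonneg (mul_nonneg (neg_nonneg.2 h) (sq_nonneg x)) (by linarith : 0 ≤ x + 2)]
  · have h1 := Real.quadratic_le_exp_of_nonneg (by positivity : 0 ≤ x + x ^ 2)
    have h2 : -x - x ^ 2 = -(x + x ^ 2) := by ring
    rw [h2, Real.exp_neg]
    have h3 : 0 < 1 - x := by linarith
    rw [inv_le_comm₀ (Real.exp_pos _) h3]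
    refine le_trans ?_ h1
    rw [inv_le_iff_one_le_mul₀ h3]
    have h5 : 0 ≤ (1 + x) ^ 2 * (1 - x) - 2 * x := by nlinarith [mul_nonneg h h3.le, sq_nonneg x, mul_nonneg (sq_nonneg x) h3.le]
    nlinarith [mul_nonneg (sq_nonneg x) h5]

/-- The exponents combine into a Gaussian integral, equal to (1 − 2s)^(-1/2), to which
`exp_neg_sub_sq_le` applies. -/
lemma integral_exp_mul_sq_gaussianReal {s : ℝ} (hs : |s| ≤ 1 / 4) :
    Integrable (fun x : ℝ => Real.exp (s * x ^ 2)) (gaussianReal 0 1) ∧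
    ∫ x, Real.exp (s * x ^ 2) ∂(gaussianReal 0 1) ≤ Real.exp (s + 2 * s ^ 2) := by
  have hs' := abs_le.1 hs
  have hb : 0 < 1 / 2 - s := by linarith
  have hpdf : ∀ x : ℝ, gaussianPDFReal 0 1 x * Real.exp (s * x ^ 2) =
      (√(2 * Real.pi))⁻¹ * Real.exp (-(1 / 2 - s) * x ^ 2) := fun x => by
    rw [gaussianPDFReal, mul_assoc, ← Real.exp_add]
    simp only [NNReal.coe_one, mul_one, sub_zero]
    congr 2; ring
  constructor
  · rw [gaussianReal_of_var_ne_zero 0 one_ne_zero,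
      integrable_withDensity_iff (measurable_gaussianPDF 0 1)
        (Eventually.of_forall fun x => gaussianPDF_lt_top)]
    simp only [toReal_gaussianPDF]
    have : (fun x : ℝ => Real.exp (s * x ^ 2) * gaussianPDFReal 0 1 x) = fun x =>
        (√(2 * Real.pi))⁻¹ * Real.exp (-(1 / 2 - s) * x ^ 2) := by
      ext x; rw [mul_comm, hpdf]
    rw [this]
    exact (integrable_exp_neg_mul_sq hb).const_mul _
  · rw [integral_gaussianReal_eq_integral_smul one_ne_zero]
    simp only [smul_eq_mul, hpdf]
    rw [integral_const_mul, integral_gaussian]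
    have h1 : (√(2 * Real.pi))⁻¹ * √(Real.pi / (1 / 2 - s)) = (√(1 - 2 * s))⁻¹ := by
      rw [← Real.sqrt_inv, ← Real.sqrt_mul (by positivity), ← Real.sqrt_inv]
      congr 1
      have hpi := Real.pi_pos.ne'
      have : (1 - 2 * s) ≠ 0 := by linarith
      have h3 : (1 / 2 - s) = (1 - 2 * s) / 2 := by ring
      rw [h3]
      field_simp
    rw [h1]
    have h2 := exp_neg_sub_sq_le (x := 2 * s) (by rw [abs_mul]; norm_num; linarith)
    have h3 : Real.exp (-(s + 2 * s ^ 2)) ≤ √(1 - 2 * s) := by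
      refine Real.le_sqrt_of_sq_le (le_trans (le_of_eq ?_) h2)
      rw [← Real.exp_nat_mul]; congr 1; push_cast; ring
    rw [inv_le_comm₀ (Real.sqrt_pos.2 (by linarith)) (Real.exp_pos _), ← Real.exp_neg]
    exact h3

variable {Ω : Type*} [MeasurableSpace Ω] {P : Measure Ω} [IsProbabilityMeasure P]

/-- Concentration of the mean of independent squared standard Gaussian variables. -/
lemma prob_chiSquare_le {T : ℕ} {U : Fin T → Ω → ℝ} (hU : ∀ t, HasLaw (U t) (gaussianReal 0 1) P)
    (hm : ∀ t, Measurable (U t)) (hind : iIndepFun U P) {x : ℝ} (hx0 : 0 ≤ x) (hx : x ≤ 1) :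
    P {ω | T * x < |∑ t, U t ω ^ 2 - T|} ≤ ENNReal.ofReal (2 * Real.exp (-(T * x ^ 2) / 8)) := by
  have hm2 : ∀ t, Measurable (fun ω => U t ω ^ 2) := fun t => (hm t).pow_const 2
  have hind2 : iIndepFun (fun t ω => U t ω ^ 2) P :=
    hind.comp (fun _ (y : ℝ) => y ^ 2) fun _ => by fun_prop
  have hi1 : ∀ s : ℝ, |s| ≤ 1 / 4 → ∀ t, Integrable (fun ω => Real.exp (s * U t ω ^ 2)) P := by
    intro s hs t
    have h := (integral_exp_mul_sq_gaussianReal hs).1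
    rw [← (hU t).map_eq] at h
    exact h.comp_aemeasurable (hm t).aemeasurable
  have hmgf : ∀ s : ℝ, |s| ≤ 1 / 4 → mgf (∑ t, fun ω => U t ω ^ 2) P s ≤
      Real.exp (s + 2 * s ^ 2) ^ T := by
    intro s hs
    rw [hind2.mgf_sum hm2]
    have h1 : ∀ t, mgf (fun ω => U t ω ^ 2) P s ≤ Real.exp (s + 2 * s ^ 2) := fun t => by
      have h := (hU t).integral_comp (f := fun y : ℝ => Real.exp (s * y ^ 2)) (by fun_prop)
      rw [mgf]
      exact (le_of_eq h).trans (integral_exp_mul_sq_gaussianReal hs).2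
    refine (Finset.prod_le_prod (fun t _ => mgf_nonneg) fun t _ => h1 t).trans (le_of_eq ?_)
    simp
  have hint : ∀ s : ℝ, |s| ≤ 1 / 4 → Integrable (fun ω => Real.exp (s *
      (∑ t, fun ω => U t ω ^ 2) ω)) P := fun s hs =>
    hind2.integrable_exp_mul_sum hm2 (s := Finset.univ) fun t _ => hi1 s hs t
  -- Both tails use s = ±x/4: the terms linear in x cancel, and Tx²/8 − Tx²/4 = −Tx²/8 remains in
  -- the exponent.
  have hx4 : |x / 4| ≤ 1 / 4 := by rw [abs_of_nonneg (by linarith)]; linarith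
  have hx4' : |(-(x / 4))| ≤ 1 / 4 := by rwa [abs_neg]
  have h1 : P.real {ω | (T : ℝ) + T * x ≤ (∑ t, fun ω => U t ω ^ 2) ω} ≤
      Real.exp (-(T * x ^ 2) / 8) := by
    refine (measure_ge_le_exp_mul_mgf _ (by linarith : 0 ≤ x / 4) (hint _ hx4)).trans ?_
    refine (mul_le_mul_of_nonneg_left (hmgf _ hx4) (Real.exp_pos _).le).trans ?_
    rw [← Real.exp_nat_mul, ← Real.exp_add, Real.exp_le_exp]
    apply le_of_eq; ring
  have h2 : P.real {ω | (∑ t, fun ω => U t ω ^ 2) ω ≤ (T : ℝ) - T * x} ≤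
      Real.exp (-(T * x ^ 2) / 8) := by
    refine (measure_le_le_exp_mul_mgf _ (by linarith : -(x / 4) ≤ 0) (hint _ hx4')).trans ?_
    refine (mul_le_mul_of_nonneg_left (hmgf _ hx4') (Real.exp_pos _).le).trans ?_
    rw [← Real.exp_nat_mul, ← Real.exp_add, Real.exp_le_exp]
    apply le_of_eq; ring
  have h3 : P.real {ω | T * x < |∑ t, U t ω ^ 2 - T|} ≤ 2 * Real.exp (-(T * x ^ 2) / 8) := by
    refine (measureReal_mono (?_ : _ ⊆ {ω | (T : ℝ) + T * x ≤ (∑ t, fun ω => U t ω ^ 2) ω} ∪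
      {ω | (∑ t, fun ω => U t ω ^ 2) ω ≤ (T : ℝ) - T * x})).trans
      ((measureReal_union_le _ _).trans (by linarith))
    intro ω (hω : T * x < |∑ t, U t ω ^ 2 - T|)
    rcases lt_abs.1 hω with h | h
    · left; simp only [Set.mem_ofPred_eq, Finset.sum_apply]; linarith
    · right; simp only [Set.mem_ofPred_eq, Finset.sum_apply]; linarith
  rw [← ofReal_measureReal]
  exact ENNReal.ofReal_le_ofReal h3

end ChiSquare

/-! ### Projections, loadings and exceedance counts of the noise. -/

namespace IsGaussianArray

variable {Ω : Type*} [MeasurableSpace Ω] {P : Measure Ω} [IsProbabilityMeasure P] {T m : ℕ}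
    {S : Matrix (Fin m) (Fin m) ℝ} {g : Fin T → Ω → EuclideanSpace ℝ (Fin m)}

/-- Independence over time makes the i-th projected coordinate have variance ‖w‖² S i i; dependence
between coordinates does not enter. -/
lemma integral_sum_dir_sq (hg : IsGaussianArray P S g) (w : Fin T → ℝ) :
    Integrable (fun ω => ∑ i, (∑ t, w t * g t ω i) ^ 2) P ∧
    ∫ ω, ∑ i, (∑ t, w t * g t ω i) ^ 2 ∂P = (∑ t, w t ^ 2) * S.trace := by
  have h := hg.integral_sum_linForm_sq fun j : Fin m => fun t i =>
    w t * (Pi.single j 1 : Fin m → ℝ) i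
  simp only [linForm_outer_single, covForm_outer, sum_single_mul_single] at h
  refine ⟨h.1, h.2.trans ?_⟩
  simp only [← sq, ← Finset.mul_sum, Matrix.trace, Matrix.diag_apply]

lemma integral_sum_mat_sq (hg : IsGaussianArray P S g) (D : Fin T → Fin T → ℝ) :
    Integrable (fun ω => ∑ t, ∑ i, (∑ s, D t s * g s ω i) ^ 2) P ∧
    ∫ ω, ∑ t, ∑ i, (∑ s, D t s * g s ω i) ^ 2 ∂P = (∑ t, ∑ s, D t s ^ 2) * S.trace := by
  have h := fun t => hg.integral_sum_dir_sq (D t)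
  refine ⟨integrable_finsetSum _ fun t _ => (h t).1, ?_⟩
  rw [integral_finsetSum _ fun t _ => (h t).1, Finset.sum_mul]
  exact Finset.sum_congr rfl fun t _ => (h t).2

lemma integral_sum_loading_dir_sq (hg : IsGaussianArray P S g) {r : ℕ}
    (γ : Matrix (Fin m) (Fin r) ℝ) (w : Fin T → ℝ) :
    Integrable (fun ω => ∑ k, (∑ i, γ i k * ∑ t, w t * g t ω i) ^ 2) P ∧
    ∫ ω, ∑ k, (∑ i, γ i k * ∑ t, w t * g t ω i) ^ 2 ∂P =
      (∑ t, w t ^ 2) * ∑ k, ∑ i, ∑ j, γ i k * γ j k * S i j := by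
  have h := hg.integral_sum_linForm_sq fun k : Fin r => fun t i => w t * γ i k
  have e : ∀ k ω, linForm g (fun t i => w t * γ i k) ω = ∑ i, γ i k * ∑ t, w t * g t ω i := by
    intro k ω
    rw [linForm, Finset.sum_comm]
    refine Finset.sum_congr rfl fun i _ => ?_
    rw [Finset.mul_sum]
    exact Finset.sum_congr rfl fun t _ => by ring
  simp only [e, covForm_outer] at h
  refine ⟨h.1, h.2.trans ?_⟩
  rw [← Finset.mul_sum]
  simp only [← sq]

lemma integral_sum_loading_sq (hg : IsGaussianArray P S g) {r : ℕ}
    (γ : Matrix (Fin m) (Fin r) ℝ) :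
    Integrable (fun ω => ∑ t, ∑ k, (∑ i, γ i k * g t ω i) ^ 2) P ∧
    ∫ ω, ∑ t, ∑ k, (∑ i, γ i k * g t ω i) ^ 2 ∂P =
      T * ∑ k, ∑ i, ∑ j, γ i k * γ j k * S i j := by
  have h := fun t : Fin T => hg.integral_sum_loading_dir_sq γ (Pi.single t 1)
  have e : ∀ t i ω, ∑ s, (Pi.single t 1 : Fin T → ℝ) s * g s ω i = g t ω i := fun t i ω => by
    rw [Finset.sum_eq_single t]
    · simp
    · intro s _ hs; simp [hs]
    · simp
  have e2 : ∀ t : Fin T, ∑ s, (Pi.single t 1 : Fin T → ℝ) s ^ 2 = 1 := fun t => by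
    rw [Finset.sum_eq_single t]
    · simp
    · intro s _ hs; simp [hs]
    · simp
  simp only [e, e2, one_mul] at h
  refine ⟨integrable_finsetSum _ fun t _ => (h t).1, ?_⟩
  rw [integral_finsetSum _ fun t _ => (h t).1]
  simp [(h _).2]

/-- `integral_gram_mulVec` at the standard basis vectors, summed over time. -/
lemma integral_gram (hg : IsGaussianArray P S g) :
    Integrable (fun ω => ∑ t, ∑ s, (∑ i, g s ω i * g t ω i -
      (1 : Matrix (Fin T) (Fin T) ℝ) t s * S.trace) ^ 2) P ∧
    ∫ ω, ∑ t, ∑ s, (∑ i, g s ω i * g t ω i -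
      (1 : Matrix (Fin T) (Fin T) ℝ) t s * S.trace) ^ 2 ∂P =
      T * (T + 1) * ∑ i, ∑ j, S i j ^ 2 := by
  have h := fun t : Fin T => hg.integral_gram_mulVec (Pi.single t 1)
  have e : ∀ t i ω, ∑ s, (Pi.single t 1 : Fin T → ℝ) s * g s ω i = g t ω i := fun t i ω => by
    rw [Finset.sum_eq_single t]
    · simp
    · intro s _ hs; simp [hs]
    · simp
  have e2 : ∀ t : Fin T, ∑ s, (Pi.single t 1 : Fin T → ℝ) s ^ 2 = 1 := fun t => by
    rw [Finset.sum_eq_single t]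
    · simp
    · intro s _ hs; simp [hs]
    · simp
  have e3 : ∀ t s : Fin T, (Pi.single t 1 : Fin T → ℝ) s = (1 : Matrix (Fin T) (Fin T) ℝ) t s :=
    fun t s => by simp [Matrix.one_apply, Pi.single_apply, eq_comm]
  simp only [e, e2, mul_one] at h
  simp only [e3] at h
  refine ⟨integrable_finsetSum _ fun t _ => (h t).1, ?_⟩
  rw [integral_finsetSum _ fun t _ => (h t).1]
  simp only [(h _).2, Finset.sum_const, Finset.card_univ, Fintype.card_fin, nsmul_eq_mul]
  ring

/-- The standardised projection of the `i`-th coordinate on `w`. -/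
def stdProj (S : Matrix (Fin m) (Fin m) ℝ) (w : Fin T → ℝ) (η : Fin T → EuclideanSpace ℝ (Fin m))
    (i : Fin m) : ℝ := (∑ t, w t * η t i) / √(S i i)

/-- Coefficients of the standardised projection. -/
def stdCoef (S : Matrix (Fin m) (Fin m) ℝ) (w : Fin T → ℝ) (i : Fin m) : Fin T → Fin m → ℝ :=
  fun t j => ((√(S i i))⁻¹ * w t) * (Pi.single i 1 : Fin m → ℝ) j

lemma linForm_stdCoef (w : Fin T → ℝ) (i : Fin m) (ω : Ω) :
    linForm g (stdCoef S w i) ω = stdProj S w (fun t => g t ω) i := by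
  unfold stdCoef
  rw [linForm_outer_single, stdProj, div_eq_inv_mul, Finset.mul_sum]
  exact Finset.sum_congr rfl fun t _ => by ring

/-- A unit vector in time leaves cross-sectional covariances unchanged, so the standardised
projections inherit exactly the idiosyncratic correlations. -/
lemma covForm_stdCoef {w : Fin T → ℝ} (hw : ∑ t, w t ^ 2 = 1) (i j : Fin m)
    (hi : 0 ≤ S i i) :
    covForm S (stdCoef S w i) (stdCoef S w j) = S i j / √(S i i * S j j) := by
  unfold stdCoef
  rw [covForm_outer, sum_single_mul_single, Real.sqrt_mul hi, div_eq_inv_mul, mul_inv]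
  have : ∑ t, (√(S i i))⁻¹ * w t * ((√(S j j))⁻¹ * w t) =
      (√(S i i))⁻¹ * (√(S j j))⁻¹ * ∑ t, w t ^ 2 := by
    rw [Finset.mul_sum]; exact Finset.sum_congr rfl fun t _ => by ring
  rw [this, hw, mul_one]

lemma hasLaw_stdProj (hg : IsGaussianArray P S g) {w : Fin T → ℝ} (hw : ∑ t, w t ^ 2 = 1)
    {i : Fin m} (hi : 0 < S i i) :
    HasLaw (fun ω => stdProj S w (fun t => g t ω) i) (gaussianReal 0 1) P := by
  have h := hg.hasLaw_linForm (stdCoef S w i)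
  rw [covForm_stdCoef hw i i hi.le, Real.sqrt_mul_self hi.le, div_self hi.ne'] at h
  have e : linForm g (stdCoef S w i) = fun ω => stdProj S w (fun t => g t ω) i := by
    ext ω; exact linForm_stdCoef w i ω
  rw [e] at h
  simpa using h

lemma measurable_stdProj (hg : IsGaussianArray P S g) (w : Fin T → ℝ) (i : Fin m) :
    Measurable fun ω => stdProj S w (fun t => g t ω) i := by
  have := hg.measurable
  unfold stdProj
  fun_prop

/-- The number of exceedances of a level by the standardised projections has variance of the order
of the sum of all correlations. -/
lemma integral_count_sq (hg : IsGaussianArray P S g) {w : Fin T → ℝ} (hw : ∑ t, w t ^ 2 = 1)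
    (hS : ∀ i, 0 < S i i) {z : ℝ} (hz : 0 ≤ z) :
    Integrable (fun ω => (∑ i, ((if z ≤ |stdProj S w (fun t => g t ω) i| then 1 else 0) -
      (gaussianReal 0 1).real {x | z ≤ |x|})) ^ 2) P ∧
    ∫ ω, (∑ i, ((if z ≤ |stdProj S w (fun t => g t ω) i| then 1 else 0) -
      (gaussianReal 0 1).real {x | z ≤ |x|})) ^ 2 ∂P ≤
      8 * (z + 2) * ∑ i, ∑ j, |S i j / √(S i i * S j j)| := by
  set ξ : Fin m → Ω → ℝ := fun i ω => stdProj S w (fun t => g t ω) i with hξ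
  set q := (gaussianReal 0 1).real {x | z ≤ |x|} with hq
  have hξm : ∀ i, Measurable (ξ i) := hg.measurable_stdProj w
  have hξl : ∀ i, HasLaw (ξ i) (gaussianReal 0 1) P := fun i => hg.hasLaw_stdProj hw (hS i)
  have hset : MeasurableSet {x : ℝ | z ≤ |x|} := measurableSet_le measurable_const (by fun_prop)
  have hms : ∀ i, MeasurableSet {ω | z ≤ |ξ i ω|} := fun i => (hξm i) hset
  set I : Fin m → Ω → ℝ := fun i ω => if z ≤ |ξ i ω| then 1 else 0 with hI
  have hIm : ∀ i, Measurable (I i) := fun i => Measurable.ite (hms i) measurable_const measurable_const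
  have hI1 : ∀ i ω, |I i ω| ≤ 1 := fun i ω => by simp only [hI]; split_ifs <;> simp
  have hIi : ∀ i, Integrable (I i) P := fun i =>
    Integrable.of_bound (hIm i).aestronglyMeasurable 1
      (Eventually.of_forall fun ω => by simpa using hI1 i ω)
  have hIIi : ∀ i j, Integrable (fun ω => I i ω * I j ω) P := fun i j =>
    Integrable.of_bound ((hIm i).mul (hIm j)).aestronglyMeasurable 1
      (Eventually.of_forall fun ω => by
        rw [Real.norm_eq_abs, abs_mul]; exact mul_le_one₀ (hI1 i ω) (abs_nonneg _) (hI1 j ω))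
  have hmean : ∀ i, ∫ ω, I i ω ∂P = q := fun i => by
    have h1 : I i = Set.indicator {ω | z ≤ |ξ i ω|} 1 := by
      ext ω; simp [hI, Set.indicator_apply]
    rw [h1, integral_indicator_one (hms i)]
    exact (hξl i).measureReal_eq (p := fun x => z ≤ |x|) hset
  have hprod : ∀ i j, ∫ ω, I i ω * I j ω ∂P = P.real {ω | z ≤ |ξ i ω| ∧ z ≤ |ξ j ω|} := by
    intro i j
    have h1 : (fun ω => I i ω * I j ω) = Set.indicator {ω | z ≤ |ξ i ω| ∧ z ≤ |ξ j ω|} 1 := by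
      ext ω
      by_cases h1 : z ≤ |ξ i ω| <;> by_cases h2 : z ≤ |ξ j ω| <;>
        simp [hI, h1, h2]
    rw [h1]
    exact integral_indicator_one ((hms i).inter (hms j))
  have hI2 : ∀ i j, Integrable (fun ω => (I i ω - q) * (I j ω - q)) P ∧
      ∫ ω, (I i ω - q) * (I j ω - q) ∂P ≤ 8 * (z + 2) * |S i j / √(S i i * S j j)| := by
    intro i j
    have e : (fun ω => (I i ω - q) * (I j ω - q)) = fun ω =>
        (I i ω * I j ω - q * I i ω) - (q * I j ω - q ^ 2) := by ext ω; ring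
    have i1 : Integrable (fun ω => I i ω * I j ω - q * I i ω) P :=
      (hIIi i j).sub ((hIi i).const_mul q)
    have i2 : Integrable (fun ω => q * I j ω - q ^ 2) P :=
      ((hIi j).const_mul q).sub (integrable_const _)
    rw [e]
    refine ⟨i1.sub i2, ?_⟩
    rw [integral_sub i1 i2, integral_sub (hIIi i j) ((hIi i).const_mul q),
      integral_sub ((hIi j).const_mul q) (integrable_const _), integral_const_mul,
      integral_const_mul, hmean, hmean, hprod, integral_const]
    have hp : ∀ i, P.real {ω | z ≤ |ξ i ω|} = q := fun i =>
      (hξl i).measureReal_eq (p := fun x => z ≤ |x|) hset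
    have hpair : HasGaussianLaw (fun ω => (ξ i ω, ξ j ω)) P := by
      have := hg.hasGaussianLaw_linForm_pair (stdCoef S w i) (stdCoef S w j)
      simpa only [linForm_stdCoef] using this
    have hcov : cov[ξ i, ξ j; P] = S i j / √(S i i * S j j) := by
      rw [← covForm_stdCoef hw i j (hS i).le, ← hg.covariance_linForm]
      congr 1 <;> (ext ω; rw [linForm_stdCoef])
    have key := abs_prob_inter_sub_le hpair (hξl i) (hξl j) (hξm i) (hξm j) hcov hz
    rw [hp, hp] at key
    refine le_trans (le_of_eq ?_) ((le_abs_self _).trans key)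
    simp only [probReal_univ, smul_eq_mul]
    ring
  have e : (fun ω => (∑ i, (I i ω - q)) ^ 2) = fun ω => ∑ i, ∑ j, (I i ω - q) * (I j ω - q) := by
    ext ω; rw [sq, Finset.sum_mul_sum]
  rw [e]
  refine ⟨integrable_finsetSum _ fun i _ => integrable_finsetSum _ fun j _ => (hI2 i j).1, ?_⟩
  rw [integral_finsetSum _ fun i _ => integrable_finsetSum _ fun j _ => (hI2 i j).1,
    Finset.mul_sum]
  refine Finset.sum_le_sum fun i _ => ?_
  rw [integral_finsetSum _ fun j _ => (hI2 i j).1, Finset.mul_sum]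
  exact Finset.sum_le_sum fun j _ => (hI2 i j).2

/-- Few standardised projections are close to a given level. -/
lemma integral_near (hg : IsGaussianArray P S g) {w : Fin T → ℝ} (hw : ∑ t, w t ^ 2 = 1)
    (hS : ∀ i, 0 < S i i) (z : ℝ) {b : ℝ} (hb : 0 ≤ b) :
    Integrable (fun ω => ∑ i, if |(|stdProj S w (fun t => g t ω) i| - z)| ≤ b then (1 : ℝ) else 0) P
    ∧ ∫ ω, ∑ i, (if |(|stdProj S w (fun t => g t ω) i| - z)| ≤ b then (1 : ℝ) else 0) ∂P ≤
      m * (4 * b) := by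
  set ξ : Fin m → Ω → ℝ := fun i ω => stdProj S w (fun t => g t ω) i with hξ
  have hξm : ∀ i, Measurable (ξ i) := hg.measurable_stdProj w
  have hξl : ∀ i, HasLaw (ξ i) (gaussianReal 0 1) P := fun i => hg.hasLaw_stdProj hw (hS i)
  have hset : MeasurableSet {x : ℝ | |(|x| - z)| ≤ b} :=
    measurableSet_le (by fun_prop) measurable_const
  have hms : ∀ i, MeasurableSet {ω | |(|ξ i ω| - z)| ≤ b} := fun i => (hξm i) hset
  have hind : ∀ i, (fun ω => if |(|ξ i ω| - z)| ≤ b then (1 : ℝ) else 0) =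
      Set.indicator {ω | |(|ξ i ω| - z)| ≤ b} 1 := fun i => by
    ext ω; simp [Set.indicator_apply]
  have hi : ∀ i, Integrable (fun ω => if |(|ξ i ω| - z)| ≤ b then (1 : ℝ) else 0) P := fun i => by
    rw [hind]; exact (integrable_const 1).indicator (hms i)
  refine ⟨integrable_finsetSum _ fun i _ => hi i, ?_⟩
  rw [integral_finsetSum _ fun i _ => hi i]
  calc _ ≤ ∑ i : Fin m, 4 * b := Finset.sum_le_sum fun i _ => by
        rw [hind, integral_indicator_one (hms i),
          (hξl i).measureReal_eq (p := fun x => |(|x| - z)| ≤ b) hset, measureReal_def]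
        exact ENNReal.toReal_le_of_le_ofReal (by linarith) (gaussianReal_abs_near_le z b)
    _ = m * (4 * b) := by simp

/-- The empirical variances concentrate, uniformly in the coordinate. -/
lemma prob_norm_le (hg : IsGaussianArray P S g) (hS : ∀ i, 0 < S i i) (hS1 : ∀ i, S i i ≤ 1)
    {x : ℝ} (hx0 : 0 ≤ x) (hx : x ≤ 1) :
    P {ω | ∃ i, T * x < |∑ t, g t ω i ^ 2 - T * S i i|} ≤
      ENNReal.ofReal (m * (2 * Real.exp (-(T * x ^ 2) / 8))) := by
  have h1 : ∀ i, P {ω | T * x < |∑ t, g t ω i ^ 2 - T * S i i|} ≤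
      ENNReal.ofReal (2 * Real.exp (-(T * x ^ 2) / 8)) := by
    intro i
    set U : Fin T → Ω → ℝ := fun t ω => g t ω i / √(S i i) with hU
    have hUl : ∀ t, HasLaw (U t) (gaussianReal 0 1) P := fun t => by
      have hw : ∑ s, (Pi.single t 1 : Fin T → ℝ) s ^ 2 = 1 := by
        rw [Finset.sum_eq_single t]
        · simp
        · intro s _ hs; simp [hs]
        · simp
      have h := hg.hasLaw_stdProj hw (hS i)
      have e : (fun ω => stdProj S (Pi.single t 1) (fun t => g t ω) i) = U t := by
        ext ω
        simp only [stdProj, hU]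
        congr 1
        rw [Finset.sum_eq_single t]
        · simp
        · intro s _ hs; simp [hs]
        · simp
      rwa [e] at h
    have hUm : ∀ t, Measurable (U t) := fun t => by
      have := hg.measurable t
      simp only [hU]; fun_prop
    have hUi : iIndepFun U P :=
      hg.indep.comp (fun _ (y : EuclideanSpace ℝ (Fin m)) => y i / √(S i i)) fun _ => by fun_prop
    refine (measure_mono ?_).trans (prob_chiSquare_le hUl hUm hUi hx0 hx)
    intro ω hω
    simp only [Set.mem_ofPred_eq] at hω ⊢
    have e : ∑ t, g t ω i ^ 2 - T * S i i = S i i * (∑ t, U t ω ^ 2 - T) := by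
      simp only [hU, div_pow, Real.sq_sqrt (hS i).le, ← Finset.sum_div]
      rw [mul_sub, mul_div_cancel₀ _ (hS i).ne']; ring
    rw [e, abs_mul, abs_of_pos (hS i)] at hω
    exact hω.trans_le (mul_le_of_le_one_left (abs_nonneg _) (hS1 i))
  have h2 : {ω | ∃ i, T * x < |∑ t, g t ω i ^ 2 - T * S i i|} =
      ⋃ i, {ω | T * x < |∑ t, g t ω i ^ 2 - T * S i i|} := by
    ext ω; simp
  rw [h2]
  refine (measure_iUnion_fintype_le _ _).trans ((Finset.sum_le_sum fun i _ => h1 i).trans ?_)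
  simp only [Finset.sum_const, Finset.card_univ, Fintype.card_fin, nsmul_eq_mul]
  rw [ENNReal.ofReal_mul (by positivity)]
  simp

/-- Tail bound for the projections of the coordinates on finitely many fixed vectors. -/
lemma prob_proj_le (hg : IsGaussianArray P S g) (hS1 : ∀ i, S i i ≤ 1) {r : ℕ}
    (c : Fin r → Fin T → ℝ) (V : Fin r → ℝ) (hV : ∀ k, ∑ t, c k t ^ 2 ≤ V k) {L : ℝ}
    (hL : 0 ≤ L) :
    P {ω | ∃ i k, 2 * √L * √(V k) < |∑ t, c k t * g t ω i|} ≤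
      ENNReal.ofReal (m * (r * (2 * Real.exp (-2 * L)))) := by
  have h1 : ∀ i k, P {ω | 2 * √L * √(V k) < |∑ t, c k t * g t ω i|} ≤
      ENNReal.ofReal (2 * Real.exp (-2 * L)) := by
    intro i k
    have hc0 : 0 ≤ ∑ t, c k t ^ 2 := Finset.sum_nonneg fun t _ => sq_nonneg _
    -- A zero bound forces zero coefficients; the Chernoff bound covers only positive ones.
    rcases (hc0.trans (hV k)).eq_or_lt with h0 | h0
    · have hz : ∀ t, c k t = 0 := fun t => by
        have h2 : ∑ t, c k t ^ 2 = 0 := le_antisymm (h0 ▸ hV k) hc0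
        have := (Finset.sum_eq_zero_iff_of_nonneg fun t _ => sq_nonneg _).1 h2 t (Finset.mem_univ t)
        exact pow_eq_zero_iff (two_ne_zero) |>.1 this
      have : {ω | 2 * √L * √(V k) < |∑ t, c k t * g t ω i|} = ∅ := by
        ext ω; simp [hz, ← h0]
      rw [this]; simp
    · have h := hg.hasLaw_linForm fun t j => c k t * (Pi.single i 1 : Fin m → ℝ) j
      have e : linForm g (fun t j => c k t * (Pi.single i 1 : Fin m → ℝ) j) =
          fun ω => ∑ t, c k t * g t ω i := by ext ω; exact linForm_outer_single g _ i ω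
      rw [e] at h
      refine prob_abs_gt_le h ?_ h0 hL
      rw [Real.coe_toNNReal _ (hg.covForm_self_nonneg _), covForm_outer, sum_single_mul_single]
      simp only [← sq]
      exact (mul_le_of_le_one_right hc0 (hS1 i)).trans (hV k)
  have h2 : {ω | ∃ i k, 2 * √L * √(V k) < |∑ t, c k t * g t ω i|} =
      ⋃ i, ⋃ k, {ω | 2 * √L * √(V k) < |∑ t, c k t * g t ω i|} := by
    ext ω; simp
  rw [h2]
  refine (measure_iUnion_fintype_le _ _).trans ((Finset.sum_le_sum fun i _ =>
    (measure_iUnion_fintype_le _ _).trans (Finset.sum_le_sum fun k _ => h1 i k)).trans ?_)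
  simp only [Finset.sum_const, Finset.card_univ, Fintype.card_fin, nsmul_eq_mul]
  rw [ENNReal.ofReal_mul (by positivity), ENNReal.ofReal_mul (by positivity)]
  simp

end IsGaussianArray

/-! ### The event of high probability. -/

section GoodDraw

variable {N T r : ℕ}

/-- The pairs `(Q, w)` of an orthogonal projection of corank at most `p` and a unit vector. -/
def projectionSet (T p : ℕ) : Set ((Fin T → Fin T → ℝ) × (Fin T → ℝ)) :=
  {a | (∀ t s, a.1 t s = a.1 s t) ∧ (∀ t s, ∑ u, a.1 t u * a.1 u s = a.1 t s) ∧
    ∑ t, (1 - a.1 t t) ≤ p ∧ ∑ t, a.2 t ^ 2 = 1}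

lemma measurableSet_projectionSet (T p : ℕ) : MeasurableSet (projectionSet T p) := by
  unfold projectionSet
  refine (MeasurableSet.inter ?_ (MeasurableSet.inter ?_ (MeasurableSet.inter ?_ ?_)))
  · refine MeasurableSet.congr (s := ⋂ t, ⋂ s, {a | a.1 t s = a.1 s t}) ?_ ?_
    · exact .iInter fun t => .iInter fun s => measurableSet_eq_fun (by fun_prop) (by fun_prop)
    · ext a; simp only [Set.mem_iInter]; rfl
  · refine MeasurableSet.congr (s := ⋂ t, ⋂ s, {a | ∑ u, a.1 t u * a.1 u s = a.1 t s}) ?_ ?_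
    · exact .iInter fun t => .iInter fun s => measurableSet_eq_fun (by fun_prop) (by fun_prop)
    · ext a; simp only [Set.mem_iInter]; rfl
  · exact measurableSet_le
      (f := fun a : (Fin T → Fin T → ℝ) × (Fin T → ℝ) => ∑ t, (1 - a.1 t t)) (by fun_prop)
      measurable_const
  · exact measurableSet_eq_fun
      (f := fun a : (Fin T → Fin T → ℝ) × (Fin T → ℝ) => ∑ t, a.2 t ^ 2) (by fun_prop)
      measurable_const

/-- Entries of the complementary projection. -/
def coEntry (Q : Fin T → Fin T → ℝ) (t s : Fin T) : ℝ := (1 : Matrix (Fin T) (Fin T) ℝ) t s - Q t s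

/-- The squared Frobenius norm of an orthogonal projection is its trace. Projecting out the design
costs only `p` degrees of freedom, whatever T is. -/
lemma sum_coEntry_sq {p : ℕ} {a : (Fin T → Fin T → ℝ) × (Fin T → ℝ)}
    (ha : a ∈ projectionSet T p) : ∑ t, ∑ s, coEntry a.1 t s ^ 2 ≤ p := by
  obtain ⟨hs, hi, htr, -⟩ := ha
  refine le_trans (le_of_eq (Finset.sum_congr rfl fun t _ => ?_)) htr
  have h1 : ∀ s, coEntry a.1 t s ^ 2 =
      (1 : Matrix (Fin T) (Fin T) ℝ) t s - 2 * ((1 : Matrix (Fin T) (Fin T) ℝ) t s * a.1 t s)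
        + a.1 t s * a.1 s t := fun s => by
    rw [coEntry, ← hs t s]
    by_cases h : t = s
    · subst h; simp; ring
    · simp [h]; ring
  simp only [h1, Finset.sum_add_distrib, Finset.sum_sub_distrib, ← Finset.mul_sum, hi t t]
  simp [Matrix.one_apply]
  ring

/-- Symmetry and idempotence give ‖Qx‖² = ⟨x, Qx⟩; expand ‖x − Qx‖² ≥ 0. -/
lemma sum_proj_sq_le {p : ℕ} {a : (Fin T → Fin T → ℝ) × (Fin T → ℝ)}
    (ha : a ∈ projectionSet T p) (x : Fin T → ℝ) :
    ∑ t, (∑ s, a.1 t s * x s) ^ 2 ≤ ∑ t, x t ^ 2 := by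
  obtain ⟨hs, hi, -, -⟩ := ha
  have h1 : ∑ t, (∑ s, a.1 t s * x s) ^ 2 = ∑ t, x t * ∑ s, a.1 t s * x s := by
    have : ∀ t, (∑ s, a.1 t s * x s) ^ 2 = ∑ s, ∑ u, x s * (a.1 s t * a.1 t u) * x u := fun t => by
      rw [sq, Finset.sum_mul_sum]
      refine Finset.sum_congr rfl fun s _ => Finset.sum_congr rfl fun u _ => ?_
      rw [hs t s]; ring
    simp only [this]
    rw [Finset.sum_comm]
    refine Finset.sum_congr rfl fun s _ => ?_
    rw [Finset.sum_comm, Finset.mul_sum]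
    refine Finset.sum_congr rfl fun u _ => ?_
    rw [← Finset.sum_mul, ← Finset.mul_sum, hi]; ring
  have h2 : 0 ≤ ∑ t, (x t - ∑ s, a.1 t s * x s) ^ 2 := Finset.sum_nonneg fun _ _ => sq_nonneg _
  have h3 : ∑ t, (x t - ∑ s, a.1 t s * x s) ^ 2 = ∑ t, x t ^ 2 - 2 * ∑ t, x t * ∑ s, a.1 t s * x s
      + ∑ t, (∑ s, a.1 t s * x s) ^ 2 := by
    rw [Finset.mul_sum, ← Finset.sum_sub_distrib, ← Finset.sum_add_distrib]
    exact Finset.sum_congr rfl fun t _ => by ring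
  linarith

/-- The bounds, valid with high probability, on which the analysis of the procedure rests. The
number `Γ` bounds the sums of squared covariances and of absolute correlations, and `Λ` bounds the
covariances weighted with the loadings. -/
structure GoodDraw (S : Matrix (Fin N) (Fin N) ℝ) (γ : Matrix (Fin N) (Fin r) ℝ) (p : ℕ)
    (K Γ Λ ℓ lev b : ℝ) (Q : Fin T → Fin T → ℝ) (w : Fin T → ℝ)
    (z : Fin T → EuclideanSpace ℝ (Fin r)) (η : Fin T → EuclideanSpace ℝ (Fin N)) : Prop where
  moment : ∑ k, ∑ l, (∑ t, z t k * z t l - T * (1 : Matrix (Fin r) (Fin r) ℝ) k l) ^ 2 ≤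
    K * (2 * (r + 1) ^ 2 * T)
  coProj_factor : ∑ t, ∑ k, (∑ s, coEntry Q t s * z s k) ^ 2 ≤ K * ((p + 1) * (r + 1))
  dir_factor : ∑ k, (∑ t, w t * z t k) ^ 2 ≤ K * (r + 1)
  dir_noise : ∑ i, (∑ t, w t * η t i) ^ 2 ≤ K * N
  gram : ∑ t, ∑ s, (∑ i, η s i * η t i - (1 : Matrix (Fin T) (Fin T) ℝ) t s * S.trace) ^ 2 ≤
    K * (2 * T ^ 2 * Γ)
  gram_dir : ∑ s, (∑ i, η s i * (∑ t, w t * η t i) - w s * S.trace) ^ 2 ≤ K * (2 * T * Γ)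
  loading : ∑ t, ∑ k, (∑ i, γ i k * η t i) ^ 2 ≤ K * (T * Λ)
  loading_dir : ∑ k, (∑ i, γ i k * ∑ t, w t * η t i) ^ 2 ≤ K * Λ
  coProj_noise : ∑ t, ∑ i, (∑ s, coEntry Q t s * η s i) ^ 2 ≤ K * ((p + 1) * N)
  norm_noise : ∀ i, |∑ t, η t i ^ 2 - T * S i i| ≤ T * (4 * ℓ)
  proj_noise : ∀ i k, |∑ t, (∑ s, Q t s * z s k) * η t i| ≤
    2 * √(Real.log N) * √(∑ t, z t k ^ 2)
  count : (∑ i, ((if lev ≤ |IsGaussianArray.stdProj S w η i| then 1 else 0) -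
      (gaussianReal 0 1).real {x | lev ≤ |x|})) ^ 2 ≤ K * (8 * (lev + 2) * Γ)
  near : ∑ i, (if |(|IsGaussianArray.stdProj S w η i| - lev)| ≤ b then (1 : ℝ) else 0) ≤
    K * (N * (4 * b))

variable {Ω : Type*} [MeasurableSpace Ω] {P : Measure Ω} [IsProbabilityMeasure P]

/-- Markov's inequality, given an independent component. -/
lemma prob_gt_le_of_indepFun {α β : Type*} [MeasurableSpace α] [MeasurableSpace β] {A : Ω → α}
    {B : Ω → β} (hA : Measurable A) (hB : Measurable B) (h : IndepFun A B P) {D : Set α}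
    (hD : MeasurableSet D) {f : α → β → ℝ} (hf : Measurable fun x : α × β => f x.1 x.2)
    (hf0 : ∀ a b, 0 ≤ f a b) {c K : ℝ} (hc : 0 < c) (hK : 0 < K)
    (hi : ∀ a ∈ D, Integrable (fun ω => f a (B ω)) P ∧ ∫ ω, f a (B ω) ∂P ≤ c) :
    P {ω | A ω ∈ D ∧ K * c < f (A ω) (B ω)} ≤ ENNReal.ofReal K⁻¹ :=
  prob_le_of_indepFun hA hB h hD (S := {x : α × β | K * c < f x.1 x.2})
    (measurableSet_lt measurable_const hf) fun a ha =>
    prob_gt_le_of_integral_le (fun _ => hf0 _ _) (hi a ha).1 hc hK (hi a ha).2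

/-- The design acts only through an independent pair (Q, w), which may be held fixed. Eleven of the
bounds then follow from Markov's inequality, each failing with probability at most 1/K. The two that
are uniform over the units use exponential tails and fail with probability at most 2/N and 2r/N. -/
lemma prob_not_goodDraw {S : Matrix (Fin N) (Fin N) ℝ} {γ : Matrix (Fin N) (Fin r) ℝ} {p : ℕ}
    {K Γ Λ ℓ lev b : ℝ} {z : Fin T → Ω → EuclideanSpace ℝ (Fin r)}
    {η : Fin T → Ω → EuclideanSpace ℝ (Fin N)} (hz : IsGaussianArray P 1 z)
    (hη : IsGaussianArray P S η) (hzη : IndepFun (fun ω t => z t ω) (fun ω t => η t ω) P)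
    {A : Ω → (Fin T → Fin T → ℝ) × (Fin T → ℝ)} (hA : Measurable A)
    (hAB : IndepFun A (fun ω => (fun t => z t ω, fun t => η t ω)) P)
    (hT : 0 < T) (hN : 0 < N) (hS : ∀ i, 0 < S i i) (hS1 : ∀ i, S i i ≤ 1) (hK : 0 < K)
    (hΓ : 0 < Γ) (hΓS : ∑ i, ∑ j, S i j ^ 2 ≤ Γ)
    (hΓC : ∑ i, ∑ j, |S i j / √(S i i * S j j)| ≤ Γ)
    (hΛ : 0 < Λ) (hΛS : ∑ k, ∑ i, ∑ j, γ i k * γ j k * S i j ≤ Λ)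
    (hℓ : ℓ = √(Real.log N / T)) (hℓ1 : 4 * ℓ ≤ 1) (hlev : 0 ≤ lev) (hb : 0 < b) :
    P {ω | A ω ∈ projectionSet T p ∧ ¬ GoodDraw S γ p K Γ Λ ℓ lev b (A ω).1 (A ω).2
      (fun t => z t ω) (fun t => η t ω)} ≤
      ENNReal.ofReal (11 / K + (2 + 2 * r) / N) := by
  have hTR : (0 : ℝ) < T := by exact_mod_cast hT
  have hNR : (0 : ℝ) < N := by exact_mod_cast hN
  have hzm := hz.measurable
  have hηm := hη.measurable
  have hZm : Measurable (fun ω t => z t ω) := by fun_prop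
  have hHm : Measurable (fun ω t => η t ω) := by fun_prop
  have hBm : Measurable (fun ω => ((fun t => z t ω, fun t => η t ω) :
      (Fin T → EuclideanSpace ℝ (Fin r)) × (Fin T → EuclideanSpace ℝ (Fin N)))) := by fun_prop
  have hD := measurableSet_projectionSet T p
  have htr : S.trace ≤ N := by
    calc S.trace ≤ ∑ i : Fin N, (1 : ℝ) := Finset.sum_le_sum fun i _ => hS1 i
      _ = N := by simp
  have hst : ∀ i, Measurable fun x : ((Fin T → Fin T → ℝ) × (Fin T → ℝ)) ×
      ((Fin T → EuclideanSpace ℝ (Fin r)) × (Fin T → EuclideanSpace ℝ (Fin N))) =>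
      IsGaussianArray.stdProj S x.1.2 x.2.2 i := fun i => by
    unfold IsGaussianArray.stdProj; fun_prop
  have hT1 : (1 : ℝ) ≤ T := by exact_mod_cast hT
  have mk := fun (f : ((Fin T → Fin T → ℝ) × (Fin T → ℝ)) →
      ((Fin T → EuclideanSpace ℝ (Fin r)) × (Fin T → EuclideanSpace ℝ (Fin N))) → ℝ) hf hf0 c hc =>
    prob_gt_le_of_indepFun hA hBm hAB hD (f := f) hf hf0 (c := c) (K := K) hc hK
  have e1 := mk (fun _ b => ∑ k, ∑ l, (∑ t, b.1 t k * b.1 t l -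
      T * (1 : Matrix (Fin r) (Fin r) ℝ) k l) ^ 2) (by fun_prop) (fun _ _ => by positivity)
    (2 * (r + 1) ^ 2 * T) (by positivity) fun a _ => by
      have h := hz.integral_sample_moment
      refine ⟨integrable_finsetSum _ fun k _ => integrable_finsetSum _ fun l _ => (h k l).1, ?_⟩
      rw [integral_finsetSum _ fun k _ => integrable_finsetSum _ fun l _ => (h k l).1]
      calc _ ≤ ∑ k : Fin r, ∑ l : Fin r, 2 * (T : ℝ) := Finset.sum_le_sum fun k _ => by
            rw [integral_finsetSum _ fun l _ => (h k l).1]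
            exact Finset.sum_le_sum fun l _ => (h k l).2
        _ = 2 * (r : ℝ) ^ 2 * T := by simp; ring
        _ ≤ _ := by gcongr; linarith
  have e2 := mk (fun a b => ∑ t, ∑ k, (∑ s, coEntry a.1 t s * b.1 s k) ^ 2)
    (by unfold coEntry; fun_prop) (fun _ _ => by positivity)
    ((p + 1) * (r + 1)) (by positivity) fun a ha => by
      have h := hz.integral_sum_mat_sq (coEntry a.1)
      refine ⟨h.1, h.2.le.trans ?_⟩
      have := sum_coEntry_sq ha
      rw [Matrix.trace_one, Fintype.card_fin]
      gcongr <;> linarith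
  have e3 := mk (fun a b => ∑ k, (∑ t, a.2 t * b.1 t k) ^ 2)
    (by fun_prop) (fun _ _ => by positivity) (r + 1) (by positivity) fun a ha => by
      have h := hz.integral_sum_dir_sq a.2
      refine ⟨h.1, h.2.le.trans ?_⟩
      rw [Matrix.trace_one, Fintype.card_fin, ha.2.2.2]; linarith
  have e4 := mk (fun a b => ∑ i, (∑ t, a.2 t * b.2 t i) ^ 2)
    (by fun_prop) (fun _ _ => by positivity) N (by positivity) fun a ha => by
      have h := hη.integral_sum_dir_sq a.2
      refine ⟨h.1, h.2.le.trans ?_⟩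
      rw [ha.2.2.2]; linarith
  have e5 := mk (fun _ b => ∑ t, ∑ s, (∑ i, b.2 s i * b.2 t i -
      (1 : Matrix (Fin T) (Fin T) ℝ) t s * S.trace) ^ 2)
    (by fun_prop) (fun _ _ => by positivity) (2 * T ^ 2 * Γ) (by positivity) fun a ha => by
      have h := hη.integral_gram
      refine ⟨h.1, h.2.le.trans ?_⟩
      exact mul_le_mul (by nlinarith) hΓS (by positivity) (by positivity)
  have e6 := mk (fun a b => ∑ s, (∑ i, b.2 s i * (∑ t, a.2 t * b.2 t i) - a.2 s * S.trace) ^ 2)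
    (by fun_prop) (fun _ _ => by positivity) (2 * T * Γ) (by positivity) fun a ha => by
      have h := hη.integral_gram_mulVec a.2
      refine ⟨h.1, h.2.le.trans ?_⟩
      rw [ha.2.2.2]
      exact mul_le_mul (by linarith) hΓS (by positivity) (by positivity)
  have e7 := mk (fun _ b => ∑ t, ∑ k, (∑ i, γ i k * b.2 t i) ^ 2)
    (by fun_prop) (fun _ _ => by positivity) (T * Λ) (by positivity) fun a ha => by
      have h := hη.integral_sum_loading_sq γ
      exact ⟨h.1, h.2.le.trans (by gcongr)⟩
  have e8 := mk (fun a b => ∑ k, (∑ i, γ i k * ∑ t, a.2 t * b.2 t i) ^ 2)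
    (by fun_prop) (fun _ _ => by positivity) Λ (by positivity) fun a ha => by
      have h := hη.integral_sum_loading_dir_sq γ a.2
      exact ⟨h.1, h.2.le.trans (by rw [ha.2.2.2, one_mul]; exact hΛS)⟩
  have e9 := mk (fun a b => ∑ t, ∑ i, (∑ s, coEntry a.1 t s * b.2 s i) ^ 2)
    (by unfold coEntry; fun_prop) (fun _ _ => by positivity)
    ((p + 1) * N) (by positivity) fun a ha => by
      have h := hη.integral_sum_mat_sq (coEntry a.1)
      refine ⟨h.1, h.2.le.trans ?_⟩
      have := sum_coEntry_sq ha
      have h0 : 0 ≤ S.trace := Finset.sum_nonneg fun i _ => (hS i).le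
      gcongr
      linarith
  have e10 := mk (fun a b => (∑ i, ((if lev ≤ |IsGaussianArray.stdProj S a.2 b.2 i| then 1 else 0) -
      (gaussianReal 0 1).real {x | lev ≤ |x|})) ^ 2)
    (by
      refine (Finset.measurable_sum _ fun i _ => Measurable.sub_const (Measurable.ite
        (measurableSet_le measurable_const ?_) measurable_const measurable_const) _).pow_const 2
      exact (hst i).abs) (fun _ _ => by positivity)
    (8 * (lev + 2) * Γ) (by positivity) fun a ha => by
      have h := hη.integral_count_sq ha.2.2.2 hS hlev
      refine ⟨h.1, h.2.trans ?_⟩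
      gcongr
  have e11 := mk (fun a y => ∑ i, (if |(|IsGaussianArray.stdProj S a.2 y.2 i| - lev)| ≤ b then
      (1 : ℝ) else 0))
    (by
      refine (Finset.measurable_sum _ fun i _ => Measurable.ite
        (measurableSet_le ?_ measurable_const) measurable_const measurable_const)
      exact ((hst i).abs.sub_const _).abs) (fun _ _ => by positivity)
    (N * (4 * b)) (by positivity) fun a ha => hη.integral_near ha.2.2.2 hS lev hb.le
  have e12 : P {ω | ∃ i, T * (4 * ℓ) < |∑ t, η t ω i ^ 2 - T * S i i|} ≤ ENNReal.ofReal (2 / N) := by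
    have hlog : 0 ≤ Real.log N := Real.log_nonneg (by exact_mod_cast hN)
    refine (hη.prob_norm_le hS hS1 (by rw [hℓ]; positivity) hℓ1).trans
      (ENNReal.ofReal_le_ofReal (le_of_eq ?_))
    -- The constant 4 is calibrated here: each unit fails with probability at most 2N⁻².
    have : -(T * (4 * ℓ) ^ 2) / 8 = -2 * Real.log N := by
      rw [mul_pow, hℓ, Real.sq_sqrt (by positivity)]; field_simp; ring
    rw [this, mul_comm (-2), Real.exp_mul, Real.exp_log hNR, Real.rpow_neg hNR.le]
    field_simp
    norm_num
  have e13 : P {ω | A ω ∈ projectionSet T p ∧ ∃ i k, 2 * √(Real.log N) * √(∑ t, z t ω k ^ 2) <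
      |∑ t, (∑ s, (A ω).1 t s * z s ω k) * η t ω i|} ≤ ENNReal.ofReal (2 * r / N) := by
    have hlog : 0 ≤ Real.log N := Real.log_nonneg (by exact_mod_cast hN)
    refine prob_le_of_indepFun hA hBm hAB hD
      (S := {x | ∃ i k, 2 * √(Real.log N) * √(∑ t, x.2.1 t k ^ 2) <
        |∑ t, (∑ s, x.1.1 t s * x.2.1 s k) * x.2.2 t i|}) ?_ fun a ha => ?_
    · simp only [Set.ofPred_exists]
      exact .iUnion fun i => .iUnion fun k => measurableSet_lt (by fun_prop) (by fun_prop)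
    -- A second conditioning, on the factors: given them, the projected factors are fixed
    -- coefficients and the noise is Gaussian.
    · have := prob_le_of_indepFun hZm hHm hzη (D := Set.univ) .univ
        (S := {x | ∃ i k, 2 * √(Real.log N) * √(∑ t, x.1 t k ^ 2) <
        |∑ t, (∑ s, a.1 t s * x.1 s k) * x.2 t i|}) (ε := ENNReal.ofReal (2 * r / N)) ?_ ?_
      · simpa using this
      · simp only [Set.ofPred_exists]
        exact .iUnion fun i => .iUnion fun k => measurableSet_lt (by fun_prop) (by fun_prop)
      · intro y _
        refine (hη.prob_proj_le hS1 (fun k t => ∑ s, a.1 t s * y s k) (fun k => ∑ t, y t k ^ 2)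
          (fun k => sum_proj_sq_le ha fun s => y s k) hlog).trans
          (ENNReal.ofReal_le_ofReal (le_of_eq ?_))
        rw [mul_comm (-2), Real.exp_mul, Real.exp_log hNR, Real.rpow_neg hNR.le]
        field_simp
        norm_num
        ring
  have hu : ∀ {s₁ s₂ : Set Ω} {x y : ℝ}, (0 ≤ x ∧ P s₁ ≤ ENNReal.ofReal x) →
      (0 ≤ y ∧ P s₂ ≤ ENNReal.ofReal y) →
      0 ≤ x + y ∧ P (s₁ ∪ s₂) ≤ ENNReal.ofReal (x + y) := fun h₁ h₂ =>
    ⟨add_nonneg h₁.1 h₂.1, (measure_union_le _ _).trans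
      ((add_le_add h₁.2 h₂.2).trans_eq (ENNReal.ofReal_add h₁.1 h₂.1).symm)⟩
  have hK' : 0 ≤ K⁻¹ := by positivity
  have h2 : (0 : ℝ) ≤ 2 / N := by positivity
  have h3 : (0 : ℝ) ≤ 2 * r / N := by positivity
  refine (measure_mono ?_).trans ((hu ⟨hK', e1⟩ (hu ⟨hK', e2⟩ (hu ⟨hK', e3⟩ (hu ⟨hK', e4⟩
    (hu ⟨hK', e5⟩ (hu ⟨hK', e6⟩ (hu ⟨hK', e7⟩ (hu ⟨hK', e8⟩ (hu ⟨hK', e9⟩ (hu ⟨hK', e10⟩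
    (hu ⟨hK', e11⟩ (hu ⟨h2, e12⟩ ⟨h3, e13⟩)))))))))))).2.trans ?_)
  · rintro ω ⟨hω, hn⟩
    by_contra hc
    simp only [Set.mem_union, Set.mem_ofPred_eq, not_or, not_and, not_lt, not_exists] at hc
    obtain ⟨c1, c2, c3, c4, c5, c6, c7, c8, c9, c10, c11, c12, c13⟩ := hc
    exact hn ⟨c1 hω, c2 hω, c3 hω, c4 hω, c5 hω, c6 hω, c7 hω, c8 hω, c9 hω, c12, c13 hω, c10 hω,
      c11 hω⟩
  · refine ENNReal.ofReal_le_ofReal (le_of_eq ?_)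
    ring

end GoodDraw

/-! ### The normal distribution function and critical values. -/

section NormalCDF

lemma stdNormalCDF_eq (x : ℝ) : stdNormalCDF x = (gaussianReal 0 1).real (Set.Iic x) :=
  cdf_eq_real _ x

/-- Lebesgue measure is absolutely continuous with respect to the Gaussian law, so every
nondegenerate interval has positive mass. -/
lemma strictMono_stdNormalCDF : StrictMono stdNormalCDF := by
  intro x y hxy
  have h1 : (gaussianReal 0 1).real (Set.Iic y) =
      (gaussianReal 0 1).real (Set.Iic x) + (gaussianReal 0 1).real (Set.Ioc x y) := by
    rw [← measureReal_union (Set.Iic_disjoint_Ioc le_rfl) measurableSet_Ioc,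
      Set.Iic_union_Ioc_eq_Iic hxy.le]
  have h2 : gaussianReal 0 1 (Set.Ioc x y) ≠ 0 := fun h => by
    have := gaussianReal_absolutelyContinuous' 0 (one_ne_zero) h
    simp [hxy.not_ge] at this
  rw [stdNormalCDF_eq, stdNormalCDF_eq, h1, lt_add_iff_pos_right, measureReal_def]
  exact ENNReal.toReal_pos h2 (measure_ne_top _ _)

/-- A jump would be the mass of an atom, and the Gaussian law has none. -/
lemma continuous_stdNormalCDF : Continuous stdNormalCDF := by
  have : NullSingletonClass (gaussianReal 0 1) := nullSingletonClass_gaussianReal one_ne_zero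
  refine continuous_iff_continuousAt.2 fun x => ?_
  have hm : Monotone (cdf (gaussianReal 0 1)) := monotone_cdf _
  have h := (cdf (gaussianReal 0 1)).measure_singleton x
  rw [measure_cdf, measure_singleton] at h
  have h1 := ENNReal.ofReal_eq_zero.1 h.symm
  refine (hm.continuousAt_iff_leftLim_eq_rightLim (x := x)).2 ?_
  rw [StieltjesFunction.rightLim_eq]
  exact le_antisymm (hm.leftLim_le le_rfl) (by linarith)

lemma stdNormalCDF_neg (x : ℝ) : stdNormalCDF (-x) = (gaussianReal 0 1).real (Set.Ici x) := by
  have h := gaussianReal_map_neg (μ := 0) (v := 1)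
  rw [neg_zero] at h
  rw [stdNormalCDF_eq]
  conv_lhs => rw [← h]
  rw [map_measureReal_apply measurable_neg measurableSet_Iic]
  congr 1
  ext y; simp

lemma two_mul_stdNormalCDF_neg {x : ℝ} (hx : 0 < x) :
    2 * stdNormalCDF (-x) = (gaussianReal 0 1).real {y | x ≤ |y|} := by
  have e : {y : ℝ | x ≤ |y|} = Set.Iic (-x) ∪ Set.Ici x := by
    ext y
    simp only [Set.mem_ofPred_eq, le_abs, Set.mem_union, Set.mem_Iic, Set.mem_Ici]
    constructor
    · rintro (h | h)
      · exact .inr h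
      · exact .inl (by linarith)
    · rintro (h | h)
      · exact .inr (by linarith)
      · exact .inl h
  rw [e, measureReal_union (Set.Iic_disjoint_Ici.2 (by linarith)) measurableSet_Ici,
    ← stdNormalCDF_neg, ← stdNormalCDF_eq]
  ring

lemma stdNormalCDF_pos (x : ℝ) : 0 < stdNormalCDF x :=
  (cdf_nonneg _ (x - 1)).trans_lt (strictMono_stdNormalCDF (by linarith))

lemma two_mul_stdNormalCDF_neg_abs_le (x : ℝ) : 2 * stdNormalCDF (-|x|) ≤ 1 := by
  have h0 : stdNormalCDF 0 + stdNormalCDF 0 = 1 := by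
    have : NullSingletonClass (gaussianReal 0 1) := nullSingletonClass_gaussianReal one_ne_zero
    have h := stdNormalCDF_neg 0
    rw [neg_zero] at h
    have h1 : (gaussianReal 0 1).real (Set.Iic 0) + (gaussianReal 0 1).real (Set.Ioi 0) = 1 := by
      rw [← measureReal_union (Set.Iic_disjoint_Ioi le_rfl) measurableSet_Ioi, Set.Iic_union_Ioi]
      simp
    have h2 : (gaussianReal 0 1).real (Set.Ici 0) = (gaussianReal 0 1).real (Set.Ioi 0) := by
      rw [measureReal_def, measureReal_def, measure_congr Ioi_ae_eq_Ici]
    nth_rw 1 [h]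
    rw [stdNormalCDF_eq, h2]; linarith
  have h1 : stdNormalCDF (-|x|) ≤ stdNormalCDF 0 :=
    strictMono_stdNormalCDF.monotone (by simp)
  linarith

/-- The critical value of a two-sided test of size `s`. -/
lemma exists_critical_value {s : ℝ} (h0 : 0 < s) (h1 : s < 1) :
    ∃ z : ℝ, 0 < z ∧ (gaussianReal 0 1).real {y | z ≤ |y|} = s ∧
      ∀ x, 2 * stdNormalCDF (-|x|) ≤ s ↔ z ≤ |x| := by
  have hmem : s / 2 ∈ Set.range stdNormalCDF := by
    refine mem_range_of_exists_le_of_exists_ge continuous_stdNormalCDF ?_ ?_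
    · have := (tendsto_cdf_atBot (gaussianReal 0 1)).eventually (gt_mem_nhds (half_pos h0))
      obtain ⟨a, ha⟩ := this.exists
      exact ⟨a, ha.le⟩
    · have := (tendsto_cdf_atTop (gaussianReal 0 1)).eventually
        (lt_mem_nhds (show s / 2 < 1 by linarith))
      obtain ⟨a, ha⟩ := this.exists
      exact ⟨a, ha.le⟩
  obtain ⟨y, hy⟩ := hmem
  have hy0 : y < 0 := by
    by_contra hc
    have h2 := strictMono_stdNormalCDF.monotone (not_lt.1 hc)
    have h3 : (1 : ℝ) ≤ 2 * stdNormalCDF 0 := by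
      have : NullSingletonClass (gaussianReal 0 1) := nullSingletonClass_gaussianReal one_ne_zero
      have h := stdNormalCDF_neg 0
      rw [neg_zero] at h
      have h1 : (1 : ℝ) ≤ (gaussianReal 0 1).real (Set.Iic 0) +
          (gaussianReal 0 1).real (Set.Ici 0) := by
        refine le_trans (le_of_eq ?_) (measureReal_union_le _ _)
        rw [Set.Iic_union_Ici]; simp
      rw [← h, ← stdNormalCDF_eq] at h1; linarith
    linarith
  refine ⟨-y, by linarith, ?_, fun x => ?_⟩
  · rw [← two_mul_stdNormalCDF_neg (by linarith), neg_neg, hy]; ring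
  · rw [show s = 2 * stdNormalCDF y by rw [hy]; ring, mul_le_mul_iff_right₀ two_pos,
      strictMono_stdNormalCDF.le_iff_le]
    constructor <;> intro h <;> linarith

end NormalCDF

/-! ### Algebra of the residual maker. -/

section Design

variable {T p : ℕ} {X : Matrix (Fin T) (Fin p) ℝ}

lemma residualMaker_transpose (X : Matrix (Fin T) (Fin p) ℝ) :
    (residualMaker X)ᵀ = residualMaker X := by
  simp [residualMaker, Matrix.transpose_nonsing_inv, Matrix.mul_assoc]

lemma residualMaker_mul_design (h : IsUnit (Xᵀ * X).det) : residualMaker X * X = 0 := by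
  rw [residualMaker, Matrix.sub_mul, Matrix.mul_assoc, Matrix.mul_assoc, Matrix.nonsing_inv_mul _ h]
  simp

lemma residualMaker_idem (h : IsUnit (Xᵀ * X).det) :
    residualMaker X * residualMaker X = residualMaker X := by
  conv_lhs => rw [residualMaker.eq_1 X]
  have : X * (Xᵀ * X)⁻¹ * Xᵀ * residualMaker X = 0 := by
    have h1 : Xᵀ * residualMaker X = 0 := by
      rw [← residualMaker_transpose X, ← Matrix.transpose_mul, residualMaker_mul_design h]; simp
    rw [Matrix.mul_assoc, h1, Matrix.mul_zero]
  conv_lhs => rw [← residualMaker.eq_1 X]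
  nth_rw 1 [residualMaker]
  rw [Matrix.sub_mul, Matrix.one_mul, this, sub_zero]

/-- Cyclic invariance turns the trace of the hat matrix into that of the p × p identity. -/
lemma trace_residualMaker (h : IsUnit (Xᵀ * X).det) : (residualMaker X).trace = T - p := by
  rw [residualMaker, Matrix.trace_sub, Matrix.trace_one, Matrix.mul_assoc, Matrix.trace_mul_comm,
    Matrix.mul_assoc, Matrix.nonsing_inv_mul _ h, Matrix.trace_one]
  simp

/-- The normalised projection of the vector of ones. -/
def unitDir (X : Matrix (Fin T) (Fin p) ℝ) : Fin T → ℝ :=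
  (√(oneQOne X))⁻¹ • (residualMaker X *ᵥ 1)

lemma oneQOne_eq (h : IsUnit (Xᵀ * X).det) :
    oneQOne X = (residualMaker X *ᵥ 1) ⬝ᵥ (residualMaker X *ᵥ 1) := by
  rw [oneQOne]
  conv_lhs => rw [← residualMaker_idem h]
  rw [← Matrix.mulVec_mulVec, Matrix.dotProduct_mulVec, ← Matrix.mulVec_transpose,
    residualMaker_transpose]

lemma oneQOne_pos (h : IsUnit (Xᵀ * X).det) (h1 : oneQOne X ≠ 0) : 0 < oneQOne X := by
  refine lt_of_le_of_ne ?_ h1.symm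
  rw [oneQOne_eq h]
  exact Finset.sum_nonneg fun i _ => mul_self_nonneg _

lemma oneQOne_le (h : IsUnit (Xᵀ * X).det) : oneQOne X ≤ T := by
  have h1 := oneQOne_eq h
  have h2 : 0 ≤ (1 - residualMaker X *ᵥ 1) ⬝ᵥ (1 - residualMaker X *ᵥ 1) :=
    Finset.sum_nonneg fun i _ => mul_self_nonneg _
  rw [sub_dotProduct, dotProduct_sub, dotProduct_sub, ← h1,
    dotProduct_comm (residualMaker X *ᵥ 1) 1, ← oneQOne.eq_1] at h2
  simp at h2
  exact h2

lemma unitDir_sq (h : IsUnit (Xᵀ * X).det) (h1 : oneQOne X ≠ 0) : ∑ t, unitDir X t ^ 2 = 1 := by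
  have h2 := oneQOne_pos h h1
  have e : ∑ t, unitDir X t ^ 2 = (oneQOne X)⁻¹ *
      ((residualMaker X *ᵥ 1) ⬝ᵥ (residualMaker X *ᵥ 1)) := by
    simp only [unitDir, Pi.smul_apply, smul_eq_mul, mul_pow, inv_pow, Real.sq_sqrt h2.le,
      dotProduct, Finset.mul_sum, ← sq]
  rw [e, ← oneQOne_eq h, inv_mul_cancel₀ h1]

lemma residualMaker_mulVec_one (h : IsUnit (Xᵀ * X).det) (h1 : oneQOne X ≠ 0) :
    residualMaker X *ᵥ 1 = √(oneQOne X) • unitDir X := by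
  have h2 := Real.sqrt_pos.2 (oneQOne_pos h h1)
  rw [unitDir, smul_smul, mul_inv_cancel₀ h2.ne', one_smul]

lemma residualMaker_mulVec_unitDir (h : IsUnit (Xᵀ * X).det) :
    residualMaker X *ᵥ unitDir X = unitDir X := by
  rw [unitDir, Matrix.mulVec_smul, Matrix.mulVec_mulVec, residualMaker_idem h]

lemma mem_projectionSet (h : IsUnit (Xᵀ * X).det) (h1 : oneQOne X ≠ 0) :
    ((fun t s => residualMaker X t s, unitDir X) :
      (Fin T → Fin T → ℝ) × (Fin T → ℝ)) ∈ projectionSet T p := by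
  refine ⟨fun t s => ?_, fun t s => ?_, ?_, unitDir_sq h h1⟩
  · exact congrFun (congrFun (residualMaker_transpose X) s) t
  · have := congrFun (congrFun (residualMaker_idem h) t) s
    rwa [Matrix.mul_apply] at this
  · have := trace_residualMaker h
    rw [Matrix.trace] at this
    simp only [Matrix.diag_apply] at this
    simp [this]

end Design

/-! ### From the panel model to the residual form. -/

section Translation

variable {N T p r : ℕ}

/-- The array as a matrix with rows indexed by time. -/
def timeRows {m : ℕ} (z : Fin T → EuclideanSpace ℝ (Fin m)) : Matrix (Fin T) (Fin m) ℝ :=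
  Matrix.of fun t k => z t k

/-- The responses of the panel model. -/
def panelResponse (mu : Fin N → ℝ) (beta : Matrix (Fin N) (Fin p) ℝ) (γ : Matrix (Fin N) (Fin r) ℝ)
    (X : Matrix (Fin T) (Fin p) ℝ) (Z : Matrix (Fin T) (Fin r) ℝ) (η : Matrix (Fin T) (Fin N) ℝ) :
    Matrix (Fin N) (Fin T) ℝ :=
  Matrix.of fun i t => mu i + (beta * Xᵀ) i t + ((γ * Zᵀ) i t + η t i)

variable {mu : Fin N → ℝ} {beta : Matrix (Fin N) (Fin p) ℝ} {γ : Matrix (Fin N) (Fin r) ℝ}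
    {X : Matrix (Fin T) (Fin p) ℝ} {Z : Matrix (Fin T) (Fin r) ℝ} {η : Matrix (Fin T) (Fin N) ℝ}

/-- Q annihilates the design, so the regression coefficients disappear, and it maps the vector of
ones to a multiple of w. The intercepts therefore survive only as a rank-one term in the direction
w. -/
lemma residual_panelResponse (h : IsUnit (Xᵀ * X).det) (h1 : oneQOne X ≠ 0) :
    residual X (panelResponse mu beta γ X Z η) =
      √(oneQOne X) • (replicateCol Unit mu * (replicateCol Unit (unitDir X))ᵀ) +
        (γ * Zᵀ + ηᵀ) * residualMaker X := by
  have e : panelResponse mu beta γ X Z η =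
      replicateCol Unit mu * (replicateCol Unit (1 : Fin T → ℝ))ᵀ + beta * Xᵀ + (γ * Zᵀ + ηᵀ) := by
    ext i t
    simp [panelResponse, Matrix.mul_apply]
  have h2 : (replicateCol Unit (1 : Fin T → ℝ))ᵀ * residualMaker X =
      √(oneQOne X) • (replicateCol Unit (unitDir X))ᵀ := by
    rw [← residualMaker_transpose X, ← Matrix.transpose_mul, ← Matrix.replicateCol_mulVec,
      residualMaker_mulVec_one h h1, Matrix.replicateCol_smul, Matrix.transpose_smul]
  have h3 : Xᵀ * residualMaker X = 0 := by
    rw [← residualMaker_transpose X, ← Matrix.transpose_mul, residualMaker_mul_design h]; simp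
  rw [residual, Matrix.transpose_mul, Matrix.transpose_transpose, residualMaker_transpose, e,
    Matrix.add_mul, Matrix.add_mul, Matrix.mul_assoc, h2, Matrix.mul_assoc, h3]
  simp

/-- The rescaled residual matrix is a residual form. -/
lemma pcaMatrix_panelResponse (hN : 0 < N) (hT : 0 < T) (h : IsUnit (Xᵀ * X).det)
    (h1 : oneQOne X ≠ 0) {F : Matrix (Fin N) (Fin T) ℝ}
    (hF : F = residualForm ((√(oneQOne X) / √(N * T)) • replicateCol Unit mu)
      ((√(N : ℝ))⁻¹ • γ) ((√(T : ℝ))⁻¹ • Z) ((√(N * T : ℝ))⁻¹ • ηᵀ) (residualMaker X)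
      (replicateCol Unit (unitDir X))) :
    pcaMatrix X (panelResponse mu beta γ X Z η) = Fᵀ * F := by
  have hs : F = (√(N * T : ℝ))⁻¹ • residual X (panelResponse mu beta γ X Z η) := by
    rw [hF, residualForm, residual_panelResponse h h1, smul_add, smul_smul, Matrix.smul_mul,
      ← Matrix.smul_mul _ (γ * Zᵀ + ηᵀ), smul_add, Matrix.transpose_smul, Matrix.smul_mul,
      Matrix.mul_smul, smul_smul, ← mul_inv, ← Real.sqrt_mul (Nat.cast_nonneg N), div_eq_inv_mul]
  rw [pcaMatrix, hs, Matrix.transpose_smul, Matrix.smul_mul, Matrix.mul_smul, smul_smul]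
  congr 1
  rw [← mul_inv, Real.mul_self_sqrt (by positivity), mul_comm]

/-- The test statistic of a true null in terms of the projections. -/
lemma testStat_panelResponse (hT : 0 < T) (h : IsUnit (Xᵀ * X).det)
    (h1 : oneQOne X ≠ 0) {v : Fin r → EuclideanSpace ℝ (Fin T)} {V : Matrix (Fin T) (Fin r) ℝ}
    (hV : V = Matrix.of fun t j => v j t) (hVV : Vᵀ * V = 1) {i : Fin N} (hi : mu i = 0)
    {x : Matrix (Fin T) Unit ℝ}
    (hx : x = residualMaker X * ((√(T : ℝ))⁻¹ • Z * replicateCol Unit (γ i) +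
      (√(T : ℝ))⁻¹ • replicateCol Unit (ηᵀ i))) :
    testStat X (panelResponse mu beta γ X Z η) v i =
      √(T : ℝ) * ((PCASystem.residualDir (replicateCol Unit (unitDir X)) V)ᵀ * x) () () /
        √(∑ t, ((1 - V * Vᵀ) * x : Matrix (Fin T) Unit ℝ) t () ^ 2) := by
  have hTR : (0 : ℝ) < T := by exact_mod_cast hT
  have hsT : √(T : ℝ) ≠ 0 := (Real.sqrt_pos.2 hTR).ne'
  have hq := Real.sqrt_pos.2 (oneQOne_pos h h1)
  set Y := panelResponse mu beta γ X Z η with hY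
  -- For a true null the rank-one intercept term is absent from the row.
  have hres : ∀ t, residual X Y i t = √(T : ℝ) * x t () := by
    intro t
    have e : residual X Y i = residualMaker X *ᵥ (Z *ᵥ γ i + ηᵀ i) := by
      rw [residual_panelResponse h h1]
      have e2 : (γ * Zᵀ + ηᵀ) * residualMaker X = (residualMaker X * (Z * γᵀ + η))ᵀ := by
        rw [Matrix.transpose_mul, residualMaker_transpose]; simp
      rw [e2]
      ext t
      simp only [Matrix.add_apply, Matrix.smul_apply, Matrix.mul_apply, Matrix.transpose_apply,
        replicateCol_apply, hi, Matrix.mulVec, dotProduct, Pi.add_apply]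
      simp only [Finset.univ_unique, Finset.sum_singleton, zero_mul, smul_zero, zero_add]
    have e3 : x = (√(T : ℝ))⁻¹ • (residualMaker X * replicateCol Unit (Z *ᵥ γ i + ηᵀ i)) := by
      rw [hx, Matrix.replicateCol_add, Matrix.replicateCol_mulVec, Matrix.smul_mul, ← smul_add,
        Matrix.mul_smul]
    rw [e, e3, ← Matrix.replicateCol_mulVec]
    simp [hsT]
  have hFH : factorHat v = √(T : ℝ) • V := by ext t k; simp [factorHat, hV]
  have hFF : (factorHat v)ᵀ * factorHat v = (T : ℝ) • (1 : Matrix (Fin r) (Fin r) ℝ) := by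
    rw [hFH, Matrix.transpose_smul, Matrix.smul_mul, Matrix.mul_smul, smul_smul, hVV,
      Real.mul_self_sqrt hTR.le]
  have hinv : ((factorHat v)ᵀ * factorHat v)⁻¹ = (T : ℝ)⁻¹ • (1 : Matrix (Fin r) (Fin r) ℝ) := by
    rw [hFF]
    refine Matrix.inv_eq_right_inv ?_
    rw [Matrix.smul_mul, Matrix.mul_smul, smul_smul, mul_inv_cancel₀ hTR.ne']; simp
  -- The estimated factors are orthogonal with squared length T, so regressing on them is the
  -- projection VVᵀ.
  have hproj : factorHat v * ((factorHat v)ᵀ * factorHat v)⁻¹ * (factorHat v)ᵀ = V * Vᵀ := by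
    rw [hinv, hFH, Matrix.transpose_smul]
    simp only [Matrix.smul_mul, Matrix.mul_smul, smul_smul, Matrix.mul_one]
    rw [show √(T : ℝ) * ((T : ℝ)⁻¹ * √(T : ℝ)) = (T : ℝ)⁻¹ * (√(T : ℝ) * √(T : ℝ)) by ring,
      Real.mul_self_sqrt hTR.le, inv_mul_cancel₀ hTR.ne', one_smul]
  have hYQ : residualMaker X *ᵥ Y i = residual X Y i := by
    ext t; simp [residual, Matrix.mul_apply, Matrix.mulVec, dotProduct]
  have hfl : factorHat v *ᵥ loadingHat X Y v i = (V * Vᵀ) *ᵥ residual X Y i := by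
    have e : loadingHat X Y v i =
        (((factorHat v)ᵀ * factorHat v)⁻¹ * (factorHat v)ᵀ) *ᵥ residual X Y i := by
      ext k; simp [loadingHat, Matrix.mul_apply, Matrix.mulVec, dotProduct]
    rw [← hproj, e, Matrix.mulVec_mulVec, Matrix.mul_assoc]
  have hw : ∀ y : Fin T → ℝ, (√(oneQOne X))⁻¹ * ((1 : Fin T → ℝ) ⬝ᵥ (residualMaker X *ᵥ y)) =
      unitDir X ⬝ᵥ y := by
    intro y
    rw [Matrix.dotProduct_mulVec, ← Matrix.mulVec_transpose, residualMaker_transpose, unitDir,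
      smul_dotProduct, smul_eq_mul]
  have hnum : √(oneQOne X) * muHat X Y i -
      (√(oneQOne X))⁻¹ *
        ((1 : Fin T → ℝ) ⬝ᵥ (residualMaker X *ᵥ (factorHat v *ᵥ loadingHat X Y v i))) =
      √(T : ℝ) * ((PCASystem.residualDir (replicateCol Unit (unitDir X)) V)ᵀ * x) () () := by
    have e1 : √(oneQOne X) * muHat X Y i = unitDir X ⬝ᵥ residual X Y i := by
      rw [← hw, ← hYQ, Matrix.mulVec_mulVec, residualMaker_idem h, muHat, ← mul_assoc]
      congr 1
      nth_rw 2 [← Real.mul_self_sqrt (oneQOne_pos h h1).le]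
      field_simp
    rw [e1, hw, hfl, ← dotProduct_sub]
    have e2 : PCASystem.residualDir (replicateCol Unit (unitDir X)) V =
        (1 - V * Vᵀ) * replicateCol Unit (unitDir X) := by
      rw [PCASystem.residualDir, Matrix.sub_mul, Matrix.one_mul, Matrix.mul_assoc]
    have e3 : (1 - V * Vᵀ)ᵀ = 1 - V * Vᵀ := by simp
    have e4 : replicateCol Unit (residual X Y i) = √(T : ℝ) • x := by
      ext t j; simp [hres]
    have e5 : unitDir X ⬝ᵥ (residual X Y i - (V * Vᵀ) *ᵥ residual X Y i) =
        ((replicateCol Unit (unitDir X))ᵀ * ((1 - V * Vᵀ) * replicateCol Unit (residual X Y i)) :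
          Matrix Unit Unit ℝ) () () := by
      rw [← Matrix.replicateCol_mulVec, Matrix.sub_mulVec, Matrix.one_mulVec]
      simp [Matrix.mul_apply, dotProduct]
    rw [e5, e4, e2, Matrix.transpose_mul, e3, Matrix.mul_smul, Matrix.mul_smul, Matrix.smul_apply,
      smul_eq_mul, Matrix.mul_assoc]
  have hvar : varHat X Y v i = ∑ t, ((1 - V * Vᵀ) * x : Matrix (Fin T) Unit ℝ) t () ^ 2 := by
    have e1 : noiseHat X Y v i = (1 - V * Vᵀ) *ᵥ residual X Y i := by
      rw [noiseHat, residualMaker, hproj]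
      ext t; simp [Matrix.mul_apply, Matrix.mulVec, dotProduct]
    have e2 : ∀ t, ((1 - V * Vᵀ) *ᵥ residual X Y i) t = √(T : ℝ) * ((1 - V * Vᵀ) * x : Matrix (Fin T) Unit ℝ) t () := by
      intro t
      simp only [Matrix.mulVec, dotProduct, Matrix.mul_apply, Finset.mul_sum, hres]
      exact Finset.sum_congr rfl fun s _ => by ring
    rw [varHat, e1]
    simp only [dotProduct, e2, Finset.mul_sum]
    refine Finset.sum_congr rfl fun t _ => ?_
    rw [show (T : ℝ)⁻¹ * (√(T : ℝ) * ((1 - V * Vᵀ) * x : Matrix (Fin T) Unit ℝ) t () * (√(T : ℝ) * ((1 - V * Vᵀ) * x : Matrix (Fin T) Unit ℝ) t ()))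
      = (T : ℝ)⁻¹ * (√(T : ℝ) * √(T : ℝ)) * ((1 - V * Vᵀ) * x : Matrix (Fin T) Unit ℝ) t () ^ 2 by ring,
      Real.mul_self_sqrt hTR.le, inv_mul_cancel₀ hTR.ne', one_mul]
  rw [testStat, hnum, hvar]

end Translation

/-! ### A lower bound for the leading singular values. -/

section LowerBound

open scoped Matrix.Norms.L2Operator

variable {n t k : Type*} [Fintype n] [Fintype t] [Fintype k]
  [DecidableEq n] [DecidableEq t] [DecidableEq k]

lemma norm_smul_le_of_sum_sq_le {A : Matrix n t ℝ} {a s c : ℝ} (hc : 0 ≤ c)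
    (hA : ∑ i, ∑ j, A i j ^ 2 ≤ s) (h : a ^ 2 * s ≤ c ^ 2) : ‖a • A‖ ≤ c := by
  refine norm_le_of_sum_sq_le hc (le_trans (le_of_eq ?_) ((mul_le_mul_of_nonneg_left hA
    (sq_nonneg a)).trans h))
  simp only [Matrix.smul_apply, smul_eq_mul, mul_pow, Finset.mul_sum]

/-- The residual form does not shrink the span of the factors. -/
lemma norm_residualForm_mul_ge {m : Matrix n Unit ℝ} {G : Matrix n k ℝ} {Z : Matrix t k ℝ}
    {E : Matrix n t ℝ} {Q : Matrix t t ℝ} {w : Matrix t Unit ℝ} (hQ : Qᵀ = Q) (hQQ : Q * Q = Q)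
    (hQw : Q * w = w) {c : ℝ} (hG : ∀ y : Matrix k Unit ℝ, c * ‖y‖ ≤ ‖G * y‖)
    (hR : ‖m‖ * ‖Zᵀ * w‖ + ‖G‖ * (‖Zᵀ * Z - 1‖ + ‖(1 - Q) * Z‖ ^ 2) + ‖E‖ * ‖Z‖ ≤ c / 2)
    (y : Matrix k Unit ℝ) : c / 2 * ‖y‖ ≤ ‖residualForm m G Z E Q w * (Q * Z * y)‖ := by
  -- Since ZᵀQZ = 1 + (ZᵀZ − 1) − ((1 − Q)Z)ᵀ((1 − Q)Z), the residual form acts on QZy as G acts on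
  -- y, up to the error R, which takes away at most half of the lower bound for G.
  set R := m * (Zᵀ * w)ᵀ + G * (Zᵀ * Z - 1 - ((1 - Q) * Z)ᵀ * ((1 - Q) * Z)) + E * (Q * Z) with hRd
  have hwQ : wᵀ * Q = wᵀ := by rw [← hQ, ← Matrix.transpose_mul, hQw]
  have h1Q : ((1 - Q) * Z)ᵀ * ((1 - Q) * Z) = Zᵀ * Z - Zᵀ * (Q * Z) := by
    have : (1 - Q) * (1 - Q) = 1 - Q := by
      rw [Matrix.sub_mul, Matrix.mul_sub, Matrix.mul_sub, hQQ]; simp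
    rw [Matrix.transpose_mul, Matrix.transpose_sub, hQ, Matrix.transpose_one, Matrix.mul_assoc,
      ← Matrix.mul_assoc (1 - Q), this, Matrix.sub_mul, Matrix.mul_sub, Matrix.one_mul]
  have e : residualForm m G Z E Q w * (Q * Z * y) = G * y + R * y := by
    rw [residualForm, hRd, h1Q, Matrix.transpose_mul, Matrix.transpose_transpose, Matrix.add_mul,
      Matrix.mul_assoc (G * Zᵀ + E), Matrix.mul_assoc m, ← Matrix.mul_assoc wᵀ,
      ← Matrix.mul_assoc wᵀ, hwQ, ← Matrix.mul_assoc Q (Q * Z), ← Matrix.mul_assoc Q Q, hQQ]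
    have : Zᵀ * Z - 1 - (Zᵀ * Z - Zᵀ * (Q * Z)) = Zᵀ * (Q * Z) - 1 := by abel_nf
    rw [this]
    simp only [Matrix.add_mul, Matrix.mul_sub, Matrix.sub_mul, Matrix.mul_assoc, Matrix.one_mul]
    abel_nf
  have hRn : ‖R‖ ≤ c / 2 := by
    refine le_trans ?_ hR
    refine (norm_add_le _ _).trans (add_le_add ((norm_add_le _ _).trans (add_le_add ?_ ?_)) ?_)
    · exact norm_matrix_mul_le_of_le le_rfl (norm_transpose_eq _).le
    · refine norm_matrix_mul_le_of_le le_rfl ((norm_sub_le _ _).trans ?_)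
      rw [norm_transpose_mul_self_eq]
    · refine norm_matrix_mul_le_of_le le_rfl ((norm_matrix_mul_le_of_le
        (norm_le_one_of_idem hQ hQQ) le_rfl).trans (one_mul _).le)
  have h2 : ‖R * y‖ ≤ c / 2 * ‖y‖ := norm_matrix_mul_le_of_le hRn le_rfl
  have h3 : ‖G * y‖ ≤ ‖G * y + R * y‖ + ‖R * y‖ := by
    have := norm_sub_le (G * y + R * y) (R * y)
    rwa [add_sub_cancel_right] at this
  rw [e]
  have := hG y
  linarith

end LowerBound

/-! ### Good draws yield a PCA system. -/

section GoodDraw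

open scoped Matrix.Norms.L2Operator

variable {N T p r : ℕ} {S : Matrix (Fin N) (Fin N) ℝ} {mu : EuclideanSpace ℝ (Fin N)}
    {beta : Matrix (Fin N) (Fin p) ℝ} {γ : Matrix (Fin N) (Fin r) ℝ}
    {X : Matrix (Fin T) (Fin p) ℝ} {z : Fin T → EuclideanSpace ℝ (Fin r)}
    {η : Fin T → EuclideanSpace ℝ (Fin N)} {v : Fin r → EuclideanSpace ℝ (Fin T)}
    {K κ g Cm c B ℓ lev b : ℝ}

/-- The conditions on the loadings, the covariances and the intercepts under which good draws are
analysed; `B` collects the constants. -/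
structure Regular (S : Matrix (Fin N) (Fin N) ℝ) (mu : EuclideanSpace ℝ (Fin N))
    (γ : Matrix (Fin N) (Fin r) ℝ) (T p : ℕ) (K κ g Cm c B : ℝ) : Prop where
  N_pos : 0 < N
  T_pos : 0 < T
  K_pos : 0 < K
  kappa_pos : 0 < κ
  g_pos : 0 < g
  Cm_pos : 0 < Cm
  c_pos : 0 < c
  B_eq : B = 1 + g + Cm + K * (r + 1) + K * ((r + 1) * g) + 2 * K * (r + 1) ^ 2 + g * Cm ^ 2 +
    K * ((p + 1) * (r + 1)) + r + 2 * K
  diag_pos : ∀ i, 0 < S i i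
  diag_le : ∀ i, S i i ≤ 1
  gamma_le : ∀ i, ∑ k, γ i k ^ 2 ≤ g
  mu_le : ‖mu‖ ≤ Cm * (√(N : ℝ) / √(T : ℝ))
  mu_le' : ‖mu‖ ≤ Cm * ((N : ℝ) / (T * √((Finset.univ.filter fun i => mu i ≠ 0).card : ℝ)))
  lower : ∀ y : Fin r → ℝ, c ^ 2 * ∑ k, y k ^ 2 ≤ (N : ℝ)⁻¹ * ∑ i, (∑ k, γ i k * y k) ^ 2
  h_small : 10 * B ^ 3 * √((T : ℝ)⁻¹ + κ) ≤ c

namespace Regular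

/-- `B` is a sum of nonnegative terms, one for each constant met in the moment bounds, so it
dominates them all at once. -/
lemma budget (H : Regular S mu γ T p K κ g Cm c B) : 1 ≤ B ∧ g ≤ B ∧ Cm ≤ B ∧ K * (r + 1) ≤ B ∧
    K * ((r + 1) * g) ≤ B ∧ 2 * K * (r + 1) ^ 2 ≤ B ∧ g * Cm ^ 2 ≤ B ∧
    K * ((p + 1) * (r + 1)) ≤ B ∧ (r : ℝ) + 1 ≤ B ∧ 2 * K ≤ B := by
  have h1 := H.K_pos
  have h2 := H.g_pos
  have h3 := H.Cm_pos
  have a1 : 0 ≤ K * (r + 1) := by positivity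
  have a2 : 0 ≤ K * ((r + 1) * g) := by positivity
  have a3 : 0 ≤ 2 * K * (r + 1) ^ 2 := by positivity
  have a4 : 0 ≤ g * Cm ^ 2 := by positivity
  have a5 : 0 ≤ K * ((p + 1) * (r + 1)) := by positivity
  have a6 : (0 : ℝ) ≤ r := by positivity
  rw [H.B_eq]
  refine ⟨?_, ?_, ?_, ?_, ?_, ?_, ?_, ?_, ?_, ?_⟩ <;> linarith

end Regular

/-- Only false nulls contribute to γᵀμ, so Cauchy–Schwarz over them yields N₁ instead of N. Combined
with the bound on √N₁‖μ‖, this makes the rescaled Gᵀm of order θ². -/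
lemma sum_loading_mul_sq_le (γ : Matrix (Fin N) (Fin r) ℝ) (mu : EuclideanSpace ℝ (Fin N))
    (hg : ∀ i, ∑ k, γ i k ^ 2 ≤ g) :
    ∑ k, (∑ i, γ i k * mu i) ^ 2 ≤
      (Finset.univ.filter fun i => mu i ≠ 0).card * g * ‖mu‖ ^ 2 := by
  set s := Finset.univ.filter fun i => mu i ≠ 0
  have h1 : ∀ k, (∑ i, γ i k * mu i) ^ 2 ≤ (∑ i ∈ s, γ i k ^ 2) * ‖mu‖ ^ 2 := fun k => by
    have e : ∑ i, γ i k * mu i = ∑ i ∈ s, γ i k * mu i := by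
      rw [Finset.sum_filter]
      refine Finset.sum_congr rfl fun i _ => ?_
      by_cases h : mu i = 0 <;> simp [h]
    rw [e]
    refine (Finset.sum_mul_sq_le_sq_mul_sq _ _ _).trans ?_
    refine mul_le_mul_of_nonneg_left ?_ (Finset.sum_nonneg fun _ _ => sq_nonneg _)
    rw [EuclideanSpace.norm_sq_eq]
    refine (Finset.sum_le_sum_of_subset_of_nonneg (Finset.subset_univ s)
      fun _ _ _ => sq_nonneg _).trans (le_of_eq ?_)
    simp
  calc _ ≤ ∑ k, (∑ i ∈ s, γ i k ^ 2) * ‖mu‖ ^ 2 := Finset.sum_le_sum fun k _ => h1 k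
    _ = (∑ i ∈ s, ∑ k, γ i k ^ 2) * ‖mu‖ ^ 2 := by rw [← Finset.sum_mul, Finset.sum_comm]
    _ ≤ (∑ i ∈ s, g) * ‖mu‖ ^ 2 := by gcongr with i; exact hg i
    _ = _ := by simp

set_option maxHeartbeats 1600000 in
/-- The rescaled ingredients of the model form a PCA system on a good draw. -/
lemma GoodDraw.pcaSystem (H : Regular S mu γ T p K κ g Cm c B)
    (D : GoodDraw S γ p K ((N * κ) ^ 2) ((r + 1) * g * (N * κ) ^ 2) ℓ lev b
      (fun t s => residualMaker X t s) (unitDir X) z η)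
    (hX : IsUnit (Xᵀ * X).det) (hX1 : oneQOne X ≠ 0)
    (hv : IsLeadingEigenvectors
      (pcaMatrix X (panelResponse mu beta γ X (timeRows z) (timeRows η))) v)
    {C : ℝ} (hC : 3 * B ≤ C) (hC' : 16 * B ^ 2 / c ^ 2 ≤ C)
    (hs : 60 * C ^ 9 * √((T : ℝ)⁻¹ + κ) ≤ 1) :
    ∃ d τ, PCASystem C (√(T : ℝ))⁻¹ κ √((T : ℝ)⁻¹ + κ) (√(T : ℝ) * ‖mu‖ / √(N : ℝ)) τ
      ((√(oneQOne X) / √(N * T)) • replicateCol Unit mu.ofLp)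
      ((√(N : ℝ))⁻¹ • γ) ((√(T : ℝ))⁻¹ • timeRows z) ((√(N * T : ℝ))⁻¹ • (timeRows η)ᵀ)
      (residualMaker X) (replicateCol Unit (unitDir X)) (Matrix.of fun t j => v j t) d := by
  obtain ⟨b1, bg, bCm, b4, b5, b6, b7, b8, br, b2K⟩ := H.budget
  have hN : (0 : ℝ) < N := by exact_mod_cast H.N_pos
  have hT : (0 : ℝ) < T := by exact_mod_cast H.T_pos
  have hκ := H.kappa_pos
  have hK := H.K_pos
  have hg := H.g_pos
  have hCm := H.Cm_pos
  have hc := H.c_pos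
  have hB0 : 0 < B := by linarith
  have hBB : B ≤ B ^ 2 := by nlinarith
  set θ : ℝ := (√(T : ℝ))⁻¹ with hθ
  have hθ0 : 0 < θ := by positivity
  have hθ2 : θ ^ 2 = (T : ℝ)⁻¹ := by rw [hθ, inv_pow, Real.sq_sqrt hT.le]
  set h : ℝ := √((T : ℝ)⁻¹ + κ) with hh
  have hh0 : 0 ≤ h := Real.sqrt_nonneg _
  have hh2 : h ^ 2 = θ ^ 2 + κ := by rw [hh, Real.sq_sqrt (by positivity), hθ2]
  have hN2 : ((√(N : ℝ))⁻¹) ^ 2 = (N : ℝ)⁻¹ := by rw [inv_pow, Real.sq_sqrt hN.le]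
  have hNT2 : ((√(N * T : ℝ))⁻¹) ^ 2 = (N * T : ℝ)⁻¹ := by
    rw [inv_pow, Real.sq_sqrt (by positivity)]
  have hC3 : 3 ≤ C := by linarith
  have hC1 : 1 ≤ C := by linarith
  have hh1 : h ≤ 1 := by
    have : 1 ≤ C ^ 9 := one_le_pow₀ hC1
    nlinarith
  have hθh : θ ≤ h := (sq_le_sq₀ hθ0.le hh0).1 (by linarith)
  have hθ1 : θ ≤ 1 := hθh.trans hh1
  set q : ℝ := √(T : ℝ) * ‖mu‖ / √(N : ℝ) with hq
  have hq0 : 0 ≤ q := by positivity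
  have hqC : q ≤ Cm := by
    rw [hq, div_le_iff₀ (by positivity)]
    have := mul_le_mul_of_nonneg_left H.mu_le (Real.sqrt_nonneg (T : ℝ))
    refine this.trans (le_of_eq ?_)
    field_simp
  set Q := residualMaker X with hQ
  set w := replicateCol Unit (unitDir X) with hw
  set G : Matrix (Fin N) (Fin r) ℝ := (√(N : ℝ))⁻¹ • γ with hG
  set Z : Matrix (Fin T) (Fin r) ℝ := θ • timeRows z with hZ
  set E : Matrix (Fin N) (Fin T) ℝ := (√(N * T : ℝ))⁻¹ • (timeRows η)ᵀ with hE
  set m : Matrix (Fin N) Unit ℝ := (√(oneQOne X) / √(N * T)) • replicateCol Unit mu.ofLp with hm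
  have hQs : Qᵀ = Q := residualMaker_transpose X
  have hQQ : Q * Q = Q := residualMaker_idem hX
  have hQw : Q * w = w := by
    rw [hw, ← Matrix.replicateCol_mulVec, residualMaker_mulVec_unitDir hX]
  have hww : wᵀ * w = 1 := by
    ext i j
    have := unitDir_sq hX hX1
    simpa [hw, Matrix.mul_apply, ← sq] using this
  set τ : ℝ := (N * T : ℝ)⁻¹ * S.trace with hτ
  have htr0 : 0 ≤ S.trace := Finset.sum_nonneg fun i _ => (H.diag_pos i).le
  have htr : S.trace ≤ N := by
    calc S.trace ≤ ∑ i : Fin N, (1 : ℝ) := Finset.sum_le_sum fun i _ => H.diag_le i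
      _ = N := by simp
  have hτ0 : 0 ≤ τ := by positivity
  have hτθ : τ ≤ θ ^ 2 := by
    rw [hτ, hθ2, mul_inv]
    calc (N : ℝ)⁻¹ * (T : ℝ)⁻¹ * S.trace ≤ (N : ℝ)⁻¹ * (T : ℝ)⁻¹ * N := by gcongr
      _ = (T : ℝ)⁻¹ := by field_simp
  have nG : ‖G‖ ≤ B := by
    refine norm_smul_le_of_sum_sq_le hB0.le (s := N * g) ?_ ?_
    · exact (Finset.sum_le_sum fun i _ => H.gamma_le i).trans (by simp)
    · rw [hN2, inv_mul_cancel_left₀ hN.ne']; linarith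
  have nZZ : ‖Zᵀ * Z - 1‖ ≤ B * θ := by
    have e : Zᵀ * Z - 1 = (T : ℝ)⁻¹ • ((timeRows z)ᵀ * timeRows z - (T : ℝ) • 1) := by
      rw [hZ, Matrix.transpose_smul, Matrix.smul_mul, Matrix.mul_smul, smul_smul, ← sq, hθ2,
        smul_sub, smul_smul, inv_mul_cancel₀ hT.ne', one_smul]
    rw [e]
    refine norm_smul_le_of_sum_sq_le (by positivity) (s := K * (2 * (r + 1) ^ 2 * T)) ?_ ?_
    · refine le_trans (le_of_eq ?_) D.moment
      simp [Matrix.mul_apply, timeRows]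
    · rw [mul_pow, hθ2]
      calc _ = (2 * K * (r + 1) ^ 2) * (T : ℝ)⁻¹ := by field_simp
        _ ≤ B ^ 2 * (T : ℝ)⁻¹ := by gcongr; linarith only [b1, bg, bCm, b4, b5, b6, b7, b8, br, b2K,
            hBB, hC]
  have nZ : ‖Z‖ ≤ 2 * B := by
    have h1 : ‖Zᵀ * Z‖ ≤ ‖Zᵀ * Z - 1‖ + ‖(1 : Matrix (Fin r) (Fin r) ℝ)‖ := by
      have := norm_add_le (Zᵀ * Z - 1) (1 : Matrix (Fin r) (Fin r) ℝ)
      rwa [sub_add_cancel] at this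
    rw [norm_transpose_mul_self_eq] at h1
    have h2 := norm_one_matrix_le (k := Fin r)
    have h3 : B * θ ≤ B := mul_le_of_le_one_right hB0.le hθ1
    refine (sq_le_sq₀ (norm_nonneg _) (by positivity)).1 ?_
    calc ‖Z‖ ^ 2 ≤ B * θ + 1 := by linarith only [h1, h2, nZZ]
      _ ≤ (2 * B) ^ 2 := by nlinarith only [h3, b1]
  have nZw : ‖Zᵀ * w‖ ≤ B * θ := by
    have e : Zᵀ * w = θ • ((timeRows z)ᵀ * w) := by
      rw [hZ, Matrix.transpose_smul, Matrix.smul_mul]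
    rw [e]
    refine norm_smul_le_of_sum_sq_le (by positivity) (s := K * (r + 1)) ?_ ?_
    · refine le_trans (le_of_eq ?_) D.dir_factor
      simp [Matrix.mul_apply, timeRows, hw, mul_comm]
    · rw [mul_pow, mul_comm]; gcongr; linarith only [b1, bg, bCm, b4, b5, b6, b7, b8, br, b2K,
            hBB, hC]
  have nEw : ‖E * w‖ ≤ B * θ := by
    have e : E * w = (√(N * T : ℝ))⁻¹ • ((timeRows η)ᵀ * w) := by rw [hE, Matrix.smul_mul]
    rw [e]
    refine norm_smul_le_of_sum_sq_le (by positivity) (s := K * N) ?_ ?_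
    · refine le_trans (le_of_eq ?_) D.dir_noise
      simp [Matrix.mul_apply, timeRows, hw, mul_comm]
    · rw [mul_pow, hNT2, hθ2]
      calc _ = K * (T : ℝ)⁻¹ := by field_simp
        _ ≤ B ^ 2 * (T : ℝ)⁻¹ := by gcongr; linarith only [b1, bg, bCm, b4, b5, b6, b7, b8, br, b2K,
            hBB, hC]
  have hco : ((√(N : ℝ))⁻¹ * (√(N * T : ℝ))⁻¹) ^ 2 = (N : ℝ)⁻¹ ^ 2 * (T : ℝ)⁻¹ := by
    rw [mul_pow, hN2, hNT2]; field_simp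
  have nGE : ‖Gᵀ * E‖ ≤ B * κ := by
    have e : Gᵀ * E = ((√(N : ℝ))⁻¹ * (√(N * T : ℝ))⁻¹) • (γᵀ * (timeRows η)ᵀ) := by
      rw [hG, hE, Matrix.transpose_smul, Matrix.smul_mul, Matrix.mul_smul, smul_smul]
    rw [e]
    refine norm_smul_le_of_sum_sq_le (by positivity)
      (s := K * (T * ((r + 1) * g * (N * κ) ^ 2))) ?_ ?_
    · refine le_trans (le_of_eq ?_) D.loading
      rw [Finset.sum_comm]
      simp [Matrix.mul_apply, timeRows]
    · rw [hco]
      calc _ = K * ((r + 1) * g) * κ ^ 2 := by field_simp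
        _ ≤ B ^ 2 * κ ^ 2 := by gcongr; linarith only [b1, bg, bCm, b4, b5, b6, b7, b8, br, b2K,
            hBB, hC]
        _ = _ := by ring
  have nGEw : ‖Gᵀ * E * w‖ ≤ B * κ * θ := by
    have e : Gᵀ * E * w = ((√(N : ℝ))⁻¹ * (√(N * T : ℝ))⁻¹) • (γᵀ * ((timeRows η)ᵀ * w)) := by
      rw [hG, hE, Matrix.transpose_smul, Matrix.smul_mul, Matrix.mul_smul, smul_smul,
        Matrix.smul_mul, Matrix.mul_assoc]
    rw [e]
    refine norm_smul_le_of_sum_sq_le (by positivity)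
      (s := K * ((r + 1) * g * (N * κ) ^ 2)) ?_ ?_
    · refine le_trans (le_of_eq ?_) D.loading_dir
      simp [Matrix.mul_apply, timeRows, hw, mul_comm]
    · rw [hco, mul_pow, mul_pow, hθ2]
      calc _ = K * ((r + 1) * g) * κ ^ 2 * (T : ℝ)⁻¹ := by field_simp
        _ ≤ B ^ 2 * κ ^ 2 * (T : ℝ)⁻¹ := by gcongr; linarith only [b1, bg, bCm, b4, b5, b6, b7, b8, br, b2K,
            hBB, hC]
        _ = (B * κ) ^ 2 * (T : ℝ)⁻¹ := by ring
  have hqN : ‖mu‖ / √(N : ℝ) = q * θ := by rw [hq, hθ]; field_simp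
  have hsq : √(oneQOne X) ≤ √(T : ℝ) := Real.sqrt_le_sqrt (oneQOne_le hX)
  have hmu2 : ∑ i, mu i ^ 2 = ‖mu‖ ^ 2 := by rw [EuclideanSpace.norm_sq_eq]; simp
  have hcm : (√(oneQOne X) / √(N * T : ℝ)) ^ 2 ≤ (N : ℝ)⁻¹ := by
    rw [div_pow, Real.sq_sqrt (oneQOne_pos hX hX1).le,
      Real.sq_sqrt (show (0 : ℝ) ≤ N * T by positivity),
      div_le_iff₀ (by positivity)]
    exact (oneQOne_le hX).trans (le_of_eq (by field_simp))
  have nm : ‖m‖ ≤ q * θ := by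
    refine norm_smul_le_of_sum_sq_le (by positivity) (s := ‖mu‖ ^ 2) ?_ ?_
    · simp [hmu2]
    · refine (mul_le_mul_of_nonneg_right hcm (sq_nonneg _)).trans (le_of_eq ?_)
      rw [← hqN, div_pow, Real.sq_sqrt hN.le, div_eq_inv_mul]
  have nGm : ‖Gᵀ * m‖ ≤ B * θ ^ 2 := by
    have e : Gᵀ * m = ((√(N : ℝ))⁻¹ * (√(oneQOne X) / √(N * T))) •
        (γᵀ * replicateCol Unit mu.ofLp) := by
      rw [hG, hm, Matrix.transpose_smul, Matrix.smul_mul, Matrix.mul_smul, smul_smul]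
    rw [e]
    set N1 : ℝ := ((Finset.univ.filter fun i => mu i ≠ 0).card : ℝ) with hN1
    have hN10 : 0 ≤ N1 := by positivity
    refine norm_smul_le_of_sum_sq_le (by positivity) (s := N1 * g * ‖mu‖ ^ 2) ?_ ?_
    · refine le_trans (le_of_eq ?_) (sum_loading_mul_sq_le γ mu H.gamma_le)
      simp [Matrix.mul_apply]
    · rw [mul_pow, hN2]
      have h1 : √N1 * ‖mu‖ ≤ Cm * (N / T) := by
        rcases hN10.eq_or_lt with h0 | h0
        · rw [← h0]; simp; positivity
        · have := mul_le_mul_of_nonneg_left H.mu_le' (Real.sqrt_nonneg N1)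
          refine this.trans (le_of_eq ?_)
          have := (Real.sqrt_pos.2 h0).ne'
          rw [← hN1]
          field_simp
      have h2 : N1 * ‖mu‖ ^ 2 ≤ Cm ^ 2 * (N / T) ^ 2 := by
        have := pow_le_pow_left₀ (by positivity) h1 2
        rwa [mul_pow, Real.sq_sqrt hN10, mul_pow] at this
      calc (N : ℝ)⁻¹ * (√(oneQOne X) / √(N * T : ℝ)) ^ 2 * (N1 * g * ‖mu‖ ^ 2)
          ≤ (N : ℝ)⁻¹ * (N : ℝ)⁻¹ * (g * (Cm ^ 2 * (N / T) ^ 2)) := by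
            rw [show N1 * g * ‖mu‖ ^ 2 = g * (N1 * ‖mu‖ ^ 2) by ring]; gcongr
        _ = (g * Cm ^ 2) * (T : ℝ)⁻¹ ^ 2 := by field_simp
        _ ≤ B ^ 2 * (T : ℝ)⁻¹ ^ 2 := by gcongr; linarith only [b1, bg, bCm, b4, b5, b6, b7, b8, br, b2K,
            hBB, hC]
        _ = (B * θ ^ 2) ^ 2 := by rw [hθ2]; ring
  have nEEw : ‖Eᵀ * E * w - τ • w‖ ≤ B * κ * θ := by
    have e : Eᵀ * E * w - τ • w =
        (N * T : ℝ)⁻¹ • (timeRows η * ((timeRows η)ᵀ * w) - S.trace • w) := by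
      rw [hE, Matrix.transpose_smul, Matrix.smul_mul, Matrix.mul_smul, smul_smul, ← sq, hNT2,
        Matrix.smul_mul, Matrix.transpose_transpose, Matrix.mul_assoc, smul_sub, smul_smul]
    rw [e]
    refine norm_smul_le_of_sum_sq_le (by positivity) (s := K * (2 * T * (N * κ) ^ 2)) ?_ ?_
    · refine le_trans (le_of_eq ?_) D.gram_dir
      simp [Matrix.mul_apply, timeRows, hw, mul_comm]
    · rw [mul_pow, mul_pow, hθ2]
      calc _ = 2 * K * κ ^ 2 * (T : ℝ)⁻¹ := by field_simp
        _ ≤ B ^ 2 * κ ^ 2 * (T : ℝ)⁻¹ := by gcongr; linarith only [b1, bg, bCm, b4, b5, b6, b7, b8, br, b2K,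
            hBB, hC]
        _ = (B * κ) ^ 2 * (T : ℝ)⁻¹ := by ring
  -- The T × T Gram matrix EᵀE equals τ times the identity up to order κ, and τ ≤ θ²; hence ‖E‖² is
  -- of order θ² + κ = h².
  have nE : ‖E‖ ≤ B * h := by
    have e : Eᵀ * E - τ • 1 = (N * T : ℝ)⁻¹ • (timeRows η * (timeRows η)ᵀ - S.trace • 1) := by
      rw [hE, Matrix.transpose_smul, Matrix.smul_mul, Matrix.mul_smul, smul_smul, ← sq, hNT2,
        Matrix.transpose_transpose, smul_sub, smul_smul]
    have h1 : ‖Eᵀ * E - τ • 1‖ ≤ B * κ := by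
      rw [e]
      refine norm_smul_le_of_sum_sq_le (by positivity) (s := K * (2 * T ^ 2 * (N * κ) ^ 2)) ?_ ?_
      · refine le_trans (le_of_eq ?_) D.gram
        simp [Matrix.mul_apply, timeRows, mul_comm]
      · calc _ = 2 * K * κ ^ 2 := by field_simp
          _ ≤ B ^ 2 * κ ^ 2 := by gcongr; linarith only [b1, bg, bCm, b4, b5, b6, b7, b8, br, b2K,
            hBB, hC]
          _ = _ := by ring
    have h2 : ‖Eᵀ * E‖ ≤ ‖Eᵀ * E - τ • 1‖ + ‖τ • (1 : Matrix (Fin T) (Fin T) ℝ)‖ := by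
      have := norm_add_le (Eᵀ * E - τ • 1) (τ • (1 : Matrix (Fin T) (Fin T) ℝ))
      rwa [sub_add_cancel] at this
    rw [norm_transpose_mul_self_eq, norm_smul τ, Real.norm_eq_abs, abs_of_nonneg hτ0] at h2
    have h3 : τ * ‖(1 : Matrix (Fin T) (Fin T) ℝ)‖ ≤ τ :=
      mul_le_of_le_one_right hτ0 norm_one_matrix_le
    refine (sq_le_sq₀ (norm_nonneg _) (by positivity)).1 ?_
    calc ‖E‖ ^ 2 ≤ B * κ + θ ^ 2 := by linarith
      _ ≤ B * (θ ^ 2 + κ) := by nlinarith only [sq_nonneg θ, b1]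
      _ ≤ B ^ 2 * (θ ^ 2 + κ) := by gcongr
      _ = _ := by rw [mul_pow, hh2]
  have nQZ : ‖(1 - Q) * Z‖ ≤ B * θ := by
    have e : (1 - Q) * Z = θ • ((1 - Q) * timeRows z) := by rw [hZ, Matrix.mul_smul]
    rw [e]
    refine norm_smul_le_of_sum_sq_le (by positivity) (s := K * ((p + 1) * (r + 1))) ?_ ?_
    · refine le_trans (le_of_eq ?_) D.coProj_factor
      simp only [Matrix.mul_apply, timeRows, coEntry, Matrix.sub_apply, Matrix.of_apply, hQ]
    · rw [mul_pow, mul_comm]; gcongr; linarith only [b1, bg, bCm, b4, b5, b6, b7, b8, br, b2K,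
            hBB, hC]
  have hGlow : ∀ y : Matrix (Fin r) Unit ℝ, c * ‖y‖ ≤ ‖G * y‖ := fun y => by
    refine (sq_le_sq₀ (by positivity) (norm_nonneg _)).1 ?_
    rw [mul_pow, norm_col_sq, norm_col_sq]
    refine (H.lower fun k => y k ()).trans (le_of_eq ?_)
    rw [Finset.mul_sum]
    refine Finset.sum_congr rfl fun i _ => ?_
    rw [hG, Matrix.smul_mul, Matrix.smul_apply, smul_eq_mul, mul_pow, hN2, Matrix.mul_apply]
  -- The terms add up to at most 5B³h, for which `h_small` makes room.
  have hR : ‖m‖ * ‖Zᵀ * w‖ + ‖G‖ * (‖Zᵀ * Z - 1‖ + ‖(1 - Q) * Z‖ ^ 2) + ‖E‖ * ‖Z‖ ≤ c / 2 := by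
    have a1 : ‖m‖ * ‖Zᵀ * w‖ ≤ (B * h) * (B * 1) := by
      refine mul_le_mul (nm.trans ?_) (nZw.trans ?_) (norm_nonneg _) (by positivity)
      · exact mul_le_mul (hqC.trans bCm) hθh hθ0.le hB0.le
      · gcongr
    have a2 : ‖(1 - Q) * Z‖ ^ 2 ≤ (B * 1) * (B * h) := by
      rw [sq]
      refine mul_le_mul (nQZ.trans ?_) (nQZ.trans ?_) (norm_nonneg _) (by positivity) <;> gcongr
    have a3 : ‖Zᵀ * Z - 1‖ ≤ B * h := nZZ.trans (by gcongr)
    have a4 : ‖G‖ * (‖Zᵀ * Z - 1‖ + ‖(1 - Q) * Z‖ ^ 2) ≤ B * (B * h + B * 1 * (B * h)) :=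
      mul_le_mul nG (add_le_add a3 a2) (by positivity) hB0.le
    have a5 : ‖E‖ * ‖Z‖ ≤ B * h * (2 * B) := mul_le_mul nE nZ (norm_nonneg _) (by positivity)
    have a6 : B ^ 2 * h ≤ B ^ 3 * h := by gcongr; norm_num
    have a7 := H.h_small
    rw [← hh] at a7
    linarith only [a1, a4, a5, a6, a7]
  have hlow := norm_residualForm_mul_ge hQs hQQ hQw hGlow hR
  have hU : ∀ y : Fin r → ℝ, ((Q * Z) *ᵥ y) ⬝ᵥ ((Q * Z) *ᵥ y) = ‖Q * Z * replicateCol Unit y‖ ^ 2 := by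
    intro y
    rw [norm_col_sq, ← Matrix.replicateCol_mulVec]
    simp [dotProduct, sq]
  have hinj : ∀ y : Fin r → ℝ, (Q * Z) *ᵥ y = 0 → y = 0 := by
    intro y hy
    have h1 := hlow (replicateCol Unit y)
    rw [← Matrix.replicateCol_mulVec, hy] at h1
    have h2 : replicateCol Unit (0 : Fin T → ℝ) = 0 := by ext; simp
    rw [h2, Matrix.mul_zero, norm_zero] at h1
    have h3 : ‖replicateCol Unit y‖ ≤ 0 := by
      by_contra hc'
      have : 0 < c / 2 * ‖replicateCol Unit y‖ := mul_pos (by linarith) (not_le.1 hc')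
      linarith
    have h4 := norm_le_zero_iff.1 h3
    ext k
    exact congrFun (congrFun h4 k) ()
  -- The constant is the square of the ratio of ‖FQZy‖ ≥ (c/2)‖y‖ to ‖QZy‖ ≤ 2B‖y‖.
  have hquad : ∀ y : Fin r → ℝ, c ^ 2 / (16 * B ^ 2) * (((Q * Z) *ᵥ y) ⬝ᵥ ((Q * Z) *ᵥ y)) ≤
      ((Q * Z) *ᵥ y) ⬝ᵥ (pcaMatrix X (panelResponse mu beta γ X (timeRows z) (timeRows η)) *ᵥ
        ((Q * Z) *ᵥ y)) := by
    intro y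
    rw [hU, pcaMatrix_panelResponse (beta := beta) H.N_pos H.T_pos hX hX1 rfl]
    set F := residualForm m G Z E Q w with hF
    have e : ((Q * Z) *ᵥ y) ⬝ᵥ ((Fᵀ * F) *ᵥ ((Q * Z) *ᵥ y)) =
        ‖F * (Q * Z * replicateCol Unit y)‖ ^ 2 := by
      rw [norm_col_sq, ← Matrix.replicateCol_mulVec, ← Matrix.replicateCol_mulVec]
      generalize (Q * Z) *ᵥ y = x
      rw [← Matrix.mulVec_mulVec, Matrix.dotProduct_mulVec, Matrix.vecMul_transpose]
      simp [dotProduct, sq]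
    rw [e]
    have h1 := hlow (replicateCol Unit y)
    have h2 : ‖Q * Z * replicateCol Unit y‖ ≤ 2 * B * ‖replicateCol Unit y‖ :=
      norm_matrix_mul_le_of_le ((norm_matrix_mul_le_of_le
        (norm_le_one_of_idem hQs hQQ) nZ).trans (one_mul _).le) le_rfl
    calc c ^ 2 / (16 * B ^ 2) * ‖Q * Z * replicateCol Unit y‖ ^ 2
        ≤ c ^ 2 / (16 * B ^ 2) * (2 * B * ‖replicateCol Unit y‖) ^ 2 := by gcongr
      _ = (c / 2 * ‖replicateCol Unit y‖) ^ 2 := by field_simp; norm_num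
      _ ≤ _ := by gcongr
  obtain ⟨d, hd, hVV, hAV⟩ := exists_leading_eigenvalues hv (U := Q * Z)
    (c := c ^ 2 / (16 * B ^ 2)) hinj hquad
  exact ⟨d, τ,
    { one_le := hC1
      theta_nonneg := hθ0.le
      kappa_nonneg := hκ.le
      h_nonneg := hh0
      h_sq := hh2
      h_small := hs
      q_nonneg := hq0
      q_le := by linarith
      Q_symm := hQs
      Q_idem := hQQ
      Q_w := hQw
      w_unit := hww
      V_orth := hVV
      eigen := by
        rw [← pcaMatrix_panelResponse (beta := beta) H.N_pos H.T_pos hX hX1 rfl]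
        exact hAV
      d_lower := fun j => by
        refine le_trans ?_ (hd j)
        refine inv_le_of_inv_le₀ (by positivity) ?_
        rwa [inv_div]
      norm_G := by linarith
      norm_Z := by linarith
      norm_Zw := nZw.trans (by gcongr; linarith only [b1, hC])
      norm_Ew := nEw.trans (by gcongr; linarith only [b1, hC])
      norm_GE := nGE.trans (by gcongr; linarith only [b1, hC])
      norm_GEw := nGEw.trans (by gcongr; linarith only [b1, hC])
      norm_m := nm
      norm_Gm := nGm.trans (by gcongr; linarith only [b1, hC])
      norm_EEw := nEEw.trans (by gcongr; linarith only [b1, hC])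
      tau_nonneg := hτ0
      tau_le := hτθ
      norm_E := nE.trans (by gcongr; linarith only [b1, hC]) }⟩

end GoodDraw

/-! ### Stability of a threshold decision. -/

section Comparison

/-- A studentised statistic exceeds a level exactly when its idealisation does, unless the latter is
close to the level. -/
lemma level_le_abs_div_iff {num var x S s₀ z δ₁ δ₂ : ℝ} (hs : 0 < s₀) (hS : s₀ ^ 2 ≤ S)
    (hz : 0 ≤ z) (hnum : |num - x| ≤ δ₁) (hvar : |var - S| ≤ δ₂) (hδ : δ₂ ≤ s₀ ^ 2 / 2)
    (hnear : ¬ |(|x / √S| - z)| ≤ δ₁ / s₀ + z * (δ₂ / s₀ ^ 2)) :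
    z ≤ |num / √var| ↔ z ≤ |x / √S| := by
  have hs2 : 0 < s₀ ^ 2 := by positivity
  have hS0 : 0 < S := hs2.trans_le hS
  have hδ0 : 0 ≤ δ₁ := (abs_nonneg _).trans hnum
  have hδ20 : 0 ≤ δ₂ := (abs_nonneg _).trans hvar
  have hvar0 : 0 < var := by
    have := (abs_le.1 hvar).1
    linarith
  have hσ : s₀ ≤ √S := Real.le_sqrt_of_sq_le hS
  have hσ0 : 0 < √S := hs.trans_le hσ
  have hτ0 : 0 < √var := Real.sqrt_pos.2 hvar0
  set u := √var / √S with hu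
  set ν := |num| / √S with hν
  set ξ := |x / √S| with hξ
  have hu0 : 0 < u := by positivity
  have hu2 : |u - 1| ≤ δ₂ / s₀ ^ 2 := by
    have h1 : u ^ 2 - 1 = (var - S) / S := by
      rw [hu, div_pow, Real.sq_sqrt hvar0.le, Real.sq_sqrt hS0.le]; field_simp
    -- The factor u + 1 exceeds one, so passing from variances to standard deviations does not lower
    -- the order of the error.
    have h2 : |u - 1| ≤ |u ^ 2 - 1| := by
      rw [show u ^ 2 - 1 = (u - 1) * (u + 1) by ring, abs_mul]
      exact le_mul_of_one_le_right (abs_nonneg _) (by rw [abs_of_pos] <;> linarith)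
    rw [h1, abs_div, abs_of_pos hS0] at h2
    exact h2.trans (div_le_div₀ hδ20 hvar hs2 hS)
  have hνξ : |ν - ξ| ≤ δ₁ / s₀ := by
    rw [hν, hξ, abs_div x, abs_of_pos hσ0, ← sub_div, abs_div, abs_of_pos hσ0]
    exact div_le_div₀ hδ0 ((abs_abs_sub_abs_le _ _).trans hnum) hs hσ
  have e : z ≤ |num / √var| ↔ z * u ≤ ν := by
    rw [abs_div, abs_of_pos hτ0, le_div_iff₀ hτ0, hu, hν, le_div_iff₀ hσ0]
    rw [show z * (√var / √S) * √S = z * √var by field_simp]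
  rw [e]
  obtain ⟨a1, a2⟩ := abs_le.1 hνξ
  obtain ⟨c1, c2⟩ := abs_le.1 hu2
  have d1 : z * u ≤ z + z * (δ₂ / s₀ ^ 2) := by
    have := mul_le_mul_of_nonneg_left (show u ≤ 1 + δ₂ / s₀ ^ 2 by linarith) hz
    linarith
  have d2 : z - z * (δ₂ / s₀ ^ 2) ≤ z * u := by
    have := mul_le_mul_of_nonneg_left (show 1 - δ₂ / s₀ ^ 2 ≤ u by linarith) hz
    linarith
  have d3 : 0 ≤ z * (δ₂ / s₀ ^ 2) := by positivity
  have d4 : 0 ≤ δ₁ / s₀ := by positivity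
  rw [abs_le, not_and_or, not_le, not_le] at hnear
  constructor
  · intro h
    rcases hnear with h1 | h1 <;> linarith
  · intro h
    rcases hnear with h1 | h1 <;> linarith

end Comparison

/-! ### Statistics of the true nulls on a good draw. -/

section NullStatistics

open scoped Matrix.Norms.L2Operator

variable {N T p r : ℕ} {S : Matrix (Fin N) (Fin N) ℝ} {mu : EuclideanSpace ℝ (Fin N)}
    {beta : Matrix (Fin N) (Fin p) ℝ} {γ : Matrix (Fin N) (Fin r) ℝ}
    {X : Matrix (Fin T) (Fin p) ℝ} {z : Fin T → EuclideanSpace ℝ (Fin r)}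
    {η : Fin T → EuclideanSpace ℝ (Fin N)} {v : Fin r → EuclideanSpace ℝ (Fin T)}
    {K κ g Cm c B ℓ lev b : ℝ}

/-- The order of the error of the factor adjustment. -/
def adjustmentRate (N T : ℕ) (κ : ℝ) (mu : EuclideanSpace ℝ (Fin N)) : ℝ :=
  √(Real.log N / T) + κ + √(T : ℝ) * ‖mu‖ / √(N : ℝ) * √((T : ℝ)⁻¹ + κ)

/-- The mean square of the part of the noise of unit `i` explained by the design. -/
def explainedNoise (X : Matrix (Fin T) (Fin p) ℝ) (η : Fin T → EuclideanSpace ℝ (Fin N))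
    (i : Fin N) : ℝ :=
  (T : ℝ)⁻¹ * ∑ t, (∑ s, coEntry (fun t s => residualMaker X t s) t s * η s i) ^ 2

/-- On a good draw the factor-adjusted statistic of a true null is close to the standardised
projection of its noise. -/
lemma GoodDraw.exists_testStat_eq (H : Regular S mu γ T p K κ g Cm c B)
    (D : GoodDraw S γ p K ((N * κ) ^ 2) ((r + 1) * g * (N * κ) ^ 2) ℓ lev b
      (fun t s => residualMaker X t s) (unitDir X) z η)
    (hX : IsUnit (Xᵀ * X).det) (hX1 : oneQOne X ≠ 0)
    (hv : IsLeadingEigenvectors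
      (pcaMatrix X (panelResponse mu beta γ X (timeRows z) (timeRows η))) v)
    {C : ℝ} (hC : 3 * B ≤ C) (hC' : 16 * B ^ 2 / c ^ 2 ≤ C)
    (hs : 60 * C ^ 9 * √((T : ℝ)⁻¹ + κ) ≤ 1) (hℓ : ℓ = √(Real.log N / T))
    (hℓ1 : 4 * ℓ ≤ 1) (hTℓ : (√(T : ℝ))⁻¹ ≤ ℓ) {i : Fin N} (hi : mu i = 0) :
    ∃ num var : ℝ,
      testStat X (panelResponse mu beta γ X (timeRows z) (timeRows η)) v i = num / √var ∧
      |num - ∑ t, unitDir X t * η t i| ≤ 431 * C ^ 15 * adjustmentRate N T κ mu ∧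
      |var - S i i| ≤ explainedNoise X η i + 4 * ℓ + 4190 * C ^ 20 * (ℓ + κ) := by
  obtain ⟨b1, bg, bCm, b4, b5, b6, b7, b8, br, b2K⟩ := H.budget
  obtain ⟨d, τ, HP⟩ := D.pcaSystem H hX hX1 hv hC hC' hs
  have hN : (0 : ℝ) < N := by exact_mod_cast H.N_pos
  have hT : (0 : ℝ) < T := by exact_mod_cast H.T_pos
  have hT1 : (1 : ℝ) ≤ T := by exact_mod_cast H.T_pos
  have hlog : 0 ≤ Real.log N := Real.log_nonneg (by exact_mod_cast H.N_pos)
  have hsT : 0 < √(T : ℝ) := Real.sqrt_pos.2 hT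
  have hB0 : 0 < B := by linarith
  have hC0 : 0 < C := by linarith
  have hℓ0 : 0 ≤ ℓ := by rw [hℓ]; positivity
  have hθ2 : ((√(T : ℝ))⁻¹) ^ 2 = (T : ℝ)⁻¹ := by rw [inv_pow, Real.sq_sqrt hT.le]
  set V : Matrix (Fin T) (Fin r) ℝ := Matrix.of fun t j => v j t with hV
  set Q := residualMaker X with hQ
  set w := replicateCol Unit (unitDir X) with hw
  set Zn : Matrix (Fin T) (Fin r) ℝ := (√(T : ℝ))⁻¹ • timeRows z with hZn
  set gi : Matrix (Fin r) Unit ℝ := replicateCol Unit (γ i) with hgi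
  set y : Matrix (Fin T) Unit ℝ := (√(T : ℝ))⁻¹ • replicateCol Unit ((timeRows η)ᵀ i) with hy
  have hstat := testStat_panelResponse (mu := mu) (beta := beta) (γ := γ) (Z := timeRows z)
    (η := timeRows η) H.T_pos hX hX1 hV HP.V_orth hi rfl
  have ngi : ‖gi‖ ≤ C := by
    refine norm_le_of_sum_sq_le hC0.le ?_
    simp only [hgi, replicateCol_apply, Finset.univ_unique, Finset.sum_singleton]
    have := H.gamma_le i
    nlinarith only [this, bg, b1, hC]
  have ny2 : ‖y‖ ^ 2 = (T : ℝ)⁻¹ * ∑ t, η t i ^ 2 := by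
    rw [norm_col_sq, Finset.mul_sum]
    refine Finset.sum_congr rfl fun t _ => ?_
    simp [hy, timeRows, mul_pow, Real.sq_sqrt hT.le]
  have nyS : |‖y‖ ^ 2 - S i i| ≤ 4 * ℓ := by
    have h := D.norm_noise i
    have e : ‖y‖ ^ 2 - S i i = (T : ℝ)⁻¹ * (∑ t, η t i ^ 2 - T * S i i) := by
      rw [ny2]; field_simp
    rw [e, abs_mul, abs_of_pos (inv_pos.2 hT)]
    calc _ ≤ (T : ℝ)⁻¹ * (T * (4 * ℓ)) := by gcongr
      _ = 4 * ℓ := by field_simp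
  have ny : ‖y‖ ≤ C := by
    refine (sq_le_sq₀ (norm_nonneg _) hC0.le).1 ?_
    have h1 := (abs_le.1 nyS).2
    have h2 := H.diag_le i
    nlinarith only [h1, h2, hℓ1, b1, hC]
  -- The noise of a unit is nearly uncorrelated in time with each projected factor, uniformly over
  -- the units at the price of √(log N); the squared length of each factor series is O(T) by the
  -- sample moments.
  have nZy : ‖Znᵀ * (Q * y)‖ ≤ C * ℓ := by
    have e : Znᵀ * (Q * y) =
        (T : ℝ)⁻¹ • ((timeRows z)ᵀ * (Q * replicateCol Unit ((timeRows η)ᵀ i))) := by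
      rw [hZn, hy, Matrix.transpose_smul, Matrix.smul_mul, Matrix.mul_smul, Matrix.mul_smul,
        smul_smul, ← sq, hθ2]
    rw [e]
    refine norm_smul_le_of_sum_sq_le (by positivity) (s := 4 * Real.log N * (2 * B ^ 2 * T)) ?_ ?_
    · have hz : ∀ k, ∑ t, z t k ^ 2 ≤ 2 * B * T := fun k => by
        have h1 : (∑ t, z t k ^ 2 - T) ^ 2 ≤ K * (2 * (r + 1) ^ 2 * T) := by
          refine le_trans ?_ D.moment
          refine le_trans ?_ (Finset.single_le_sum (f := fun k => ∑ l, (∑ t, z t k * z t l -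
            T * (1 : Matrix (Fin r) (Fin r) ℝ) k l) ^ 2)
            (fun k _ => Finset.sum_nonneg fun l _ => sq_nonneg _) (Finset.mem_univ k))
          refine le_trans (le_of_eq ?_) (Finset.single_le_sum (f := fun l => (∑ t, z t k * z t l -
            T * (1 : Matrix (Fin r) (Fin r) ℝ) k l) ^ 2)
            (fun l _ => sq_nonneg _) (Finset.mem_univ k))
          simp [sq]
        have h2 : (∑ t, z t k ^ 2 - T) ^ 2 ≤ (B * T) ^ 2 := by
          refine h1.trans ?_
          calc _ = 2 * K * (r + 1) ^ 2 * T := by ring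
            _ ≤ B * T := by gcongr
            _ ≤ (B * T) ^ 2 := by
              have : 1 ≤ B * T := by nlinarith only [b1, hT1]
              nlinarith only [this]
        have h3 := abs_le_of_sq_le_sq h2 (by positivity)
        have h4 := (abs_le.1 h3).2
        nlinarith only [h4, b1, hT]
      have hent : ∀ k, ((timeRows z)ᵀ * (Q * replicateCol Unit ((timeRows η)ᵀ i))) k () ^ 2 ≤
          4 * Real.log N * (2 * B * T) := fun k => by
        have e : ((timeRows z)ᵀ * (Q * replicateCol Unit ((timeRows η)ᵀ i))) k () =
            ∑ t, (∑ s, Q t s * z s k) * η t i := by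
          rw [← Matrix.mul_assoc, Matrix.mul_apply]
          refine Finset.sum_congr rfl fun t _ => ?_
          rw [Matrix.mul_apply]
          simp only [timeRows, Matrix.transpose_apply, Matrix.of_apply, replicateCol_apply]
          congr 1
          refine Finset.sum_congr rfl fun s _ => ?_
          have : Q s t = Q t s := congrFun (congrFun HP.Q_symm t) s
          rw [this, mul_comm]
        have h1 := D.proj_noise i k
        rw [e, ← sq_abs]
        calc _ ≤ (2 * √(Real.log N) * √(∑ t, z t k ^ 2)) ^ 2 := by gcongr
          _ = 4 * Real.log N * ∑ t, z t k ^ 2 := by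
            rw [mul_pow, mul_pow, Real.sq_sqrt hlog,
              Real.sq_sqrt (Finset.sum_nonneg fun t _ => sq_nonneg _)]; ring
          _ ≤ _ := by gcongr; exact hz k
      simp only [Finset.univ_unique, Finset.sum_singleton]
      calc _ ≤ ∑ k : Fin r, 4 * Real.log N * (2 * B * T) := Finset.sum_le_sum fun k _ => hent k
        _ = r * (4 * Real.log N * (2 * B * T)) := by simp
        _ ≤ B * (4 * Real.log N * (2 * B * T)) := by gcongr; linarith
        _ = _ := by ring
    · rw [mul_pow, hℓ, Real.sq_sqrt (by positivity)]
      calc _ = 8 * B ^ 2 * (Real.log N / T) := by field_simp; ring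
        _ ≤ C ^ 2 * (Real.log N / T) := by
          gcongr
          nlinarith only [hC, b1]
  refine ⟨_, _, hstat, ?_, ?_⟩
  · have h1 := HP.numerator_bound ngi ny hTℓ nZy
    rw [norm_unit_matrix] at h1
    have e : √(T : ℝ) * ((PCASystem.residualDir w V)ᵀ * (Q * (Zn * gi + y))) () () -
        ∑ t, unitDir X t * η t i =
        √(T : ℝ) * ((PCASystem.residualDir w V)ᵀ * (Q * (Zn * gi + y)) - wᵀ * y) () () := by
      rw [Matrix.sub_apply, mul_sub]
      congr 1
      rw [hy, Matrix.mul_smul, Matrix.smul_apply, smul_eq_mul, mul_inv_cancel_left₀ hsT.ne',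
        Matrix.mul_apply]
      rfl
    rw [e, abs_mul, abs_of_pos hsT]
    refine (mul_le_mul_of_nonneg_left h1 hsT.le).trans (le_of_eq ?_)
    rw [adjustmentRate, ← hℓ]
    field_simp
  · have h1 := HP.variance_bound ngi (by linarith) ny hTℓ nZy
    rw [norm_col_sq] at h1
    have e : ‖(1 - Q) * y‖ ^ 2 = explainedNoise X η i := by
      rw [norm_col_sq, explainedNoise, Finset.mul_sum]
      refine Finset.sum_congr rfl fun t _ => ?_
      rw [hy, Matrix.mul_smul, Matrix.smul_apply, smul_eq_mul, mul_pow, hθ2, Matrix.mul_apply]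
      rfl
    rw [e] at h1
    refine (abs_sub_le _ (‖y‖ ^ 2) _).trans ?_
    linarith

/-- On a good draw the proportion of rejected true nulls is close to the nominal level. -/
lemma GoodDraw.abs_falseRejections_sub_le (H : Regular S mu γ T p K κ g Cm c B)
    (hX : IsUnit (Xᵀ * X).det) (hX1 : oneQOne X ≠ 0)
    (hv : IsLeadingEigenvectors
      (pcaMatrix X (panelResponse mu beta γ X (timeRows z) (timeRows η))) v)
    {C : ℝ} (hC : 3 * B ≤ C) (hC' : 16 * B ^ 2 / c ^ 2 ≤ C)
    (hs : 60 * C ^ 9 * √((T : ℝ)⁻¹ + κ) ≤ 1) (hℓ : ℓ = √(Real.log N / T))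
    (hℓ1 : 4 * ℓ ≤ 1) (hTℓ : (√(T : ℝ))⁻¹ ≤ ℓ) {s₀ : ℝ} (hs₀ : 0 < s₀)
    (hS : ∀ i, s₀ ^ 2 ≤ S i i) {s : ℝ} (hlev : 0 < lev)
    (hlevs : (gaussianReal 0 1).real {x | lev ≤ |x|} = s)
    (hlev2 : ∀ x, 2 * stdNormalCDF (-|x|) ≤ s ↔ lev ≤ |x|) {D₁ D₂ : ℝ} (hD₁ : D₁ = 431 * C ^ 15)
    (hD₂ : D₂ = 5 + 4190 * C ^ 20) (hsm : D₂ * adjustmentRate N T κ mu ≤ s₀ ^ 2 / 2)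
    (D : GoodDraw S γ p K ((N * κ) ^ 2) ((r + 1) * g * (N * κ) ^ 2) ℓ lev
      ((D₁ / s₀ + lev * (D₂ / s₀ ^ 2)) * adjustmentRate N T κ mu)
      (fun t s => residualMaker X t s) (unitDir X) z η) :
    |(falseRejections mu
        (pValue X (panelResponse mu beta γ X (timeRows z) (timeRows η)) v) s : ℝ) / N - s| ≤
      (1 + K * (p + 1) + 4 * K * (D₁ / s₀ + lev * (D₂ / s₀ ^ 2)) + √(8 * K * (lev + 2))) *
        (adjustmentRate N T κ mu + ((Finset.univ.filter fun i => mu i ≠ 0).card : ℝ) / N) := by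
  have hN : (0 : ℝ) < N := by exact_mod_cast H.N_pos
  have hT : (0 : ℝ) < T := by exact_mod_cast H.T_pos
  have hκ := H.kappa_pos
  have hK := H.K_pos
  have hC0 : 0 < C := by linarith [H.budget.1]
  have hD₁0 : 0 < D₁ := by rw [hD₁]; positivity
  have hD₂0 : 0 < D₂ := by rw [hD₂]; positivity
  set a := adjustmentRate N T κ mu with ha
  have hℓ0 : 0 < ℓ := (inv_pos.2 (Real.sqrt_pos.2 hT)).trans_le hTℓ
  have haℓ : ℓ + κ ≤ a := by
    rw [ha, adjustmentRate, ← hℓ]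
    have : 0 ≤ √(T : ℝ) * ‖mu‖ / √(N : ℝ) * √((T : ℝ)⁻¹ + κ) := by positivity
    linarith
  have ha0 : 0 < a := by linarith
  set P := pValue X (panelResponse mu beta γ X (timeRows z) (timeRows η)) v with hP
  set ξ := IsGaussianArray.stdProj S (unitDir X) η with hξ
  set N1 := ((Finset.univ.filter fun i => mu i ≠ 0).card : ℝ) with hN1
  set b := (D₁ / s₀ + lev * (D₂ / s₀ ^ 2)) * a with hb
  -- The indicators differ for three reasons only: a false null, a unit whose noise is unusually
  -- well explained by the design, or an idealised statistic near the critical value. The second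
  -- cannot be excluded uniformly, as the leverages of the design are unrestricted, so it is charged
  -- ℓ⁻¹ times the explained part and counted on average.
  have hpoint : ∀ i, |(if mu i = 0 ∧ P i ≤ s then (1 : ℝ) else 0) -
      (if lev ≤ |ξ i| then 1 else 0)| ≤ (if mu i ≠ 0 then (1 : ℝ) else 0) +
        ℓ⁻¹ * explainedNoise X η i + (if |(|ξ i| - lev)| ≤ b then (1 : ℝ) else 0) := by
    intro i
    have hx0 : 0 ≤ explainedNoise X η i :=
      mul_nonneg (inv_nonneg.2 hT.le) (Finset.sum_nonneg fun t _ => sq_nonneg _)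
    have hx1 : 0 ≤ ℓ⁻¹ * explainedNoise X η i := by positivity
    have hle1 : |(if mu i = 0 ∧ P i ≤ s then (1 : ℝ) else 0) -
      (if lev ≤ |ξ i| then 1 else 0)| ≤ 1 := by split_ifs <;> simp
    have hn0 : (0 : ℝ) ≤ if |(|ξ i| - lev)| ≤ b then (1 : ℝ) else 0 := by split_ifs <;> simp
    by_cases hmu : mu i = 0
    · by_cases hbad : ℓ < explainedNoise X η i
      · have : 1 ≤ ℓ⁻¹ * explainedNoise X η i := by
          rw [← inv_mul_cancel₀ hℓ0.ne']; gcongr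
        simp only [hmu, ne_eq, not_true, if_false] at *
        linarith
      · by_cases hnear : |(|ξ i| - lev)| ≤ b
        · simp only [hmu, hnear, ne_eq, not_true, if_false, if_true] at *
          linarith
        · obtain ⟨num, var, h1, h2, h3⟩ :=
            D.exists_testStat_eq H hX hX1 hv hC hC' hs hℓ hℓ1 hTℓ hmu
          rw [← hD₁, ← ha] at h2
          have h4 : |var - S i i| ≤ D₂ * a := by
            refine h3.trans ?_
            calc _ ≤ ℓ + 4 * ℓ + 4190 * C ^ 20 * (ℓ + κ) := by gcongr; exact not_lt.1 hbad
              _ ≤ D₂ * (ℓ + κ) := by rw [hD₂, add_mul]; linarith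
              _ ≤ D₂ * a := by gcongr
          have h5 : ¬ |(|(∑ t, unitDir X t * η t i) / √(S i i)| - lev)| ≤
              D₁ * a / s₀ + lev * (D₂ * a / s₀ ^ 2) := by
            refine fun h => hnear (h.trans (le_of_eq ?_))
            rw [hb]; ring
          have key := level_le_abs_div_iff hs₀ (hS i) hlev.le h2 h4 hsm h5
          have hiff : P i ≤ s ↔ lev ≤ |ξ i| := by
            have : P i = 2 * stdNormalCDF (-|num / √var|) := by rw [hP, pValue, h1]
            rw [this, hlev2, key]; rfl
          simp only [hmu, true_and, hiff, sub_self, abs_zero]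
          positivity
    · simp only [hmu, ne_eq, not_false_eq_true, if_true] at *
      linarith
  have hsum : |∑ i, ((if mu i = 0 ∧ P i ≤ s then (1 : ℝ) else 0) -
      (if lev ≤ |ξ i| then 1 else 0))| ≤ N1 + K * (p + 1) * N * ℓ + K * (N * (4 * b)) := by
    refine (Finset.abs_sum_le_sum_abs _ _).trans ((Finset.sum_le_sum fun i _ => hpoint i).trans ?_)
    rw [Finset.sum_add_distrib, Finset.sum_add_distrib]
    refine add_le_add (add_le_add ?_ ?_) D.near
    · rw [hN1, Finset.sum_boole]
    · rw [← Finset.mul_sum]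
      have h1 : ∑ i, explainedNoise X η i ≤ (T : ℝ)⁻¹ * (K * ((p + 1) * N)) := by
        have := D.coProj_noise
        rw [Finset.sum_comm] at this
        simp only [explainedNoise, ← Finset.mul_sum]
        gcongr
      -- The explained parts sum to O(N/T); this bound turns the resulting ℓ⁻¹N/T into Nℓ.
      have h2 : (T : ℝ)⁻¹ ≤ ℓ ^ 2 := by
        have := pow_le_pow_left₀ (by positivity) hTℓ 2
        rwa [inv_pow, Real.sq_sqrt hT.le] at this
      calc _ ≤ ℓ⁻¹ * (ℓ ^ 2 * (K * ((p + 1) * N))) := by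
            gcongr
            exact h1.trans (by gcongr)
        _ = _ := by field_simp
  have hcount : |∑ i, ((if lev ≤ |ξ i| then (1 : ℝ) else 0) - s)| ≤
      √(8 * K * (lev + 2)) * (N * κ) := by
    refine abs_le_of_sq_le_sq ?_ (by positivity)
    rw [mul_pow, Real.sq_sqrt (by positivity)]
    have := D.count
    rw [hlevs] at this
    refine this.trans (le_of_eq (by ring))
  have hV : (falseRejections mu P s : ℝ) = ∑ i, (if mu i = 0 ∧ P i ≤ s then (1 : ℝ) else 0) := by
    rw [falseRejections, Finset.sum_boole]
  have hdec : (falseRejections mu P s : ℝ) - N * s =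
      ∑ i, ((if mu i = 0 ∧ P i ≤ s then (1 : ℝ) else 0) - (if lev ≤ |ξ i| then 1 else 0)) +
        ∑ i, ((if lev ≤ |ξ i| then (1 : ℝ) else 0) - s) := by
    rw [hV, ← Finset.sum_add_distrib]
    simp
  have htot : |(falseRejections mu P s : ℝ) - N * s| ≤
      N1 + K * (p + 1) * N * ℓ + K * (N * (4 * b)) + √(8 * K * (lev + 2)) * (N * κ) := by
    rw [hdec]
    exact (abs_add_le _ _).trans (add_le_add hsum hcount)
  rw [show (falseRejections mu P s : ℝ) / N - s = (falseRejections mu P s - N * s) / N by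
    field_simp, abs_div, abs_of_pos hN, div_le_iff₀ hN]
  refine htot.trans ?_
  have hN10 : 0 ≤ N1 := by positivity
  set A₁ := K * ((p : ℝ) + 1) with hA₁
  set A₂ := D₁ / s₀ + lev * (D₂ / s₀ ^ 2) with hA₂
  set A₃ := √(8 * K * (lev + 2)) with hA₃
  have p1 : 0 ≤ A₁ := by positivity
  have p2 : 0 ≤ A₂ := by positivity
  have p3 : 0 ≤ A₃ := by positivity
  have e1 : (1 + A₁ + 4 * K * A₂ + A₃) * (a + N1 / N) * N =
      (1 + A₁ + 4 * K * A₂ + A₃) * N1 + (1 + A₁ + 4 * K * A₂ + A₃) * (a * N) := by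
    field_simp; ring
  rw [e1]
  have q1 : N1 ≤ (1 + A₁ + 4 * K * A₂ + A₃) * N1 := by
    refine le_mul_of_one_le_left hN10 ?_
    have : 0 ≤ 4 * K * A₂ := by positivity
    linarith
  have q2 : A₁ * N * ℓ ≤ A₁ * (a * N) := by
    rw [mul_assoc, mul_comm a]; gcongr; linarith
  have q3 : A₃ * (N * κ) ≤ A₃ * (a * N) := by
    rw [mul_comm a]; gcongr; linarith
  have q4 : 0 ≤ a * N := by positivity
  rw [hb]
  linarith only [q1, q2, q3, q4]

end NullStatistics

/-! ### Measurability of the projection and direction of the design. -/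

section Design

variable {T p : ℕ}

/-- The residual maker and the normalised intercept direction of a design. -/
def designProjection (x : Fin T → EuclideanSpace ℝ (Fin p)) :
    (Fin T → Fin T → ℝ) × (Fin T → ℝ) :=
  (fun t s => residualMaker (timeRows x) t s, unitDir (timeRows x))

/-- The inverse is the adjugate divided by the determinant, with division by zero giving zero, hence
measurable everywhere. Thereby the independence of the design from factors and noise passes to (Q,
w). -/
lemma measurable_designProjection : Measurable (designProjection (T := T) (p := p)) := by
  have hX : Continuous fun x : Fin T → EuclideanSpace ℝ (Fin p) => timeRows x :=
    continuous_matrix fun t k => by simp only [timeRows, Matrix.of_apply]; fun_prop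
  have hG : Continuous fun x : Fin T → EuclideanSpace ℝ (Fin p) => (timeRows x)ᵀ * timeRows x :=
    hX.matrix_transpose.matrix_mul hX
  have hinv : ∀ k l, Measurable fun x : Fin T → EuclideanSpace ℝ (Fin p) =>
      ((timeRows x)ᵀ * timeRows x)⁻¹ k l := fun k l => by
    simp only [Matrix.inv_def, Ring.inverse_eq_inv', Matrix.smul_apply, smul_eq_mul]
    exact hG.matrix_det.measurable.inv.mul (hG.matrix_adjugate.matrix_elem k l).measurable
  have hrow : ∀ t k, Measurable fun x : Fin T → EuclideanSpace ℝ (Fin p) => timeRows x t k :=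
    fun t k => (hX.matrix_elem t k).measurable
  have hQ : ∀ t s, Measurable fun x : Fin T → EuclideanSpace ℝ (Fin p) =>
      residualMaker (timeRows x) t s := fun t s => by
    simp only [residualMaker, Matrix.sub_apply, Matrix.mul_apply, Matrix.transpose_apply]
    refine measurable_const.sub (Finset.measurable_sum _ fun k _ => Measurable.mul
      (Finset.measurable_sum _ fun l _ => (hrow t l).mul (hinv l k)) (hrow s k))
  have hQ1 : ∀ t, Measurable fun x : Fin T → EuclideanSpace ℝ (Fin p) =>
      (residualMaker (timeRows x) *ᵥ 1) t := fun t => by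
    simp only [Matrix.mulVec, dotProduct]
    exact Finset.measurable_sum _ fun s _ => (hQ t s).mul_const _
  have hq : Measurable fun x : Fin T → EuclideanSpace ℝ (Fin p) => oneQOne (timeRows x) := by
    simp only [oneQOne, dotProduct]
    exact Finset.measurable_sum _ fun s _ => (hQ1 s).const_mul _
  refine Measurable.prodMk ?_ ?_
  · exact measurable_pi_lambda _ fun t => measurable_pi_lambda _ fun s => hQ t s
  · refine measurable_pi_lambda _ fun t => ?_
    simp only [unitDir, Pi.smul_apply, smul_eq_mul]
    exact hq.sqrt.inv.mul (hQ1 t)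

end Design

/-- The quadratic form at S j j · eᵢ − S i j · eⱼ equals S j j (S i i S j j − (S i j)²). -/
lemma sq_apply_le_of_posSemidef {n : ℕ} {S : Matrix (Fin n) (Fin n) ℝ} (hS : S.PosSemidef)
    (hd : ∀ i, 0 < S i i) (i j : Fin n) : S i j ^ 2 ≤ S i i * S j j := by
  have hs : S j i = S i j := by
    have := congrFun (congrFun hS.isHermitian i) j
    simpa [Matrix.conjTranspose_apply] using this
  have h := hS.dotProduct_mulVec_nonneg (Pi.single i (S j j) - Pi.single j (S i j))
  rw [star_trivial, Matrix.mulVec_sub, sub_dotProduct, dotProduct_sub, dotProduct_sub] at h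
  simp only [single_dotProduct, Matrix.mulVec_single, Pi.smul_apply, Matrix.col_apply,
    MulOpposite.smul_eq_mul_unop, MulOpposite.unop_op, hs] at h
  have h2 : 0 ≤ S j j * (S i i * S j j - S i j ^ 2) := by nlinarith only [h]
  have := nonneg_of_mul_nonneg_right h2 (hd j)
  linarith

/-! ### Covariance bounds for the panel and the probability bound. -/

namespace Panel

variable {N T p r : ℕ} {Ω : Type*} [MeasurableSpace Ω] {P : Measure Ω} [IsProbabilityMeasure P]
  (M : Panel N T p r Ω P)

lemma isGaussianArray_Z : IsGaussianArray P 1 M.Z where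
  posSemidef := Matrix.PosSemidef.one
  measurable := M.measurable_Z
  law t := by rw [multivariateGaussian_zero_one]; exact M.law_Z t
  indep := M.indep_Z

lemma isGaussianArray_eta : IsGaussianArray P M.SigmaEta M.eta where
  posSemidef := M.posSemidef_SigmaEta
  measurable := M.measurable_eta
  law := M.law_eta
  indep := M.indep_eta

lemma Y_eq (ω : Ω) : M.Y ω = panelResponse M.mu M.beta M.gamma (M.design ω)
    (timeRows fun t => M.Z t ω) (timeRows fun t => M.eta t ω) := by
  ext i t
  simp [Y, error, panelResponse, design, timeRows, Matrix.mul_apply, dotProduct]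

lemma variance_eta (t : Fin T) (i : Fin N) :
    variance (fun ω => M.eta t ω i) P = M.SigmaEta i i := by
  have hg := M.isGaussianArray_eta
  have h := hg.variance_linForm fun s j =>
    (Pi.single t 1 : Fin T → ℝ) s * (Pi.single i 1 : Fin N → ℝ) j
  rw [covForm_outer, sum_single_mul_single] at h
  have e : linForm M.eta (fun s j => (Pi.single t 1 : Fin T → ℝ) s *
      (Pi.single i 1 : Fin N → ℝ) j) = fun ω => M.eta t ω i := by
    ext ω
    rw [linForm_outer_single, Finset.sum_eq_single t]
    · simp
    · intro s _ hs; simp [hs]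
    · simp
  have e2 : ∑ s, (Pi.single t 1 : Fin T → ℝ) s * (Pi.single t 1 : Fin T → ℝ) s = 1 := by
    rw [Finset.sum_eq_single t]
    · simp
    · intro s _ hs; simp [hs]
    · simp
  rw [e, e2, one_mul] at h
  exact h

/-- The idiosyncratic variances are bounded by the variance of the response. -/
lemma SigmaEta_diag_le (hT : 0 < T) (i : Fin N) : M.SigmaEta i i ≤ 1 := by
  have t : Fin T := ⟨0, hT⟩
  have hmX := M.measurable_X
  have hmZ := M.measurable_Z
  have hmη := M.measurable_eta
  set A : Ω → ℝ := fun ω => M.beta i ⬝ᵥ (M.X t ω).ofLp with hA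
  set W : Ω → ℝ := fun ω => M.gamma i ⬝ᵥ (M.Z t ω).ofLp with hW
  set U : Ω → ℝ := fun ω => M.eta t ω i with hU
  have hAm : Measurable A := by simp only [hA, dotProduct]; fun_prop
  have hWm : Measurable W := by simp only [hW, dotProduct]; fun_prop
  have hUm : Measurable U := by simp only [hU]; fun_prop
  have hW2 : MemLp W 2 P := by
    have h := (M.isGaussianArray_Z.hasGaussianLaw_linForm fun s k =>
      (Pi.single t 1 : Fin T → ℝ) s * M.gamma i k).memLp_two
    have e : linForm M.Z (fun s k => (Pi.single t 1 : Fin T → ℝ) s * M.gamma i k) = W := by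
      ext ω; rw [linForm_single_outer]; rfl
    rwa [e] at h
  have hU2 : MemLp U 2 P := (M.isGaussianArray_eta.hasGaussianLaw_entry t i).memLp_two
  have hvar : variance (fun ω => M.mu i + A ω + W ω + U ω) P = 1 := M.var_Y i t
  -- The variance of a variable that is not square-integrable is zero by convention, so variance one
  -- already implies square-integrability.
  have hV2 : MemLp (fun ω => M.mu i + A ω + W ω + U ω) 2 P := by
    by_contra h
    have := evariance_eq_top (μ := P)
      (by fun_prop : Measurable fun ω => M.mu i + A ω + W ω + U ω).aestronglyMeasurable h
    rw [variance, this] at hvar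
    simp at hvar
  have hWU2 : MemLp (W + U) 2 P := hW2.add hU2
  -- Subtracting the Gaussian parts from the response leaves the regression term, so no second
  -- moment of the regressors has to be assumed.
  have hA2 : MemLp A 2 P := by
    have h := (hV2.sub hWU2).sub (memLp_const (M.mu i))
    refine h.congr_norm hAm.aestronglyMeasurable (Eventually.of_forall fun ω => ?_)
    simp only [Pi.sub_apply, Pi.add_apply]
    congr 1; ring
  have hind1 : IndepFun A (W + U) P := by
    have := M.indep_X.comp (φ := fun x : Fin T → EuclideanSpace ℝ (Fin p) =>
        M.beta i ⬝ᵥ (x t).ofLp)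
      (ψ := fun y : (Fin T → EuclideanSpace ℝ (Fin r)) × (Fin T → EuclideanSpace ℝ (Fin N)) =>
        M.gamma i ⬝ᵥ (y.1 t).ofLp + y.2 t i)
      (by simp only [dotProduct]; fun_prop) (by simp only [dotProduct]; fun_prop)
    exact this
  have hind2 : IndepFun W U P := by
    have := M.indep_Z_eta.comp (φ := fun x : Fin T → EuclideanSpace ℝ (Fin r) =>
        M.gamma i ⬝ᵥ (x t).ofLp)
      (ψ := fun y : Fin T → EuclideanSpace ℝ (Fin N) => y t i)
      (by simp only [dotProduct]; fun_prop) (by fun_prop)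
    exact this
  have e : (fun ω => M.mu i + A ω + W ω + U ω) = fun ω => (A + (W + U)) ω + M.mu i := by
    ext ω; simp only [Pi.add_apply]; ring
  rw [e, variance_add_const (hA2.add hWU2).aestronglyMeasurable, hind1.variance_add hA2 hWU2,
    hind2.variance_add hW2 hU2] at hvar
  have h1 := variance_nonneg A P
  have h2 := variance_nonneg W P
  have h3 : variance U P = M.SigmaEta i i := M.variance_eta t i
  linarith

/-- The root of the mean absolute correlation of the idiosyncratic errors. -/
def corrRoot : ℝ := √(∑ i, ∑ j, |M.corr i j|) / N

lemma sq_corrRoot (hN : 0 < N) : (N * M.corrRoot) ^ 2 = ∑ i, ∑ j, |M.corr i j| := by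
  have : (N : ℝ) ≠ 0 := by exact_mod_cast hN.ne'
  rw [corrRoot, mul_div_cancel₀ _ this, Real.sq_sqrt (by positivity)]

lemma corr_self {i : Fin N} (h : 0 < M.SigmaEta i i) : M.corr i i = 1 := by
  rw [corr, Real.sqrt_mul_self h.le, div_self h.ne']

lemma sum_abs_corr_ge (h : ∀ i, 0 < M.SigmaEta i i) : (N : ℝ) ≤ ∑ i, ∑ j, |M.corr i j| := by
  calc (N : ℝ) = ∑ i : Fin N, (1 : ℝ) := by simp
    _ ≤ _ := Finset.sum_le_sum fun i _ => by
      refine le_trans ?_ (Finset.single_le_sum (f := fun j => |M.corr i j|)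
        (fun j _ => abs_nonneg _) (Finset.mem_univ i))
      rw [M.corr_self (h i), abs_one]

lemma corrRoot_pos (hN : 0 < N) (h : ∀ i, 0 < M.SigmaEta i i) : 0 < M.corrRoot := by
  have hN' : (0 : ℝ) < N := by exact_mod_cast hN
  have := M.sum_abs_corr_ge h
  exact div_pos (Real.sqrt_pos.2 (by linarith)) hN'

lemma abs_corr_le_one (h : ∀ i, 0 < M.SigmaEta i i) (i j : Fin N) : |M.corr i j| ≤ 1 := by
  rw [corr, abs_div, abs_of_nonneg (Real.sqrt_nonneg _)]
  refine div_le_one_of_le₀ ?_ (Real.sqrt_nonneg _)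
  exact Real.abs_le_sqrt (sq_apply_le_of_posSemidef M.posSemidef_SigmaEta h i j)

/-- The variances are at most one, so standardising can only enlarge a covariance. -/
lemma abs_SigmaEta_le (hT : 0 < T) (h : ∀ i, 0 < M.SigmaEta i i) (i j : Fin N) :
    |M.SigmaEta i j| ≤ |M.corr i j| := by
  have h1 : 0 < √(M.SigmaEta i i * M.SigmaEta j j) := Real.sqrt_pos.2 (mul_pos (h i) (h j))
  have h2 : √(M.SigmaEta i i * M.SigmaEta j j) ≤ 1 := by
    rw [Real.sqrt_le_one]
    exact mul_le_one₀ (M.SigmaEta_diag_le hT i) (h j).le (M.SigmaEta_diag_le hT j)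
  rw [corr, abs_div, abs_of_pos h1]
  exact le_div_self (abs_nonneg _) h1 h2

/-- Correlations are at most one, so squares are below first powers. The same sum thus controls both
the Gram matrix of the noise and the exceedance count. -/
lemma sum_sq_SigmaEta_le (hT : 0 < T) (h : ∀ i, 0 < M.SigmaEta i i) :
    ∑ i, ∑ j, M.SigmaEta i j ^ 2 ≤ ∑ i, ∑ j, |M.corr i j| := by
  refine Finset.sum_le_sum fun i _ => Finset.sum_le_sum fun j _ => ?_
  have h1 := M.abs_SigmaEta_le hT h i j
  have h2 := M.abs_corr_le_one h i j
  rw [← sq_abs]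
  nlinarith [abs_nonneg (M.SigmaEta i j), abs_nonneg (M.corr i j)]

/-- Cauchy–Schwarz bounds the inner product of any two loading vectors by `g`. -/
lemma sum_loading_SigmaEta_le (hT : 0 < T) (h : ∀ i, 0 < M.SigmaEta i i) {g : ℝ}
    (hg : ∀ i, ∑ k, M.gamma i k ^ 2 ≤ g) :
    ∑ k, ∑ i, ∑ j, M.gamma i k * M.gamma j k * M.SigmaEta i j ≤
      g * ∑ i, ∑ j, |M.corr i j| := by
  rw [Finset.sum_comm, Finset.mul_sum]
  refine Finset.sum_le_sum fun i _ => ?_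
  rw [Finset.sum_comm, Finset.mul_sum]
  refine Finset.sum_le_sum fun j _ => ?_
  rw [← Finset.sum_mul]
  have hg0 : 0 ≤ g := (Finset.sum_nonneg fun k _ => sq_nonneg _).trans (hg i)
  have h1 : |∑ k, M.gamma i k * M.gamma j k| ≤ g := by
    refine abs_le_of_sq_le_sq ?_ hg0
    refine (Finset.sum_mul_sq_le_sq_mul_sq _ _ _).trans ?_
    rw [sq]
    exact mul_le_mul (hg i) (hg j) (Finset.sum_nonneg fun k _ => sq_nonneg _) hg0
  refine (le_abs_self _).trans ?_
  rw [abs_mul]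
  exact mul_le_mul h1 (M.abs_SigmaEta_le hT h i j) (abs_nonneg _) hg0

/-- Probability bound for the proportion of rejected true nulls. -/
lemma prob_falseRejections (v : Ω → Fin r → EuclideanSpace ℝ (Fin T))
    (hv : ∀ᵐ ω ∂P, IsLeadingEigenvectors (pcaMatrix (M.design ω) (M.Y ω)) (v ω))
    {K g Cm c B : ℝ} (H : Regular M.SigmaEta M.mu M.gamma T p K M.corrRoot g Cm c B)
    {C : ℝ} (hC : 3 * B ≤ C) (hC' : 16 * B ^ 2 / c ^ 2 ≤ C)
    (hs : 60 * C ^ 9 * √((T : ℝ)⁻¹ + M.corrRoot) ≤ 1)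
    (hℓ1 : 4 * √(Real.log N / T) ≤ 1) (hlogN : 1 ≤ Real.log N) {s₀ : ℝ} (hs₀ : 0 < s₀)
    (hS : ∀ i, s₀ ^ 2 ≤ M.SigmaEta i i) {s lev : ℝ} (hlev : 0 < lev)
    (hlevs : (gaussianReal 0 1).real {x | lev ≤ |x|} = s)
    (hlev2 : ∀ x, 2 * stdNormalCDF (-|x|) ≤ s ↔ lev ≤ |x|) {D₁ D₂ : ℝ} (hD₁ : D₁ = 431 * C ^ 15)
    (hD₂ : D₂ = 5 + 4190 * C ^ 20)
    (hsm : D₂ * adjustmentRate N T M.corrRoot M.mu ≤ s₀ ^ 2 / 2) :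
    P {ω | (1 + K * (p + 1) + 4 * K * (D₁ / s₀ + lev * (D₂ / s₀ ^ 2)) + √(8 * K * (lev + 2))) *
        (adjustmentRate N T M.corrRoot M.mu + (M.N1 : ℝ) / N) <
        |(falseRejections M.mu (M.pVal v ω) s : ℝ) / N - s|} ≤
      P {ω | IsUnit ((M.design ω)ᵀ * M.design ω).det ∧ oneQOne (M.design ω) ≠ 0}ᶜ +
        ENNReal.ofReal (11 / K + (2 + 2 * r) / N) := by
  have hN : (0 : ℝ) < N := by exact_mod_cast H.N_pos
  have hT : (0 : ℝ) < T := by exact_mod_cast H.T_pos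
  have hκ := H.kappa_pos
  have hC0 : 0 < C := by linarith [H.budget.1]
  have hTℓ : (√(T : ℝ))⁻¹ ≤ √(Real.log N / T) := by
    rw [← Real.sqrt_inv]
    refine Real.sqrt_le_sqrt ?_
    rw [div_eq_mul_inv]
    exact le_mul_of_one_le_left (by positivity) hlogN
  have ha0 : 0 < adjustmentRate N T M.corrRoot M.mu := by
    unfold adjustmentRate; positivity
  have hb : 0 < (D₁ / s₀ + lev * (D₂ / s₀ ^ 2)) * adjustmentRate N T M.corrRoot M.mu := by
    have h1 : 0 < D₁ := by rw [hD₁]; positivity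
    have h2 : 0 < D₂ := by rw [hD₂]; positivity
    positivity
  have hsq := M.sq_corrRoot H.N_pos
  have hg := H.g_pos
  have hgood := prob_not_goodDraw (p := p) (K := K) (γ := M.gamma) (lev := lev)
    (Γ := (N * M.corrRoot) ^ 2) (Λ := (r + 1) * g * (N * M.corrRoot) ^ 2)
    M.isGaussianArray_Z M.isGaussianArray_eta
    M.indep_Z_eta (A := fun ω => designProjection fun t => M.X t ω)
    (measurable_designProjection.comp (measurable_pi_lambda _ M.measurable_X))
    (M.indep_X.comp measurable_designProjection measurable_id) H.T_pos H.N_pos H.diag_pos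
    H.diag_le H.K_pos (by positivity) (by rw [hsq]; exact M.sum_sq_SigmaEta_le H.T_pos H.diag_pos)
    (by rw [hsq]; exact le_rfl) (by positivity)
    (by
      refine (M.sum_loading_SigmaEta_le H.T_pos H.diag_pos H.gamma_le).trans ?_
      rw [← hsq, mul_assoc]
      refine le_mul_of_one_le_left (by positivity) ?_
      have : (0 : ℝ) ≤ r := by positivity
      linarith) rfl hℓ1 hlev.le hb
  have hnull : P {ω | ¬ IsLeadingEigenvectors (pcaMatrix (M.design ω) (M.Y ω)) (v ω)} = 0 :=
    ae_iff.1 hv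
  -- The exceptional set consists of singular designs, the null set where `v` fails to be leading
  -- eigenvectors, and bad draws. Only monotonicity and subadditivity are used, so the choice of
  -- eigenvectors need not be measurable.
  refine (measure_mono ?_).trans ((measure_union_le _ _).trans (add_le_add le_rfl
    ((measure_union_le _ _).trans ((add_le_add hnull.le hgood).trans_eq (zero_add _)))))
  intro ω hω
  by_contra hcon
  simp only [Set.mem_union, Set.mem_compl_iff, Set.mem_ofPred_eq, not_or, not_not] at hcon
  obtain ⟨⟨hX, hX1⟩, hve, hG⟩ := hcon
  have hG := not_not.1 fun h => hG ⟨mem_projectionSet hX hX1, h⟩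
  rw [M.Y_eq] at hve
  have key := GoodDraw.abs_falseRejections_sub_le H hX hX1 hve hC hC' hs rfl hℓ1 hTℓ hs₀ hS hlev
    hlevs hlev2 hD₁ hD₂ hsm hG
  rw [← M.Y_eq] at key
  exact absurd key (not_le.2 hω)

end Panel

/-! ### Uniform positivity of the loading Gram matrix. -/

section PositiveDefinite

variable {r : ℕ}

/-- The form attains a positive minimum on the compact unit sphere, and homogeneity does the rest.
Without factors the sphere is empty and any constant serves. -/
lemma exists_quadratic_form_ge {S : Matrix (Fin r) (Fin r) ℝ} (hS : S.PosDef) :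
    ∃ c : ℝ, 0 < c ∧ ∀ y : Fin r → ℝ, c * ∑ k, y k ^ 2 ≤ y ⬝ᵥ (S *ᵥ y) := by
  set f : EuclideanSpace ℝ (Fin r) → ℝ := fun y => y.ofLp ⬝ᵥ (S *ᵥ y.ofLp) with hf
  have hfc : Continuous f := by
    simp only [hf, dotProduct, Matrix.mulVec]
    fun_prop
  have hpos : ∀ y : EuclideanSpace ℝ (Fin r), y ≠ 0 → 0 < f y := fun y hy => by
    have := hS.dotProduct_mulVec_pos (x := y.ofLp) (by simpa using hy)
    simpa using this
  have hscale : ∀ y : EuclideanSpace ℝ (Fin r), y ≠ 0 → f y = ‖y‖ ^ 2 * f (‖y‖⁻¹ • y) :=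
    fun y hy => by
    have : ‖y‖ ≠ 0 := norm_ne_zero_iff.2 hy
    simp only [hf, WithLp.ofLp_smul, Matrix.mulVec_smul, smul_dotProduct, dotProduct_smul,
      smul_eq_mul]
    field_simp
  have hsph : ∀ y : EuclideanSpace ℝ (Fin r), y ≠ 0 →
      ‖y‖⁻¹ • y ∈ Metric.sphere (0 : EuclideanSpace ℝ (Fin r)) 1 := fun y hy => by
    simp [norm_smul, norm_ne_zero_iff.2 hy]
  obtain ⟨c, hc, hcl⟩ : ∃ c : ℝ, 0 < c ∧
      ∀ u ∈ Metric.sphere (0 : EuclideanSpace ℝ (Fin r)) 1, c ≤ f u := by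
    rcases (Metric.sphere (0 : EuclideanSpace ℝ (Fin r)) 1).eq_empty_or_nonempty with h0 | h0
    · exact ⟨1, one_pos, by simp [h0]⟩
    · obtain ⟨u, hu, hmin⟩ := (isCompact_sphere _ _).exists_isMinOn h0 hfc.continuousOn
      refine ⟨f u, hpos u ?_, fun x hx => hmin hx⟩
      rintro rfl
      simp at hu
  refine ⟨c, hc, fun y => ?_⟩
  have hn : ∑ k, y k ^ 2 = ‖WithLp.toLp 2 y‖ ^ 2 := by simp [EuclideanSpace.norm_sq_eq]
  by_cases hy : WithLp.toLp 2 y = 0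
  · have : y = 0 := by simpa using hy
    simp [this]
  · have h1 := hscale _ hy
    have h2 := hcl _ (hsph _ hy)
    have h3 : f (WithLp.toLp 2 y) = y ⬝ᵥ (S *ᵥ y) := rfl
    rw [hn, ← h3, h1, mul_comm]
    gcongr

lemma abs_quadratic_form_le (A : Matrix (Fin r) (Fin r) ℝ) (y : Fin r → ℝ) :
    |y ⬝ᵥ (A *ᵥ y)| ≤ (∑ k, ∑ l, |A k l|) * ∑ k, y k ^ 2 := by
  have hy : ∀ k l, |y k| * |y l| ≤ ∑ k, y k ^ 2 := fun k l => by
    have h1 := Finset.single_le_sum (f := fun k => y k ^ 2) (fun k _ => sq_nonneg _)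
      (Finset.mem_univ k)
    have h2 := Finset.single_le_sum (f := fun k => y k ^ 2) (fun k _ => sq_nonneg _)
      (Finset.mem_univ l)
    nlinarith [sq_nonneg (|y k| - |y l|), sq_abs (y k), sq_abs (y l)]
  generalize ∑ k, y k ^ 2 = s at hy ⊢
  simp only [dotProduct, Matrix.mulVec, Finset.mul_sum, Finset.sum_mul]
  refine (Finset.abs_sum_le_sum_abs _ _).trans (Finset.sum_le_sum fun k _ => ?_)
  refine (Finset.abs_sum_le_sum_abs _ _).trans (Finset.sum_le_sum fun l _ => ?_)
  rw [abs_mul, abs_mul, mul_left_comm]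
  exact mul_le_mul_of_nonneg_left (hy k l) (abs_nonneg _)

/-- Entrywise convergence eventually costs at most half of the limiting constant. -/
lemma eventually_quadratic_form_ge {S : Matrix (Fin r) (Fin r) ℝ} (hS : S.PosDef)
    {A : ℕ → Matrix (Fin r) (Fin r) ℝ} (hA : Tendsto A atTop (𝓝 S)) :
    ∃ c : ℝ, 0 < c ∧ ∀ᶠ n in atTop, ∀ y : Fin r → ℝ,
      c ^ 2 * ∑ k, y k ^ 2 ≤ y ⬝ᵥ (A n *ᵥ y) := by
  obtain ⟨c, hc, h⟩ := exists_quadratic_form_ge hS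
  have hent : ∀ k l, Tendsto (fun n => A n k l) atTop (𝓝 (S k l)) := fun k l =>
    tendsto_pi_nhds.1 (tendsto_pi_nhds.1 hA k) l
  have hsum : Tendsto (fun n => ∑ k, ∑ l, |(A n - S) k l|) atTop (𝓝 0) := by
    have : Tendsto (fun n => ∑ k, ∑ l, |(A n - S) k l|) atTop
        (𝓝 (∑ k : Fin r, ∑ l : Fin r, |S k l - S k l|)) :=
      tendsto_finsetSum _ fun k _ => tendsto_finsetSum _ fun l _ =>
        ((hent k l).sub_const _).abs
    simpa using this
  refine ⟨√(c / 2), Real.sqrt_pos.2 (half_pos hc), ?_⟩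
  filter_upwards [hsum.eventually (gt_mem_nhds (half_pos hc))] with n hn y
  rw [Real.sq_sqrt (half_pos hc).le]
  have h1 := h y
  have h2 := (abs_le.1 (abs_quadratic_form_le (A n - S) y)).1
  rw [Matrix.sub_mulVec, dotProduct_sub] at h2
  have h0 : 0 ≤ ∑ k, y k ^ 2 := Finset.sum_nonneg fun k _ => sq_nonneg _
  have h3 := mul_le_mul_of_nonneg_right hn.le h0
  linarith

end PositiveDefinite

/-! ### Rates, and the proportion of rejected true nulls. -/

section Asymptotics

variable {p r : ℕ} {N T : ℕ → ℕ} {Ω : ℕ → Type*} [∀ n, MeasurableSpace (Ω n)]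
    {P : ∀ n, Measure (Ω n)} [∀ n, IsProbabilityMeasure (P n)]
    {M : ∀ n, Panel (N n) (T n) p r (Ω n) (P n)}

lemma tendsto_sqrt_log_div (hT : Tendsto T atTop atTop)
    (hC1 : ∃ a C : ℝ, 0 < a ∧ a < 1 / 2 ∧ 0 < C ∧
      ∀ᶠ n in atTop, Real.log (N n) ≤ C * (T n : ℝ) ^ a) :
    Tendsto (fun n => √(Real.log (N n) / T n)) atTop (𝓝 0) := by
  obtain ⟨a, C, -, ha, hC, h⟩ := hC1
  have hTR : Tendsto (fun n => (T n : ℝ)) atTop atTop := tendsto_natCast_atTop_atTop.comp hT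
  have h1 : Tendsto (fun n => C * (T n : ℝ) ^ (-(1 - a))) atTop (𝓝 0) := by
    have := ((tendsto_rpow_neg_atTop (show 0 < 1 - a by linarith)).comp hTR).const_mul C
    simpa using this
  have h2 : Tendsto (fun n => Real.log (N n) / T n) atTop (𝓝 0) := by
    refine tendsto_of_tendsto_of_tendsto_of_le_of_le' tendsto_const_nhds h1 ?_ ?_
    · exact Eventually.of_forall fun n => div_nonneg (Real.log_natCast_nonneg _) (Nat.cast_nonneg _)
    · filter_upwards [h, hT.eventually_gt_atTop 0] with n hn hn0
      have hn0 : (0 : ℝ) < T n := by exact_mod_cast hn0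
      rw [div_le_iff₀ hn0, mul_assoc]
      nth_rw 2 [← Real.rpow_one (T n : ℝ)]
      rw [← Real.rpow_add hn0]
      refine hn.trans (le_of_eq ?_)
      congr 2; ring
  simpa using h2.sqrt

/-- The diagonal contributes N and the off-diagonal part at most a constant times N^(2−δ); the
square root is subadditive. -/
lemma eventually_corrRoot_le (hN : Tendsto N atTop atTop) {δ : ℝ}
    (hweak : (fun n => (N n : ℝ) ^ (-2 + δ) *
        ∑ i, ∑ j, if i ≠ j then |(M n).corr i j| else 0) =O[atTop] fun _ => (1 : ℝ))
    (hpos : ∀ᶠ n in atTop, ∀ i, 0 < (M n).SigmaEta i i) :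
    ∃ C : ℝ, 0 < C ∧
      ∀ᶠ n in atTop, (M n).corrRoot ≤ (√(N n : ℝ))⁻¹ + C * (N n : ℝ) ^ (-δ / 2) := by
  obtain ⟨C, hC0, hC⟩ := hweak.exists_pos
  rw [Asymptotics.IsBigOWith] at hC
  refine ⟨√C, Real.sqrt_pos.2 hC0, ?_⟩
  filter_upwards [hC, hpos, hN.eventually_gt_atTop 0] with n hn hp hN0
  have hNR : (0 : ℝ) < N n := by exact_mod_cast hN0
  set O := ∑ i, ∑ j, if i ≠ j then |(M n).corr i j| else 0 with hO
  have hO0 : 0 ≤ O := Finset.sum_nonneg fun i _ => Finset.sum_nonneg fun j _ => by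
    split_ifs <;> simp
  rw [norm_one, mul_one, Real.norm_eq_abs,
    abs_of_nonneg (mul_nonneg (Real.rpow_nonneg hNR.le _) hO0)] at hn
  have hdec : ∑ i, ∑ j, |(M n).corr i j| = N n + O := by
    have : ∀ i, ∑ j, |(M n).corr i j| = 1 + ∑ j, if i ≠ j then |(M n).corr i j| else 0 := by
      intro i
      have h1 : ∀ j, |(M n).corr i j| = (if i = j then 1 else 0) +
          if i ≠ j then |(M n).corr i j| else 0 := fun j => by
        by_cases h : i = j
        · subst h; simp [(M n).corr_self (hp i)]
        · simp [h]
      rw [Finset.sum_congr rfl fun j _ => h1 j, Finset.sum_add_distrib]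
      simp
    simp only [this, Finset.sum_add_distrib, hO]
    simp
  have hO1 : O ≤ C * (N n : ℝ) ^ (-δ) * (N n : ℝ) ^ 2 := by
    have h1 : (N n : ℝ) ^ (-2 + δ) * ((N n : ℝ) ^ (-δ) * (N n : ℝ) ^ 2) = 1 := by
      rw [← Real.rpow_natCast (N n : ℝ) 2, ← Real.rpow_add hNR, ← Real.rpow_add hNR]
      simp
    have h2 : 0 ≤ (N n : ℝ) ^ (-δ) * (N n : ℝ) ^ 2 := by positivity
    calc O = O * ((N n : ℝ) ^ (-2 + δ) * ((N n : ℝ) ^ (-δ) * (N n : ℝ) ^ 2)) := by rw [h1, mul_one]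
      _ = (N n : ℝ) ^ (-2 + δ) * O * ((N n : ℝ) ^ (-δ) * (N n : ℝ) ^ 2) := by ring
      _ ≤ C * ((N n : ℝ) ^ (-δ) * (N n : ℝ) ^ 2) := by gcongr
      _ = _ := by ring
  rw [Panel.corrRoot, hdec, div_le_iff₀ hNR]
  refine Real.sqrt_le_iff.2 ⟨by positivity, ?_⟩
  have h3 : (√C * (N n : ℝ) ^ (-δ / 2)) ^ 2 = C * (N n : ℝ) ^ (-δ) := by
    rw [mul_pow, Real.sq_sqrt hC0.le, ← Real.rpow_mul_natCast hNR.le]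
    norm_num
  have h4 : ((√(N n : ℝ))⁻¹) ^ 2 * (N n : ℝ) ^ 2 = N n := by
    rw [inv_pow, Real.sq_sqrt hNR.le]; field_simp
  have h5 : 0 ≤ (√(N n : ℝ))⁻¹ * (√C * (N n : ℝ) ^ (-δ / 2)) := by positivity
  calc (N n : ℝ) + O ≤ ((√(N n : ℝ))⁻¹) ^ 2 * (N n : ℝ) ^ 2 +
        (√C * (N n : ℝ) ^ (-δ / 2)) ^ 2 * (N n : ℝ) ^ 2 := by rw [h3, h4]; linarith
    _ ≤ (((√(N n : ℝ))⁻¹) ^ 2 + (√C * (N n : ℝ) ^ (-δ / 2)) ^ 2 +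
        2 * ((√(N n : ℝ))⁻¹ * (√C * (N n : ℝ) ^ (-δ / 2)))) * (N n : ℝ) ^ 2 := by
      rw [← add_mul]
      exact mul_le_mul_of_nonneg_right (by linarith) (by positivity)
    _ = _ := by ring

lemma tendsto_corrRoot (hN : Tendsto N atTop atTop) {δ : ℝ} (hδ : 0 < δ)
    (hweak : (fun n => (N n : ℝ) ^ (-2 + δ) *
        ∑ i, ∑ j, if i ≠ j then |(M n).corr i j| else 0) =O[atTop] fun _ => (1 : ℝ))
    (hpos : ∀ᶠ n in atTop, ∀ i, 0 < (M n).SigmaEta i i) :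
    Tendsto (fun n => (M n).corrRoot) atTop (𝓝 0) := by
  obtain ⟨C, -, hC⟩ := eventually_corrRoot_le hN hweak hpos
  have hNR : Tendsto (fun n => (N n : ℝ)) atTop atTop := tendsto_natCast_atTop_atTop.comp hN
  have h1 : Tendsto (fun n => (√(N n : ℝ))⁻¹ + C * (N n : ℝ) ^ (-δ / 2)) atTop (𝓝 0) := by
    have h2 : Tendsto (fun n => (√(N n : ℝ))⁻¹) atTop (𝓝 0) :=
      tendsto_inv_atTop_zero.comp (Real.tendsto_sqrt_atTop.comp hNR)
    have h3 := ((tendsto_rpow_neg_atTop (half_pos hδ)).comp hNR).const_mul C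
    have := h2.add h3
    simpa [neg_div] using this
  exact tendsto_of_tendsto_of_tendsto_of_le_of_le' tendsto_const_nhds h1
    (Eventually.of_forall fun n => div_nonneg (Real.sqrt_nonneg _) (Nat.cast_nonneg _)) hC

lemma tendsto_sqrt_inv_add_corrRoot (hT : Tendsto T atTop atTop)
    (hκ : Tendsto (fun n => (M n).corrRoot) atTop (𝓝 0)) :
    Tendsto (fun n => √((T n : ℝ)⁻¹ + (M n).corrRoot)) atTop (𝓝 0) := by
  have hTR : Tendsto (fun n => (T n : ℝ)) atTop atTop := tendsto_natCast_atTop_atTop.comp hT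
  have := ((tendsto_inv_atTop_zero.comp hTR).add hκ).sqrt
  simpa using this

/-- The signal-to-noise factor need only stay bounded, because it multiplies h, which vanishes. -/
lemma tendsto_adjustmentRate (hT : Tendsto T atTop atTop)
    (hℓ : Tendsto (fun n => √(Real.log (N n) / T n)) atTop (𝓝 0))
    (hκ : Tendsto (fun n => (M n).corrRoot) atTop (𝓝 0)) {Cm : ℝ}
    (hq : ∀ᶠ n in atTop, √(T n : ℝ) * ‖(M n).mu‖ / √(N n : ℝ) ≤ Cm) :
    Tendsto (fun n => adjustmentRate (N n) (T n) (M n).corrRoot (M n).mu) atTop (𝓝 0) := by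
  have h1 := tendsto_sqrt_inv_add_corrRoot hT hκ
  have h2 : Tendsto (fun n => √(T n : ℝ) * ‖(M n).mu‖ / √(N n : ℝ) *
      √((T n : ℝ)⁻¹ + (M n).corrRoot)) atTop (𝓝 0) := by
    refine tendsto_of_tendsto_of_tendsto_of_le_of_le' tendsto_const_nhds
      (by simpa using h1.const_mul Cm) (Eventually.of_forall fun n => by positivity) ?_
    filter_upwards [hq] with n hn
    gcongr
  simpa [adjustmentRate] using (hℓ.add hκ).add h2

/-- The product qh is at most q² + h²: here q² is the term N⁻¹T‖μ‖², and h² = T⁻¹ + κ is absorbed.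
The part N^(-1/2) of κ is below √(log N/T), since eventually T < N and log N ≥ 1. -/
lemma eventually_adjustmentRate_le (hN : Tendsto N atTop atTop) (hT : Tendsto T atTop atTop)
    (hNT : Tendsto (fun n => (T n : ℝ) / N n) atTop (𝓝 0))
    (hℓ : Tendsto (fun n => √(Real.log (N n) / T n)) atTop (𝓝 0)) {δ C : ℝ} (hC : 0 < C)
    (hκ : ∀ᶠ n in atTop, (M n).corrRoot ≤ (√(N n : ℝ))⁻¹ + C * (N n : ℝ) ^ (-δ / 2)) :
    ∀ᶠ n in atTop, adjustmentRate (N n) (T n) (M n).corrRoot (M n).mu ≤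
      (4 + 2 * C) * ((N n : ℝ) ^ (-δ / 2) + √(Real.log (N n)) / √(T n : ℝ) +
        (N n : ℝ)⁻¹ * T n * ‖(M n).mu‖ ^ 2) := by
  have hNR : Tendsto (fun n => (N n : ℝ)) atTop atTop := tendsto_natCast_atTop_atTop.comp hN
  filter_upwards [hκ, hN.eventually_gt_atTop 0, hT.eventually_gt_atTop 0,
    hNT.eventually (gt_mem_nhds one_pos), hℓ.eventually (gt_mem_nhds one_pos),
    (Real.tendsto_log_atTop.comp hNR).eventually_ge_atTop 1] with n hn hN0 hT0 hTN hl hlog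
  have hN0 : (0 : ℝ) < N n := by exact_mod_cast hN0
  have hT0 : (0 : ℝ) < T n := by exact_mod_cast hT0
  simp only [Function.comp_apply] at hlog
  rw [div_lt_one hN0] at hTN
  set ℓ := √(Real.log (N n) / T n) with hℓd
  have hℓ2 : ℓ ^ 2 = Real.log (N n) / T n := Real.sq_sqrt (by positivity)
  have hℓ0 : 0 ≤ ℓ := Real.sqrt_nonneg _
  have hTℓ : (T n : ℝ)⁻¹ ≤ ℓ ^ 2 := by
    rw [hℓ2, div_eq_mul_inv]
    exact le_mul_of_one_le_left (by positivity) hlog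
  have hNℓ : (√(N n : ℝ))⁻¹ ≤ ℓ := by
    rw [← Real.sqrt_inv]
    refine Real.sqrt_le_sqrt (le_trans ?_ (hTℓ.trans hℓ2.le))
    gcongr
  have hℓe : √(Real.log (N n)) / √(T n : ℝ) = ℓ := by
    rw [hℓd, Real.sqrt_div (by linarith)]
  set κ := (M n).corrRoot with hκd
  have hκ0 : 0 ≤ κ := div_nonneg (Real.sqrt_nonneg _) hN0.le
  set q := √(T n : ℝ) * ‖(M n).mu‖ / √(N n : ℝ) with hq
  have hq2 : q ^ 2 = (N n : ℝ)⁻¹ * T n * ‖(M n).mu‖ ^ 2 := by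
    rw [hq, div_pow, mul_pow, Real.sq_sqrt hT0.le, Real.sq_sqrt hN0.le]; field_simp
  set h := √((T n : ℝ)⁻¹ + κ) with hh
  have hh2 : h ^ 2 = (T n : ℝ)⁻¹ + κ := Real.sq_sqrt (by positivity)
  have hqh : q * h ≤ q ^ 2 + h ^ 2 := by nlinarith only [sq_nonneg (q - h), sq_nonneg q, sq_nonneg h]
  rw [adjustmentRate, ← hℓd, ← hq, ← hh, hℓe, ← hq2]
  set D := (N n : ℝ) ^ (-δ / 2) with hD
  have hD0 : 0 ≤ D := by positivity
  have hℓℓ : ℓ ^ 2 ≤ ℓ := by nlinarith only [hℓ0, hl]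
  have hk : κ ≤ ℓ + C * D := by linarith
  have r1 : 0 ≤ C * ℓ := by positivity
  have r2 : 0 ≤ C * q ^ 2 := by positivity
  nlinarith only [hqh, hh2, hTℓ, hℓℓ, hk, hD0, sq_nonneg q, r1, r2]

/-- The proportion of rejected true nulls, at a level `s`. -/
lemma isBigOInProb_falseRejections (hT : Tendsto T atTop atTop) (hN : Tendsto N atTop atTop)
    (hX : WithHighProb P fun n =>
      {ω | IsUnit (((M n).design ω)ᵀ * (M n).design ω).det ∧ oneQOne ((M n).design ω) ≠ 0})
    (hℓ : Tendsto (fun n => √(Real.log (N n) / T n)) atTop (𝓝 0))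
    (hκ : Tendsto (fun n => (M n).corrRoot) atTop (𝓝 0)) {Cm : ℝ} (hCm : 0 < Cm)
    (hmu : ∀ᶠ n in atTop,
      ‖(M n).mu‖ ≤ Cm * min (√(N n : ℝ) / √(T n : ℝ)) ((N n : ℝ) / (T n * √((M n).N1 : ℝ))))
    (ha : Tendsto (fun n => adjustmentRate (N n) (T n) (M n).corrRoot (M n).mu) atTop (𝓝 0))
    {s₀ : ℝ} (hs₀ : 0 < s₀) (hS : ∀ᶠ n in atTop, ∀ i, s₀ ^ 2 ≤ (M n).SigmaEta i i)
    {c : ℝ} (hc : 0 < c) (hlow : ∀ᶠ n in atTop, ∀ y : Fin r → ℝ,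
      c ^ 2 * ∑ k, y k ^ 2 ≤ (N n : ℝ)⁻¹ * ∑ i, (∑ k, (M n).gamma i k * y k) ^ 2)
    {g : ℝ} (hg : 0 < g) (hγ : ∀ᶠ n in atTop, ∀ i, ∑ k, (M n).gamma i k ^ 2 ≤ g)
    (v : ∀ n, Ω n → Fin r → EuclideanSpace ℝ (Fin (T n)))
    (hv : ∀ᶠ n in atTop, ∀ᵐ ω ∂P n, IsLeadingEigenvectors
      (pcaMatrix ((M n).design ω) ((M n).Y ω)) (v n ω)) {s : ℝ} (hs0 : 0 ≤ s) (hs1 : s ≤ 1) :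
    IsBigOInProb P
      (fun n ω => (falseRejections (M n).mu ((M n).pVal (v n) ω) s : ℝ) / N n - s)
      (fun n => adjustmentRate (N n) (T n) (M n).corrRoot (M n).mu + ((M n).N1 : ℝ) / N n) := by
  have hpos : ∀ᶠ n in atTop, ∀ i, 0 < (M n).SigmaEta i i := by
    filter_upwards [hS] with n hn i using (by positivity : 0 < s₀ ^ 2).trans_le (hn i)
  have hb0 : ∀ n, 0 ≤ adjustmentRate (N n) (T n) (M n).corrRoot (M n).mu := fun n => by
    have : 0 ≤ (M n).corrRoot := div_nonneg (Real.sqrt_nonneg _) (Nat.cast_nonneg _)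
    unfold adjustmentRate; positivity
  intro ε hε
  -- Level zero arises for λ = 0: the p-values are positive, so nothing is rejected.
  rcases hs0.eq_or_lt with h0 | h0
  · refine ⟨1, one_pos, Eventually.of_forall fun n => ?_⟩
    have : {ω | 1 * (adjustmentRate (N n) (T n) (M n).corrRoot (M n).mu + ((M n).N1 : ℝ) / N n) <
        |(falseRejections (M n).mu ((M n).pVal (v n) ω) s : ℝ) / N n - s|} = ∅ := by
      ext ω
      have hz : falseRejections (M n).mu ((M n).pVal (v n) ω) s = 0 := by
        rw [falseRejections, Finset.card_eq_zero, Finset.filter_eq_empty_iff]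
        rintro i - ⟨-, hi⟩
        rw [← h0] at hi
        have := stdNormalCDF_pos (-|testStat ((M n).design ω) ((M n).Y ω) (v n ω) i|)
        simp only [Panel.pVal, pValue] at hi
        linarith
      have h3 := hb0 n
      simp only [Set.mem_ofPred_eq, Set.mem_empty_iff_false, iff_false, not_lt, one_mul]
      rw [hz, ← h0, Nat.cast_zero, zero_div, sub_self, abs_zero]
      positivity
    rw [this]; simp
  -- Level one arises for t = 1: everything is rejected and the error is exactly −N₁/N.
  rcases hs1.eq_or_lt with h1 | h1
  · refine ⟨1, one_pos, ?_⟩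
    filter_upwards [hN.eventually_gt_atTop 0] with n hN0
    have hNR : (0 : ℝ) < N n := by exact_mod_cast hN0
    have : {ω | 1 * (adjustmentRate (N n) (T n) (M n).corrRoot (M n).mu + ((M n).N1 : ℝ) / N n) <
        |(falseRejections (M n).mu ((M n).pVal (v n) ω) s : ℝ) / N n - s|} = ∅ := by
      ext ω
      have hz : (falseRejections (M n).mu ((M n).pVal (v n) ω) s : ℝ) = N n - (M n).N1 := by
        have e : falseRejections (M n).mu ((M n).pVal (v n) ω) s + (M n).N1 = N n := by
          rw [falseRejections, Panel.N1]
          have h2 : ∀ i, (M n).pVal (v n) ω i ≤ s := fun i => by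
            rw [h1]; exact two_mul_stdNormalCDF_neg_abs_le _
          simp only [h2, and_true]
          rw [Finset.card_filter_add_card_filter_not]
          simp
        have e2 : (falseRejections (M n).mu ((M n).pVal (v n) ω) s : ℝ) + (M n).N1 = N n := by
          exact_mod_cast e
        linarith
      have h3 := hb0 n
      have h4 : (((N n : ℝ) - (M n).N1) / N n - 1) = -((M n).N1 / N n) := by field_simp; ring
      have h5 : (0 : ℝ) ≤ (M n).N1 / N n := by positivity
      simp only [Set.mem_ofPred_eq, Set.mem_empty_iff_false, iff_false, not_lt]
      rw [hz, h1, h4, abs_neg, abs_of_nonneg h5]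
      linarith
    rw [this]; simp
  obtain ⟨lev, hlev, hlevs, hlev2⟩ := exists_critical_value h0 h1
  -- With this K the Markov bounds cost 11/K = ε/4. The uniform tail bounds take another ε/4, and
  -- the exceptional designs ε/2.
  obtain ⟨K, hK⟩ : ∃ K, K = 44 / ε := ⟨_, rfl⟩
  have hK0 : 0 < K := by rw [hK]; positivity
  obtain ⟨B, hB⟩ : ∃ B, B = 1 + g + Cm + K * (r + 1) + K * ((r + 1) * g) +
    2 * K * (r + 1) ^ 2 + g * Cm ^ 2 + K * ((p + 1) * (r + 1)) + r + 2 * K := ⟨_, rfl⟩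
  obtain ⟨C, hC⟩ : ∃ C, C = 3 * B + 16 * B ^ 2 / c ^ 2 := ⟨_, rfl⟩
  have hB0 : 0 < B := by rw [hB]; positivity
  have hC0 : 0 < C := by rw [hC]; positivity
  obtain ⟨D₁, hD₁⟩ : ∃ D₁, D₁ = 431 * C ^ 15 := ⟨_, rfl⟩
  obtain ⟨D₂, hD₂⟩ : ∃ D₂, D₂ = 5 + 4190 * C ^ 20 := ⟨_, rfl⟩
  have hD₁0 : 0 < D₁ := by rw [hD₁]; positivity
  have hD₂0 : 0 < D₂ := by rw [hD₂]; positivity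
  have hNR : Tendsto (fun n => (N n : ℝ)) atTop atTop := tendsto_natCast_atTop_atTop.comp hN
  have hh := tendsto_sqrt_inv_add_corrRoot hT hκ
  have t1 : Tendsto (fun n => 60 * C ^ 9 * √((T n : ℝ)⁻¹ + (M n).corrRoot)) atTop (𝓝 0) := by
    simpa using hh.const_mul (60 * C ^ 9)
  have t2 : Tendsto (fun n => 10 * B ^ 3 * √((T n : ℝ)⁻¹ + (M n).corrRoot)) atTop (𝓝 0) := by
    simpa using hh.const_mul (10 * B ^ 3)
  have t3 : Tendsto (fun n => 4 * √(Real.log (N n) / T n)) atTop (𝓝 0) := by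
    simpa using hℓ.const_mul 4
  have t4 : Tendsto (fun n => D₂ * adjustmentRate (N n) (T n) (M n).corrRoot (M n).mu) atTop
      (𝓝 0) := by
    simpa using ha.const_mul D₂
  have t5 : Tendsto (fun n => (2 + 2 * (r : ℝ)) / N n) atTop (𝓝 0) :=
    tendsto_const_nhds.div_atTop hNR
  have t6 : ∀ᶠ n in atTop, P n {ω | IsUnit (((M n).design ω)ᵀ * (M n).design ω).det ∧
      oneQOne ((M n).design ω) ≠ 0}ᶜ ≤ ENNReal.ofReal (ε / 2) :=
    (hX.eventually (gt_mem_nhds (ENNReal.ofReal_pos.2 (half_pos hε)))).mono fun n hn => le_of_lt hn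
  refine ⟨1 + K * (p + 1) + 4 * K * (D₁ / s₀ + lev * (D₂ / s₀ ^ 2)) + √(8 * K * (lev + 2)),
    by positivity, ?_⟩
  filter_upwards [t1.eventually (gt_mem_nhds one_pos), t2.eventually (gt_mem_nhds hc),
    t3.eventually (gt_mem_nhds one_pos), t4.eventually (gt_mem_nhds (show 0 < s₀ ^ 2 / 2 by
      positivity)), t5.eventually (gt_mem_nhds (show 0 < ε / 4 by positivity)), t6,
    hN.eventually_gt_atTop 0, hT.eventually_gt_atTop 0, hmu, hS, hpos, hlow, hγ, hv,
    (Real.tendsto_log_atTop.comp hNR).eventually_ge_atTop 1]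
    with n e1 e2 e3 e4 e5 e6 hN0 hT0 hmun hSn hposn hlown hγn hvn hlog
  have H : Regular (M n).SigmaEta (M n).mu (M n).gamma (T n) p K (M n).corrRoot g Cm c B :=
    { N_pos := hN0
      T_pos := hT0
      K_pos := hK0
      kappa_pos := (M n).corrRoot_pos hN0 hposn
      g_pos := hg
      Cm_pos := hCm
      c_pos := hc
      B_eq := hB
      diag_pos := hposn
      diag_le := (M n).SigmaEta_diag_le hT0
      gamma_le := hγn
      mu_le := hmun.trans (by gcongr; exact min_le_left _ _)
      mu_le' := hmun.trans (by gcongr; exact min_le_right _ _)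
      lower := hlown
      h_small := e2.le }
  have key := (M n).prob_falseRejections (v n) hvn H (C := C)
    (by rw [hC]; have : 0 ≤ 16 * B ^ 2 / c ^ 2 := by positivity
        linarith) (by rw [hC]; linarith) e1.le e3.le hlog hs₀ hSn hlev hlevs hlev2 hD₁ hD₂ e4.le
  refine key.trans ((add_le_add e6 (ENNReal.ofReal_le_ofReal (q := ε / 2) ?_)).trans_eq ?_)
  · have : 11 / K = ε / 4 := by rw [hK]; field_simp; norm_num
    linarith
  · rw [← ENNReal.ofReal_add (by positivity) (by positivity), add_halves]

end Asymptotics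

/-! ### From null rejections to false discovery proportions. -/

section FalseDiscovery

variable {N : ℕ}

lemma falseRejections_le_rejections (mu q : Fin N → ℝ) (s : ℝ) :
    falseRejections mu q s ≤ rejections q s :=
  Finset.card_le_card fun i hi => by
    simp only [Finset.mem_filter, Finset.mem_univ, true_and] at hi ⊢
    exact hi.2

lemma rejections_le_falseRejections_add (mu q : Fin N → ℝ) (s : ℝ) :
    rejections q s ≤ falseRejections mu q s + (Finset.univ.filter fun i => mu i ≠ 0).card := by
  rw [rejections, falseRejections]
  refine (Finset.card_le_card ?_).trans (Finset.card_union_le _ _)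
  intro i hi
  simp only [Finset.mem_filter, Finset.mem_univ, true_and, Finset.mem_union] at hi ⊢
  by_cases h : mu i = 0
  · exact .inl ⟨h, hi⟩
  · exact .inr h

/-- The Storey-type estimate is accurate when the proportions of rejected true nulls at the tuning
parameter and at the threshold are close to their nominal values. -/
lemma abs_FDRHat_sub_FDP_le (hN : 0 < N) (mu q : Fin N → ℝ) {lam t H : ℝ} (hlam : lam < 1)
    (ht₀ : 0 < t) (ht₁ : t ≤ 1) (hH : 0 < H) (hR : H ≤ (rejections q t : ℝ) / N) :
    |FDRHat q lam t - FDP mu q t| ≤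
      H⁻¹ * ((|(falseRejections mu q lam : ℝ) / N - lam| +
        ((Finset.univ.filter fun i => mu i ≠ 0).card : ℝ) / N) / (1 - lam) +
        |(falseRejections mu q t : ℝ) / N - t|) := by
  have hNR : (0 : ℝ) < N := by exact_mod_cast hN
  have hl : 0 < 1 - lam := by linarith
  set x := (falseRejections mu q lam : ℝ) / N - lam with hx
  set y := (falseRejections mu q t : ℝ) / N - t with hy
  set N1 := ((Finset.univ.filter fun i => mu i ≠ 0).card : ℝ) with hN1
  set W := (rejections q lam : ℝ) - falseRejections mu q lam with hW
  have hW0 : 0 ≤ W := by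
    have : (falseRejections mu q lam : ℝ) ≤ rejections q lam := by
      exact_mod_cast falseRejections_le_rejections mu q lam
    linarith
  have hW1 : W ≤ N1 := by
    have : (rejections q lam : ℝ) ≤ falseRejections mu q lam + N1 := by
      rw [hN1]; exact_mod_cast rejections_le_falseRejections_add mu q lam
    linarith
  set m := max (rejections q t : ℝ) 1 with hm
  have hm0 : 0 < m := lt_of_lt_of_le one_pos (le_max_right _ _)
  have hHm : H * N ≤ m := ((le_div_iff₀ hNR).1 hR).trans (le_max_left _ _)
  -- An exact identity with three sources of error: the null rejections at λ, the rejected false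
  -- nulls `W` at λ, lying between 0 and N₁, and the null rejections at t.
  have e : FDRHat q lam t - FDP mu q t =
      N / m * (-((x + W / N) / (1 - lam)) * t - y) := by
    rw [FDRHat, FDP, nullProportionHat, hx, hy, hW, ← hm]
    field_simp
    ring
  have hNm : N / m ≤ H⁻¹ := by
    rw [div_le_iff₀ hm0, ← div_eq_inv_mul, le_div_iff₀ hH]
    linarith
  rw [e, abs_mul, abs_of_pos (div_pos hNR hm0)]
  refine mul_le_mul hNm ?_ (abs_nonneg _) (inv_nonneg.2 hH.le)
  refine (abs_sub _ _).trans (add_le_add ?_ le_rfl)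
  rw [abs_mul, abs_neg, abs_of_pos ht₀, abs_div, abs_of_pos hl]
  refine (mul_le_of_le_one_right (by positivity) ht₁).trans ?_
  gcongr
  refine (abs_add_le _ _).trans (add_le_add le_rfl ?_)
  rw [abs_of_nonneg (by positivity)]
  gcongr

end FalseDiscovery

/-! ### Calculus of stochastic orders. -/

section InProbability

variable {Ω : ℕ → Type*} [∀ n, MeasurableSpace (Ω n)] {P : ∀ n, Measure (Ω n)}

lemma IsBigOInProb.mono {X : ∀ n, Ω n → ℝ} {a b : ℕ → ℝ} (h : IsBigOInProb P X a) {C : ℝ}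
    (hC : 0 < C) (hab : ∀ᶠ n in atTop, a n ≤ C * b n) : IsBigOInProb P X b := by
  intro ε hε
  obtain ⟨D, hD, h⟩ := h ε hε
  refine ⟨D * C, mul_pos hD hC, ?_⟩
  filter_upwards [h, hab] with n hn hn2
  refine (measure_mono fun ω (hω : D * C * b n < |X n ω|) => ?_).trans hn
  refine lt_of_le_of_lt ?_ hω
  rw [mul_assoc]
  gcongr

lemma IsBigOInProb.tendstoZeroInProb {X : ∀ n, Ω n → ℝ} {a : ℕ → ℝ} (h : IsBigOInProb P X a)
    (ha : Tendsto a atTop (𝓝 0)) : TendstoZeroInProb P X := by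
  intro ε hε
  refine ENNReal.tendsto_nhds_zero.2 fun η hη => ?_
  obtain ⟨η', hη', hη2⟩ : ∃ η' : ℝ, 0 < η' ∧ ENNReal.ofReal η' ≤ η := by
    rcases eq_or_ne η ⊤ with h | h
    · exact ⟨1, one_pos, by simp [h]⟩
    · exact ⟨η.toReal, ENNReal.toReal_pos hη.ne' h, by rw [ENNReal.ofReal_toReal h]⟩
  obtain ⟨C, hC, hX⟩ := h η' hη'
  have hCa : Tendsto (fun n => C * a n) atTop (𝓝 0) := by simpa using ha.const_mul C
  filter_upwards [hX, hCa.eventually (gt_mem_nhds hε)] with n hn hn2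
  exact (measure_mono fun ω (hω : ε ≤ _) => hn2.trans_le hω).trans (hn.trans hη2)

/-- Combination of two stochastic bounds on an event of high probability. -/
lemma IsBigOInProb.of_abs_le {X Y Z : ∀ n, Ω n → ℝ} {a : ℕ → ℝ} (hY : IsBigOInProb P Y a)
    (hZ : IsBigOInProb P Z a) {A : ∀ n, Set (Ω n)} (hA : WithHighProb P A) {C : ℝ} (hC : 0 < C)
    (h : ∀ᶠ n in atTop, ∀ ω ∈ A n, |X n ω| ≤ C * (|Y n ω| + |Z n ω| + a n)) :
    IsBigOInProb P X a := by
  intro ε hε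
  have hε3 : 0 < ε / 3 := by positivity
  obtain ⟨C₁, hC₁, h₁⟩ := hY (ε / 3) hε3
  obtain ⟨C₂, hC₂, h₂⟩ := hZ (ε / 3) hε3
  refine ⟨C * (C₁ + C₂ + 1), by positivity, ?_⟩
  filter_upwards [h₁, h₂, h, hA.eventually (gt_mem_nhds (ENNReal.ofReal_pos.2 hε3))]
    with n k₁ k₂ k k₃
  have hsub : {ω | C * (C₁ + C₂ + 1) * a n < |X n ω|} ⊆
      {ω | C₁ * a n < |Y n ω|} ∪ ({ω | C₂ * a n < |Z n ω|} ∪ (A n)ᶜ) := by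
    intro ω hω
    by_contra hcon
    simp only [Set.mem_union, Set.mem_ofPred_eq, Set.mem_compl_iff, not_or, not_lt, not_not] at hcon
    obtain ⟨c1, c2, c3⟩ := hcon
    have c4 := k ω c3
    have c5 : C * (|Y n ω| + |Z n ω| + a n) ≤ C * (C₁ * a n + C₂ * a n + a n) := by gcongr
    have c6 : C * (C₁ + C₂ + 1) * a n < |X n ω| := hω
    linarith
  refine (measure_mono hsub).trans ((measure_union_le _ _).trans ((add_le_add k₁
    ((measure_union_le _ _).trans (add_le_add k₂ k₃.le))).trans (le_of_eq ?_)))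
  rw [← ENNReal.ofReal_add hε3.le hε3.le, ← ENNReal.ofReal_add hε3.le (by positivity)]
  congr 1; ring

end InProbability

end FAT

end

/-! ### Assembling the bounds. -/

theorem theorem1 (p r : ℕ) (N T : ℕ → ℕ)
    {Ω : ℕ → Type*} [∀ n, MeasurableSpace (Ω n)]
    (P : ∀ n, Measure (Ω n)) [∀ n, IsProbabilityMeasure (P n)]
    (M : ∀ n, FAT.Panel (N n) (T n) p r (Ω n) (P n))
    -- `T → ∞`, `N → ∞` and `N ≫ T`
    (hT : Tendsto T atTop atTop) (hN : Tendsto N atTop atTop)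
    (hNT : Tendsto (fun n => (T n : ℝ) / N n) atTop (𝓝 0))
    -- the least squares intercept is well defined: `Xᵀ X` and `1ᵀ Q 1` are invertible
    (hX : FAT.WithHighProb P fun n =>
      {ω | IsUnit (((M n).design ω)ᵀ * (M n).design ω).det ∧ FAT.oneQOne ((M n).design ω) ≠ 0})
    -- sparsity: `π₀ = 1`
    (hsparse : Tendsto (fun n => ((M n).N0 : ℝ) / N n) atTop (𝓝 1))
    -- weak dependence of the idiosyncratic errors
    (δ : ℝ) (hδ : 0 < δ)
    (hweak : (fun n => (N n : ℝ) ^ (-2 + δ) *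
        ∑ i, ∑ j, if i ≠ j then |(M n).corr i j| else 0) =O[atTop] fun _ => (1 : ℝ))
    -- (C1)
    (hC1 : ∃ a C : ℝ, 0 < a ∧ a < 1 / 2 ∧ 0 < C ∧
      ∀ᶠ n in atTop, Real.log (N n) ≤ C * (T n : ℝ) ^ a)
    -- (C2); when `N₁ = 0` both sides are zero
    (hC2 : ∃ C : ℝ, 0 < C ∧ ∀ᶠ n in atTop,
      ‖(M n).mu‖ ≤ C * min (√(N n : ℝ) / √(T n : ℝ)) ((N n : ℝ) / (T n * √((M n).N1 : ℝ))))
    -- (C3)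
    (hC3 : ∃ s : ℝ, 0 < s ∧ ∀ᶠ n in atTop, ∀ i, s ^ 2 ≤ (M n).SigmaEta i i)
    -- (C4)
    (hC4 : ∃ S : Matrix (Fin r) (Fin r) ℝ, S.PosDef ∧
      Tendsto (fun n => (N n : ℝ)⁻¹ • ((M n).gammaᵀ * (M n).gamma)) atTop (𝓝 S))
    (hC4' : ∃ g : ℝ, 0 < g ∧ ∀ᶠ n in atTop, ∀ i, ∑ k, (M n).gamma i k ^ 2 ≤ g)
    -- (C5)
    (ν : ℝ) (hν : 0 < ν)
    (hC5 : ∃ (ψbar : ∀ n, Ω n → Fin r → EuclideanSpace ℝ (Fin (N n)))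
        (ψ : ∀ n, Fin r → EuclideanSpace ℝ (Fin (N n))),
      (∀ᶠ n in atTop, ∀ᵐ ω ∂P n, FAT.IsLeadingEigenvectors
        ((T n : ℝ)⁻¹ • ((M n).error ω * ((M n).error ω)ᵀ)) (ψbar n ω)) ∧
      (∀ᶠ n in atTop, FAT.IsLeadingEigenvectors (M n).SigmaE (ψ n)) ∧
      FAT.IsBigOInProb P (fun n ω => ⨆ k, ‖ψbar n ω k - ψ n k‖) fun n => (N n : ℝ) ^ (-ν))
    -- the principal component eigenvectors from which factors and loadings are estimated
    (v : ∀ n, Ω n → Fin r → EuclideanSpace ℝ (Fin (T n)))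
    (hv : ∀ᶠ n in atTop, ∀ᵐ ω ∂P n, FAT.IsLeadingEigenvectors
      (FAT.pcaMatrix ((M n).design ω) ((M n).Y ω)) (v n ω))
    -- the tuning parameter and the threshold
    (lam : ℝ) (hlam₀ : 0 ≤ lam) (hlam₁ : lam < 1) (t : ℝ) (ht₀ : 0 < t) (ht₁ : t ≤ 1)
    -- (C6)
    (hC6 : ∃ H : ℝ, 0 < H ∧ FAT.WithHighProb P fun n =>
      {ω | H ≤ (FAT.rejections ((M n).pVal (v n) ω) t : ℝ) / N n}) :
    FAT.IsBigOInProb P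
      (fun n ω => FAT.FDRHat ((M n).pVal (v n) ω) lam t
        - FAT.FDP (M n).mu ((M n).pVal (v n) ω) t)
      (fun n => (N n : ℝ) ^ (-δ / 2) + √(Real.log (N n)) / √(T n : ℝ) + (N n : ℝ) ^ (-ν)
        + ((M n).N1 : ℝ) / N n
        + (N n : ℝ)⁻¹ * T n * ‖(M n).mu‖ ^ 2
        + √((M n).N1 : ℝ) * (N n : ℝ)⁻¹ * T n * ‖(M n).mu‖) ∧
    FAT.TendstoZeroInProb P
      (fun n ω => FAT.FDRHat ((M n).pVal (v n) ω) lam t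
        - FAT.FDP (M n).mu ((M n).pVal (v n) ω) t) := by
  obtain ⟨Cm, hCm, hmu⟩ := hC2
  obtain ⟨s₀, hs₀, hS⟩ := hC3
  obtain ⟨S, hSpd, hlim⟩ := hC4
  obtain ⟨g, hg, hγ⟩ := hC4'
  obtain ⟨H, hH, hR⟩ := hC6
  have hpos : ∀ᶠ n in atTop, ∀ i, 0 < (M n).SigmaEta i i := by
    filter_upwards [hS] with n hn i using (by positivity : 0 < s₀ ^ 2).trans_le (hn i)
  have hℓ := FAT.tendsto_sqrt_log_div hT hC1
  have hκ := FAT.tendsto_corrRoot hN hδ hweak hpos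
  obtain ⟨Cκ, hCκ, hκle⟩ := FAT.eventually_corrRoot_le hN hweak hpos
  obtain ⟨c, hc, hlow'⟩ := FAT.eventually_quadratic_form_ge hSpd hlim
  have hlow : ∀ᶠ n in atTop, ∀ y : Fin r → ℝ,
      c ^ 2 * ∑ k, y k ^ 2 ≤ (N n : ℝ)⁻¹ * ∑ i, (∑ k, (M n).gamma i k * y k) ^ 2 := by
    filter_upwards [hlow'] with n hn y
    refine (hn y).trans (le_of_eq ?_)
    rw [Matrix.smul_mulVec, dotProduct_smul, smul_eq_mul, ← Matrix.mulVec_mulVec,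
      Matrix.dotProduct_mulVec, Matrix.vecMul_transpose]
    simp only [dotProduct, Matrix.mulVec, sq]
  have hq : ∀ᶠ n in atTop, √(T n : ℝ) * ‖(M n).mu‖ / √(N n : ℝ) ≤ Cm := by
    filter_upwards [hmu, hT.eventually_gt_atTop 0, hN.eventually_gt_atTop 0] with n hn hT0 hN0
    have hT0 : 0 < √(T n : ℝ) := Real.sqrt_pos.2 (by exact_mod_cast hT0)
    have hN0 : 0 < √(N n : ℝ) := Real.sqrt_pos.2 (by exact_mod_cast hN0)
    rw [div_le_iff₀ hN0]
    calc √(T n : ℝ) * ‖(M n).mu‖ ≤ √(T n : ℝ) * (Cm * (√(N n : ℝ) / √(T n : ℝ))) := by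
          gcongr
          exact hn.trans (by gcongr; exact min_le_left _ _)
      _ = Cm * √(N n : ℝ) := by field_simp
  have ha := FAT.tendsto_adjustmentRate hT hℓ hκ hq
  have hN1 : Tendsto (fun n => ((M n).N1 : ℝ) / N n) atTop (𝓝 0) := by
    have h1 : Tendsto (fun n => 1 - ((M n).N0 : ℝ) / N n) atTop (𝓝 0) := by
      simpa using hsparse.const_sub 1
    refine h1.congr' ?_
    filter_upwards [hN.eventually_gt_atTop 0] with n hn
    have hn : (0 : ℝ) < N n := by exact_mod_cast hn
    have e : ((M n).N0 : ℝ) + (M n).N1 = N n := by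
      have : (M n).N0 + (M n).N1 = N n := by
        rw [FAT.Panel.N0, FAT.Panel.N1, Finset.card_filter_add_card_filter_not]
        simp
      exact_mod_cast this
    rw [eq_div_iff hn.ne', sub_mul, div_mul_cancel₀ _ hn.ne']
    linarith
  -- Left general in the level, because it is applied both at λ (null proportion) and at t (false
  -- discoveries).
  have hV := fun {s : ℝ} => FAT.isBigOInProb_falseRejections (s := s) hT hN hX hℓ hκ hCm hmu ha hs₀
    hS hc hlow hg hγ v hv
  have hl : 0 < 1 - lam := by linarith
  have hrate0 : ∀ n, 0 ≤ FAT.adjustmentRate (N n) (T n) (M n).corrRoot (M n).mu := fun n => by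
    have : 0 ≤ (M n).corrRoot := div_nonneg (Real.sqrt_nonneg _) (Nat.cast_nonneg _)
    unfold FAT.adjustmentRate; positivity
  have hmain := FAT.IsBigOInProb.of_abs_le (hV hlam₀ hlam₁.le) (hV ht₀.le ht₁) hR
    (C := H⁻¹ * (1 - lam)⁻¹) (by positivity)
    (X := fun n ω => FAT.FDRHat ((M n).pVal (v n) ω) lam t
        - FAT.FDP (M n).mu ((M n).pVal (v n) ω) t) (by
      filter_upwards [hN.eventually_gt_atTop 0] with n hn ω hω
      refine (FAT.abs_FDRHat_sub_FDP_le hn (M n).mu _ hlam₁ ht₀ ht₁ hH hω).trans ?_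
      rw [mul_assoc]
      refine mul_le_mul_of_nonneg_left ?_ (inv_nonneg.2 hH.le)
      rw [div_eq_inv_mul, add_right_comm, mul_add (1 - lam)⁻¹ (_ + _)]
      have h1 : 1 ≤ (1 - lam)⁻¹ := (one_le_inv₀ hl).2 (by linarith)
      refine add_le_add ?_ (le_mul_of_one_le_left (abs_nonneg _) h1)
      refine mul_le_mul_of_nonneg_left (add_le_add le_rfl ?_) (inv_nonneg.2 hl.le)
      exact le_add_of_nonneg_left (hrate0 n))
  -- Consistency is read off the intermediate rate, `adjustmentRate` plus N₁/N, which tends to zero.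
  -- In the final rate the assumptions only keep N⁻¹T‖μ‖² bounded.
  refine ⟨hmain.mono (C := 5 + 2 * Cκ) (by positivity) ?_, hmain.tendstoZeroInProb ?_⟩
  · filter_upwards [FAT.eventually_adjustmentRate_le hN hT hNT hℓ hCκ hκle] with n hn
    have h1 : 0 ≤ (N n : ℝ) ^ (-ν) := by positivity
    have h2 : 0 ≤ √((M n).N1 : ℝ) * (N n : ℝ)⁻¹ * T n * ‖(M n).mu‖ := by positivity
    have h3 : 0 ≤ ((M n).N1 : ℝ) / N n := by positivity
    have h4 : 0 ≤ (N n : ℝ) ^ (-δ / 2) + √(Real.log (N n)) / √(T n : ℝ) +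
        (N n : ℝ)⁻¹ * T n * ‖(M n).mu‖ ^ 2 := by positivity
    have h5 : 0 ≤ Cκ * ((N n : ℝ) ^ (-ν) + ((M n).N1 : ℝ) / N n +
        √((M n).N1 : ℝ) * (N n : ℝ)⁻¹ * T n * ‖(M n).mu‖) := by positivity
    linarith
  · simpa using ha.add hN1
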